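/- **Theorem.** Let $X\subset\mathbb R^n$ and $Y\subset\mathbb R^m$ be nonempty, convex and compact. Let $f$ and $c=(c_1,\dots,c_p)$ be continuously differentiable on (a neighbourhood of) $X\times Y$ with gradients Lipschitz on $X\times Y$, and such that for every $x\in X$ the function $f(x,\cdot)$ is concave on $Y$, every $c_i(x,\cdot)$ is convex on $Y$, and $\{y\in Y: c(x,y)\le 0\}\neq\emptyset$. Consider the minimax problem with coupled constraints $$\text{(MCC)}\qquad \min_{x\in X}\max_{y\in Y}\{f(x,y)\mid c(x,y)\le 0\},\qquad f(x,y)=\mathbb E_{\xi\sim D}[F(x,y;\xi)].$$ Assume that at all points of $X\times Y$ the partial gradients $\nabla_xF(x,y;\xi)$, $\nabla_yF(x,y;\xi)$ exist, are measurable in $(x,y,\xi)$, are unbiased estimators of $\nabla_xf(x,y)$, $\nabla_yf(x,y)$ with variances at most $\delta^2$ for some constant $\delta>0$, and that for some constant $L_F>0$ $$\mathbb E_\xi\|\nabla_xF(x_1,y_1;\xi)-\nabla_xF(x_2,y_2;\xi)\|^2\le L_F^2(\|x_1-x_2\|^2+\|y_1-y_2\|^2).$$ For $\rho,\sigma>0$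 let $$\psi_{\rho,\sigma}(x,y)=f(x,y)-\tfrac{\rho}{2}\|[c(x,y)]_+\|^2-\tfrac{\sigma}{2}\|y\|^2,\qquad \varphi_{\rho,\sigma}(x)=\max_{y\in Y}\psi_{\rho,\sigma}(x,y),$$ and let $\mathcal P_C$ be the Euclidean projection onto $C$. *SPACO.* Let $(\rho_k),(\sigma_k),(\alpha_k),(\beta_k),(\eta_k)_{k\ge0}$ be positive sequences, and write $\Psi_k(x,y;\xi)=F(x,y;\xi)-\frac{\rho_k}2\|[c(x,y)]_+\|^2-\frac{\sigma_k}2\|y\|^2$. From $(x^0,y^0)\in X\times Y$, for $k=0,1,2,\dots$ set $$y^{k+1}=\mathcal P_Y\big(y^k+\beta_k\nabla_y\Psi_k(x^k,y^k;\xi^y_k)\big),\qquad x^{k+1}=\mathcal P_X(x^k-\alpha_kd_x^k),$$ where $d_x^0=\nabla_x\Psi_0(x^0,y^1;\xi^x_0)$ and, for $k\ge1$, $$d_x^k=(1-\eta_k)\big(d_x^{k-1}-\nabla_x\Psi_{k-1}(x^{k-1},y^k;\xi^x_k)\big)+\nabla_x\Psi_k(x^k,y^{k+1};\xi^x_k).$$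 The samples have law $D$; with $\mathcal F_k=\sigma(\xi^y_j,\xi^x_j: j<k)$, $\xi_k^y$ is independent of $\mathcal F_k$ and $\xi_k^x$ is independent of $\sigma(\mathcal F_k,\xi_k^y)$. *Parameters.* Let $\rho_*,\sigma_*,\alpha_*,\beta_*,\eta_*>0$ be arbitrary constants and suppose that for all $k\ge1$ $$\rho_k=\rho_*k^{t},\quad \sigma_k=\sigma_*k^{-t},\quad \alpha_k=\alpha_*k^{-6t-s},\quad \beta_k=\beta_*k^{-t-s},\quad \eta_k=\eta_*k^{-s},$$ with $0<s,t<1$, $s>3t$, $8t+s<1$ and $2s+5t>1$ (the positive values at $k=0$ are arbitrary). Put $\varphi_k=\varphi_{\rho_k,\sigma_k}$ and $\mathcal G_k(x)=\frac1{\alpha_k}\big(x-\mathcal P_X(x-\alpha_k\nabla\varphi_k(x))\big)$. **Conclusion.** Every $\varphi_k$ is differentiable at every point of $X$. Almost surely, there are a subsequence $(x^{k_j},y^{k_j})$ and a point $(\bar x,\bar y)$ such that $(x^{k_j},y^{k_j})\to(\bar x,\bar y)$, $\|\mathcal G_{k_j}(x^{k_j})\|\to0$, and, if GPŁCQ holds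 at $(\bar x,\bar y)$, then $(\bar x,\bar y)$ is a KKT point of (MCC). Here *GPŁCQ holds at $(\bar x,\bar y)$* if there are $\delta,\beta,\gamma>0$ such that, with $q(x,y)=\frac12\|[c(x,y)]_+\|^2$, for all $x\in X$ and $y\in Y$ with $\|x-\bar x\|\le\delta$ and $\|y-\bar y\|\le\delta$, $$\sqrt{q(x,y)}\le\frac\gamma\beta\left\|\begin{bmatrix}x\\y\end{bmatrix}-\mathcal P_{X\times Y}\left(\begin{bmatrix}x\\y\end{bmatrix}+\beta\begin{bmatrix}\nabla_xq(x,y)\\-\nabla_yq(x,y)\end{bmatrix}\right)\right\|;$$ and $(x,y)$ is a *KKT point of (MCC)* if there is $\lambda\in\mathbb R^p_+$ such that, with $L(x,y,\lambda)=f(x,y)-\lambda^\top c(x,y)$, $$0\in\nabla_xL(x,y,\lambda)+\mathcal N_X(x),\quad 0\in-\nabla_yL(x,y,\lambda)+\mathcal N_Y(y),\quad c(x,y)\le0,\quad \lambda^\top c(x,y)=0,$$ where $\mathcal N_C(z)=\{v:\langle v,z'-z\rangle\le0\ \forall z'\in C\}$ for $z\in C$ and $\mathcal N_C(z)=\emptyset$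 for $z\notin C$. -/

import Mathlib

noncomputable section

namespace SPACO

/-! ### Projections, normal cones -/

/-- Euclidean projection of `u` onto `C`: a point of `C` nearest to `u`. It exists and is unique
when `C` is nonempty, closed and convex in a Hilbert space; if no nearest point exists, the value
is `u` (which never happens for the compact sets considered below). -/
def proj {E : Type*} [NormedAddCommGroup E] (C : Set E) (u : E) : E :=
  open Classical in
  if h : ∃ q ∈ C, ∀ z ∈ C, ‖u - q‖ ≤ ‖u - z‖ then h.choose else u

/-- The normal cone `N_C(z)` of convex analysis; it is empty when `z ∉ C`. -/
def normalCone {E : Type*} [NormedAddCommGroup E] [InnerProductSpace ℝ E] (C : Set E) (z : E) :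
    Set E :=
  {v | z ∈ C ∧ ∀ z' ∈ C, inner ℝ v (z' - z) ≤ 0}

/-! ### The minimax problem and its smooth approximation -/

section Problem

variable {E G : Type*} [NormedAddCommGroup E] [InnerProductSpace ℝ E] [CompleteSpace E]
  [NormedAddCommGroup G] [InnerProductSpace ℝ G] [CompleteSpace G] {p : ℕ}

/-- Partial gradient in the first variable. -/
def gradX (h : E → G → ℝ) (x : E) (y : G) : E := gradient (fun x' => h x' y) x

/-- Partial gradient in the second variable. -/
def gradY (h : E → G → ℝ) (x : E) (y : G) : G := gradient (fun y' => h x y') y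

/-- `p(x,y) = (1/2) ‖[c(x,y)]₊‖²`. -/
def penalty (c : Fin p → E → G → ℝ) (x : E) (y : G) : ℝ :=
  (1 / 2) * ∑ i, (max (c i x y) 0) ^ 2

/-- `h(x,y) - (ρ/2) ‖[c(x,y)]₊‖² - (σ/2) ‖y‖²`. With `h = f` this is `ψ_{ρ,σ}`; with
`h = F(·,·;ξ)` it is its stochastic estimator `Ψ(·,·;ξ)`. -/
def psi (h : E → G → ℝ) (c : Fin p → E → G → ℝ) (ρ σ : ℝ) (x : E) (y : G) : ℝ :=
  h x y - ρ * penalty c x y - σ / 2 * ‖y‖ ^ 2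

/-- `φ_{ρ,σ}(x) = max_{y ∈ Y} ψ_{ρ,σ}(x,y)`. -/
def phi (Y : Set G) (f : E → G → ℝ) (c : Fin p → E → G → ℝ) (ρ σ : ℝ) (x : E) : ℝ :=
  sSup ((fun y => psi f c ρ σ x y) '' Y)

/-- Generalized gradient residual `𝒢(x) = α⁻¹ (x - P_X(x - α ∇φ_{ρ,σ}(x)))`. -/
def residual (X : Set E) (Y : Set G) (f : E → G → ℝ) (c : Fin p → E → G → ℝ) (ρ σ α : ℝ)
    (x : E) : E :=
  (1 / α) • (x - proj X (x - α • gradient (phi Y f c ρ σ) x))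

/-- The Lagrangian `L(x,y,λ) = f(x,y) - λᵀ c(x,y)`. -/
def lagrangian (f : E → G → ℝ) (c : Fin p → E → G → ℝ) (lam : Fin p → ℝ) (x : E) (y : G) : ℝ :=
  f x y - ∑ i, lam i * c i x y

/-- `(x,y)` is a stationary (KKT) point of `min_{x ∈ X} max_{y ∈ Y} {f(x,y) | c(x,y) ≤ 0}`. -/
def IsKKT (X : Set E) (Y : Set G) (f : E → G → ℝ) (c : Fin p → E → G → ℝ) (x : E) (y : G) :
    Prop :=
  ∃ lam : Fin p → ℝ, (∀ i, 0 ≤ lam i) ∧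
    (∃ v ∈ normalCone X x, 0 = gradX (lagrangian f c lam) x y + v) ∧
    (∃ w ∈ normalCone Y y, 0 = -gradY (lagrangian f c lam) x y + w) ∧
    (∀ i, c i x y ≤ 0) ∧ ∑ i, lam i * c i x y = 0

/-- The generalized uniform Polyak-Łojasiewicz constraint qualification at `(xbar, ybar)`.
The projection onto `X × Y` acts componentwise, and the norm of the stacked vector is the
Euclidean one. -/
def GPLCQ (X : Set E) (Y : Set G) (c : Fin p → E → G → ℝ) (xbar : E) (ybar : G) : Prop :=
  ∃ δ > (0 : ℝ), ∃ β > (0 : ℝ), ∃ γ > (0 : ℝ),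
    ∀ x ∈ Metric.closedBall xbar δ ∩ X, ∀ y ∈ Metric.closedBall ybar δ ∩ Y,
      √(penalty c x y) ≤ γ / β *
        √(‖x - proj X (x + β • gradX (penalty c) x y)‖ ^ 2 +
          ‖y - proj Y (y - β • gradY (penalty c) x y)‖ ^ 2)

/-- `h` is continuously differentiable on (a neighbourhood of) `X × Y` with gradient Lipschitz
on `X × Y`. -/
def SmoothOn (X : Set E) (Y : Set G) (h : E → G → ℝ) : Prop :=
  (∃ U : Set (E × G), IsOpen U ∧ X ×ˢ Y ⊆ U ∧ ContDiffOn ℝ 1 (Function.uncurry h) U) ∧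
    ∃ L : NNReal, LipschitzOnWith L (fderiv ℝ (Function.uncurry h)) (X ×ˢ Y)

/-- Standing assumptions on the problem. -/
structure StandingAssumptions (X : Set E) (Y : Set G) (f : E → G → ℝ)
    (c : Fin p → E → G → ℝ) : Prop where
  X_nonempty : X.Nonempty
  X_convex : Convex ℝ X
  X_compact : IsCompact X
  Y_nonempty : Y.Nonempty
  Y_convex : Convex ℝ Y
  Y_compact : IsCompact Y
  f_smooth : SmoothOn X Y f
  f_concave : ∀ x ∈ X, ConcaveOn ℝ Y (f x)
  c_smooth : ∀ i, SmoothOn X Y (c i)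
  c_convex : ∀ i, ∀ x ∈ X, ConvexOn ℝ Y (c i x)
  feasible : ∀ x ∈ X, ∃ y ∈ Y, ∀ i, c i x y ≤ 0

/-! ### The stochastic oracle, the samples and the algorithm -/

variable {Ξ Ω : Type*} [MeasurableSpace Ξ]

/-- `f(x,y) = 𝔼_{ξ ∼ D} F(x,y;ξ)` together with the assumptions on the stochastic gradients
`∇ₓF(x,y;ξ)` and `∇_yF(x,y;ξ)` at points of `X × Y`. The integrability of the gradients and of
the integrand in `mean_square_smooth` follows from `measurable_*` and `variance_*`. -/
structure OracleAssumptions (X : Set E) (Y : Set G) [MeasurableSpace E] [MeasurableSpace G]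
    (D : MeasureTheory.Measure Ξ) (F : Ξ → E → G → ℝ) (f : E → G → ℝ) : Prop where
  integrable : ∀ x ∈ X, ∀ y ∈ Y, MeasureTheory.Integrable (fun ξ => F ξ x y) D
  expectation : ∀ x ∈ X, ∀ y ∈ Y, f x y = ∫ ξ, F ξ x y ∂D
  differentiable_x : ∀ ξ, ∀ x ∈ X, ∀ y ∈ Y, DifferentiableAt ℝ (fun x' => F ξ x' y) x
  differentiable_y : ∀ ξ, ∀ x ∈ X, ∀ y ∈ Y, DifferentiableAt ℝ (fun y' => F ξ x y') y
  measurable_x : Measurable fun q : Ξ × X × Y => gradX (F q.1) (q.2.1 : E) (q.2.2 : G)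
  measurable_y : Measurable fun q : Ξ × X × Y => gradY (F q.1) (q.2.1 : E) (q.2.2 : G)
  unbiased_x : ∀ x ∈ X, ∀ y ∈ Y, ∫ ξ, gradX (F ξ) x y ∂D = gradX f x y
  unbiased_y : ∀ x ∈ X, ∀ y ∈ Y, ∫ ξ, gradY (F ξ) x y ∂D = gradY f x y
  variance : ∃ δ > (0 : ℝ), ∀ x ∈ X, ∀ y ∈ Y,
    (MeasureTheory.Integrable (fun ξ => ‖gradX (F ξ) x y - gradX f x y‖ ^ 2) D ∧
      ∫ ξ, ‖gradX (F ξ) x y - gradX f x y‖ ^ 2 ∂D ≤ δ ^ 2) ∧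
    (MeasureTheory.Integrable (fun ξ => ‖gradY (F ξ) x y - gradY f x y‖ ^ 2) D ∧
      ∫ ξ, ‖gradY (F ξ) x y - gradY f x y‖ ^ 2 ∂D ≤ δ ^ 2)
  mean_square_smooth : ∃ LF > (0 : ℝ), ∀ x₁ ∈ X, ∀ y₁ ∈ Y, ∀ x₂ ∈ X, ∀ y₂ ∈ Y,
    ∫ ξ, ‖gradX (F ξ) x₁ y₁ - gradX (F ξ) x₂ y₂‖ ^ 2 ∂D ≤
      LF ^ 2 * (‖x₁ - x₂‖ ^ 2 + ‖y₁ - y₂‖ ^ 2)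

/-- `ℱ_k`, generated by the samples `ξ_j^y, ξ_j^x` with `j < k`. -/
abbrev past (ξy ξx : ℕ → Ω → Ξ) (k : ℕ) : MeasurableSpace Ω :=
  ⨆ j : ℕ, ⨆ _ : j < k,
    MeasurableSpace.comap (ξy j) inferInstance ⊔ MeasurableSpace.comap (ξx j) inferInstance

/-- `ℱ_{k+1/2}`, generated by `ℱ_k` and `ξ_k^y`. -/
abbrev pastHalf (ξy ξx : ℕ → Ω → Ξ) (k : ℕ) : MeasurableSpace Ω :=
  past ξy ξx k ⊔ MeasurableSpace.comap (ξy k) inferInstance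

/-- The samples all have law `D`; `ξ_k^y` is independent of `ℱ_k` and `ξ_k^x` is independent of
`ℱ_{k+1/2}`. -/
structure IsSampling [MeasurableSpace Ω] (P : MeasureTheory.Measure Ω)
    (D : MeasureTheory.Measure Ξ) (ξy ξx : ℕ → Ω → Ξ) : Prop where
  measurable_y : ∀ k, Measurable (ξy k)
  measurable_x : ∀ k, Measurable (ξx k)
  law_y : ∀ k, MeasureTheory.Measure.map (ξy k) P = D
  law_x : ∀ k, MeasureTheory.Measure.map (ξx k) P = D
  indep_y : ∀ k, ProbabilityTheory.Indep
    (MeasurableSpace.comap (ξy k) inferInstance) (past ξy ξx k) P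
  indep_x : ∀ k, ProbabilityTheory.Indep
    (MeasurableSpace.comap (ξx k) inferInstance) (pastHalf ξy ξx k) P

/-- `(x, y)` are the iterates (and `dx` the search directions `d_x^k`) of SPACO started at
`(x₀, y₀) ∈ X × Y`. -/
structure IsSPACO (X : Set E) (Y : Set G) (F : Ξ → E → G → ℝ) (c : Fin p → E → G → ℝ)
    (ρ σ α β η : ℕ → ℝ) (ξy ξx : ℕ → Ω → Ξ) (x₀ : E) (y₀ : G)
    (x : ℕ → Ω → E) (y : ℕ → Ω → G) (dx : ℕ → Ω → E) : Prop where
  x₀_mem : x₀ ∈ X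
  y₀_mem : y₀ ∈ Y
  x_zero : ∀ ω, x 0 ω = x₀
  y_zero : ∀ ω, y 0 ω = y₀
  y_succ : ∀ k ω, y (k + 1) ω =
    proj Y (y k ω + β k • gradY (psi (F (ξy k ω)) c (ρ k) (σ k)) (x k ω) (y k ω))
  dx_zero : ∀ ω, dx 0 ω = gradX (psi (F (ξx 0 ω)) c (ρ 0) (σ 0)) (x 0 ω) (y 1 ω)
  dx_succ : ∀ k ω, dx (k + 1) ω =
    (1 - η (k + 1)) •
      (dx k ω - gradX (psi (F (ξx (k + 1) ω)) c (ρ k) (σ k)) (x k ω) (y (k + 1) ω)) +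
    gradX (psi (F (ξx (k + 1) ω)) c (ρ (k + 1)) (σ (k + 1))) (x (k + 1) ω) (y (k + 2) ω)
  x_succ : ∀ k ω, x (k + 1) ω = proj X (x k ω - α k • dx k ω)

end Problem

/-- The parameter schedules: positive sequences, given for `k ≥ 1` by the stated powers of `k`.
(The powers have no meaning at `k = 0`, where any positive value is allowed.) -/
structure IsSchedule (ρ₀ σ₀ α₀ β₀ η₀ s t : ℝ) (ρ σ α β η : ℕ → ℝ) : Prop where
  ρ_pos : ∀ k, 0 < ρ k
  σ_pos : ∀ k, 0 < σ k
  α_pos : ∀ k, 0 < α k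
  β_pos : ∀ k, 0 < β k
  η_pos : ∀ k, 0 < η k
  ρ_eq : ∀ k : ℕ, 1 ≤ k → ρ k = ρ₀ * (k : ℝ) ^ t
  σ_eq : ∀ k : ℕ, 1 ≤ k → σ k = σ₀ * (k : ℝ) ^ (-t)
  α_eq : ∀ k : ℕ, 1 ≤ k → α k = α₀ * (k : ℝ) ^ (-6 * t - s)
  β_eq : ∀ k : ℕ, 1 ≤ k → β k = β₀ * (k : ℝ) ^ (-t - s)
  η_eq : ∀ k : ℕ, 1 ≤ k → η k = η₀ * (k : ℝ) ^ (-s)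

end SPACO

end

/-! On the scales `u = k^t` and `v = k^s` the parameters have the orders `ρ ~ u`, `σ ~ 1/u`, `α ~
1/(u⁶v)`, `β ~ 1/(uv)`, `η ~ 1/v`. For fixed parameters `ψ(x,·)` is `σ`-strongly concave on `Y`, so
its maximizer `y*(x)` is unique, Danskin's theorem gives `∇φ(x) = ∇ₓψ(x, y*(x))`, and `y*` and `∇φ`
are Lipschitz on `X` with constants of order `u²` and `u³`.

Three mean quantities are followed along a run: `Φ = 𝔼 φ_k(x^k)`, the inner error `D = 𝔼‖y^k -
y*_k(x^k)‖²` and the direction error `e = 𝔼‖d_x^k - ∇ₓψ_k(x^k, y^{k+1})‖²`. Put `S = 𝔼‖x^{k+1} -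
x^k‖²` and `q = u⁶v`. Then `Φ` falls by a multiple of `q S` and rises by at most the order of `(e +
u² D + v⁻²)/q + 1/(uk)`, while `D` contracts at rate `1/(u²v)` and `e` at rate `1/v`, both up to
steps and noise (`phi_recursion`, `innerErr_recursion`, `dirErr_recursion`). In the Lyapunov
function `Φ + A u⁻² D + A u⁻⁶ e` the contractions outweigh the errors, and the noise is `o(1/q)`
because `3t < s` and `8t + s < 1`. If `q² S + e + u² D ≥ ε` held for all large `k`, this function
would fall by a multiple of `ε/q ≥ ε/k` at each step. The harmonic series diverges and `Φ` is
bounded below by the values at feasible points, a contradiction (`frequently_lt_of_recursions`).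

Up to vanishing terms, the small quantity dominates the mean of `‖𝒢_k(x^k)‖² + ‖y^k - y*_k(x^k)‖²`.
These means are therefore small infinitely often, which yields almost sure convergence to zero along
one deterministic subsequence; compactness of `X × Y` then supplies a limit point for each sample.

At the limit the multipliers come from `ρ [c]₊`. Dividing the optimality inclusions of `(x^k,
y*_k(x^k))` by `ρ` shows that the residual of the penalty is of order `1/ρ + α‖𝒢‖`. GPŁCQ turns this
into a bound on `ρ √q(x,y)`, with `q(x,y)` the penalty, so the multipliers stay bounded and the
inclusions pass to the limit (`isKKT_of_tendsto`). -/

namespace SPACO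

set_option maxSynthPendingDepth 3

open Filter Topology Set

/-! ### Projections onto compact convex sets and normal cones. -/

section Projection

variable {E : Type*} [NormedAddCommGroup E]

theorem proj_spec {C : Set E} (hC : IsCompact C) (hne : C.Nonempty) (u : E) :
    proj C u ∈ C ∧ ∀ z ∈ C, ‖u - proj C u‖ ≤ ‖u - z‖ := by
  have h : ∃ q ∈ C, ∀ z ∈ C, ‖u - q‖ ≤ ‖u - z‖ := by
    obtain ⟨q, hq, hmin⟩ := hC.exists_isMinOn hne
      (f := fun z => ‖u - z‖) (by fun_prop)
    exact ⟨q, hq, fun z hz => hmin hz⟩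
  rw [proj, dif_pos h]
  exact h.choose_spec

theorem proj_mem {C : Set E} (hC : IsCompact C) (hne : C.Nonempty) (u : E) : proj C u ∈ C :=
  (proj_spec hC hne u).1

variable [InnerProductSpace ℝ E]

theorem inner_sub_proj_nonpos {C : Set E} (hC : IsCompact C) (hne : C.Nonempty)
    (hconv : Convex ℝ C) (u : E) {z : E} (hz : z ∈ C) :
    inner ℝ (u - proj C u) (z - proj C u) ≤ 0 := by
  obtain ⟨hm, hmin⟩ := proj_spec hC hne u
  refine (norm_eq_iInf_iff_real_inner_le_zero hconv hm).1 ?_ z hz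
  have : Nonempty C := ⟨⟨_, hm⟩⟩
  refine le_antisymm (le_ciInf fun w => hmin w w.2) ?_
  exact ciInf_le ⟨0, by rintro _ ⟨w, rfl⟩; exact norm_nonneg _⟩ (⟨_, hm⟩ : C)

/-- Testing each inequality with the other point and adding gives `‖v - w‖² ≤ 0`. -/
theorem eq_of_variational {C : Set E} {u v w : E} (hv : v ∈ C) (hw : w ∈ C)
    (h1 : ∀ z ∈ C, inner ℝ (u - v) (z - v) ≤ 0) (h2 : ∀ z ∈ C, inner ℝ (u - w) (z - w) ≤ 0) :
    v = w := by
  have e1 := h1 w hw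
  have e2 := h2 v hv
  have : inner ℝ (v - w) (v - w) ≤ 0 := by
    have : inner ℝ (v - w) (v - w) = inner ℝ (u - v) (w - v) + inner ℝ (u - w) (v - w) := by
      simp only [inner_sub_left, inner_sub_right]; ring
    linarith
  exact sub_eq_zero.1 (norm_eq_zero.1 (pow_eq_zero_iff two_ne_zero |>.1
    (le_antisymm (real_inner_self_eq_norm_sq (v - w) ▸ this) (sq_nonneg _))))

theorem proj_eq {C : Set E} (hC : IsCompact C) (hconv : Convex ℝ C) {u v : E} (hv : v ∈ C)
    (h : ∀ z ∈ C, inner ℝ (u - v) (z - v) ≤ 0) : proj C u = v :=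
  eq_of_variational (proj_mem hC ⟨v, hv⟩ u) hv
    (fun _ hz => inner_sub_proj_nonpos hC ⟨v, hv⟩ hconv u hz) h

theorem norm_proj_sub_proj_le {C : Set E} (hC : IsCompact C) (hne : C.Nonempty)
    (hconv : Convex ℝ C) (u v : E) : ‖proj C u - proj C v‖ ≤ ‖u - v‖ := by
  have e1 := inner_sub_proj_nonpos hC hne hconv u (proj_mem hC hne v)
  have e2 := inner_sub_proj_nonpos hC hne hconv v (proj_mem hC hne u)
  have h : ‖proj C u - proj C v‖ ^ 2 ≤ inner ℝ (u - v) (proj C u - proj C v) := by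
    have : inner ℝ (u - v) (proj C u - proj C v) - ‖proj C u - proj C v‖ ^ 2 =
        -inner ℝ (u - proj C u) (proj C v - proj C u)
          - inner ℝ (v - proj C v) (proj C u - proj C v) := by
      rw [← real_inner_self_eq_norm_sq]
      simp only [inner_sub_left, inner_sub_right]; ring
    linarith
  have h2 := real_inner_le_norm (u - v) (proj C u - proj C v)
  by_contra! hlt
  nlinarith [norm_nonneg (u - v), norm_nonneg (proj C u - proj C v)]

theorem continuous_proj {C : Set E} (hC : IsCompact C) (hne : C.Nonempty)
    (hconv : Convex ℝ C) : Continuous (proj C) :=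
  (LipschitzWith.of_dist_le_mul (K := 1) fun u v => by
    simpa [dist_eq_norm] using norm_proj_sub_proj_le hC hne hconv u v).continuous

/-- This turns first-order optimality into a fixed-point equation, so that nonexpansiveness of the
projection can compare it with nearby points. -/
theorem proj_add_of_mem_normalCone {C : Set E} (hC : IsCompact C) (hconv : Convex ℝ C) {z v : E}
    (hv : v ∈ normalCone C z) : proj C (z + v) = z :=
  proj_eq hC hconv hv.1 (by simpa using hv.2)

theorem smul_mem_normalCone {C : Set E} {z v : E} (hv : v ∈ normalCone C z) {a : ℝ} (ha : 0 ≤ a) :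
    a • v ∈ normalCone C z :=
  ⟨hv.1, fun z' hz' => by
    rw [inner_smul_left]; exact mul_nonpos_of_nonneg_of_nonpos ha (hv.2 z' hz')⟩

theorem mem_normalCone_of_tendsto {C : Set E} (hC : IsClosed C) {z v : ℕ → E} {z' v' : E}
    (hz : Tendsto z atTop (𝓝 z')) (hv : Tendsto v atTop (𝓝 v'))
    (h : ∀ k, v k ∈ normalCone C (z k)) : v' ∈ normalCone C z' :=
  ⟨hC.mem_of_tendsto hz (Eventually.of_forall fun k => (h k).1), fun w hw =>
    le_of_tendsto (hv.inner (tendsto_const_nhds.sub hz))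
      (Eventually.of_forall fun k => (h k).2 w hw)⟩

end Projection

/-! ### Partial gradients of the data and of the quadratic penalty. -/

section Gradients

set_option linter.unusedSectionVars false

variable {E G : Type*} [NormedAddCommGroup E] [InnerProductSpace ℝ E] [CompleteSpace E]
  [NormedAddCommGroup G] [InnerProductSpace ℝ G] [CompleteSpace G] {p : ℕ}
  {X : Set E} {Y : Set G} {h : E → G → ℝ}

theorem SmoothOn.contDiffAt (hs : SmoothOn X Y h) {x : E} {y : G} (hx : x ∈ X) (hy : y ∈ Y) :
    ContDiffAt ℝ 1 (Function.uncurry h) (x, y) := by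
  obtain ⟨⟨U, hU, hsub, hc⟩, -⟩ := hs
  exact hc.contDiffAt (hU.mem_nhds (hsub ⟨hx, hy⟩))

theorem SmoothOn.differentiableAt (hs : SmoothOn X Y h) {x : E} {y : G} (hx : x ∈ X)
    (hy : y ∈ Y) : DifferentiableAt ℝ (Function.uncurry h) (x, y) :=
  (hs.contDiffAt hx hy).differentiableAt (by simp)

theorem SmoothOn.hasFDerivAt_left (hs : SmoothOn X Y h) {x : E} {y : G} (hx : x ∈ X)
    (hy : y ∈ Y) : HasFDerivAt (fun x' => h x' y)
      ((fderiv ℝ (Function.uncurry h) (x, y)).comp (ContinuousLinearMap.inl ℝ E G)) x :=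
  HasFDerivAt.comp x (f := fun x' => (x', y)) (hs.differentiableAt hx hy).hasFDerivAt
    (hasFDerivAt_prodMk_left x y)

theorem SmoothOn.hasFDerivAt_right (hs : SmoothOn X Y h) {x : E} {y : G} (hx : x ∈ X)
    (hy : y ∈ Y) : HasFDerivAt (fun y' => h x y')
      ((fderiv ℝ (Function.uncurry h) (x, y)).comp (ContinuousLinearMap.inr ℝ E G)) y :=
  HasFDerivAt.comp y (f := fun y' => (x, y')) (hs.differentiableAt hx hy).hasFDerivAt
    (hasFDerivAt_prodMk_right x y)

theorem SmoothOn.hasGradientAt_left (hs : SmoothOn X Y h) {x : E} {y : G} (hx : x ∈ X)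
    (hy : y ∈ Y) : HasGradientAt (fun x' => h x' y) (gradX h x y) x :=
  (hs.hasFDerivAt_left hx hy).differentiableAt.hasGradientAt

theorem SmoothOn.hasGradientAt_right (hs : SmoothOn X Y h) {x : E} {y : G} (hx : x ∈ X)
    (hy : y ∈ Y) : HasGradientAt (fun y' => h x y') (gradY h x y) y :=
  (hs.hasFDerivAt_right hx hy).differentiableAt.hasGradientAt

theorem SmoothOn.gradX_eq (hs : SmoothOn X Y h) {x : E} {y : G} (hx : x ∈ X) (hy : y ∈ Y) :
    gradX h x y = (InnerProductSpace.toDual ℝ E).symm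
      ((fderiv ℝ (Function.uncurry h) (x, y)).comp (ContinuousLinearMap.inl ℝ E G)) := by
  rw [gradX, gradient, (hs.hasFDerivAt_left hx hy).fderiv]

theorem SmoothOn.gradY_eq (hs : SmoothOn X Y h) {x : E} {y : G} (hx : x ∈ X) (hy : y ∈ Y) :
    gradY h x y = (InnerProductSpace.toDual ℝ G).symm
      ((fderiv ℝ (Function.uncurry h) (x, y)).comp (ContinuousLinearMap.inr ℝ E G)) := by
  rw [gradY, gradient, (hs.hasFDerivAt_right hx hy).fderiv]

/-- `L` bounds `h` and its partial gradients on `X × Y` and is a Lipschitz constant of the partial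
gradients there. -/
structure GradBounds (X : Set E) (Y : Set G) (h : E → G → ℝ) (L : ℝ) : Prop where
  abs_le : ∀ x ∈ X, ∀ y ∈ Y, |h x y| ≤ L
  gradX_le : ∀ x ∈ X, ∀ y ∈ Y, ‖gradX h x y‖ ≤ L
  gradY_le : ∀ x ∈ X, ∀ y ∈ Y, ‖gradY h x y‖ ≤ L
  gradX_lip : ∀ x₁ ∈ X, ∀ y₁ ∈ Y, ∀ x₂ ∈ X, ∀ y₂ ∈ Y,
    ‖gradX h x₁ y₁ - gradX h x₂ y₂‖ ≤ L * (‖x₁ - x₂‖ + ‖y₁ - y₂‖)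
  gradY_lip : ∀ x₁ ∈ X, ∀ y₁ ∈ Y, ∀ x₂ ∈ X, ∀ y₂ ∈ Y,
    ‖gradY h x₁ y₁ - gradY h x₂ y₂‖ ≤ L * (‖x₁ - x₂‖ + ‖y₁ - y₂‖)

theorem GradBounds.mono {L L' : ℝ} (hb : GradBounds X Y h L) (hL : L ≤ L') :
    GradBounds X Y h L' where
  abs_le x hx y hy := (hb.abs_le x hx y hy).trans hL
  gradX_le x hx y hy := (hb.gradX_le x hx y hy).trans hL
  gradY_le x hx y hy := (hb.gradY_le x hx y hy).trans hL
  gradX_lip x₁ h1 y₁ h2 x₂ h3 y₂ h4 :=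
    (hb.gradX_lip x₁ h1 y₁ h2 x₂ h3 y₂ h4).trans (by gcongr)
  gradY_lip x₁ h1 y₁ h2 x₂ h3 y₂ h4 :=
    (hb.gradY_lip x₁ h1 y₁ h2 x₂ h3 y₂ h4).trans (by gcongr)

theorem SmoothOn.continuousOn (hs : SmoothOn X Y h) :
    ContinuousOn (Function.uncurry h) (X ×ˢ Y) := fun q hq =>
  (hs.differentiableAt (x := q.1) (y := q.2) hq.1 hq.2).continuousAt.continuousWithinAt

theorem SmoothOn.exists_norm_fderiv_le (hs : SmoothOn X Y h) (hX : IsCompact X)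
    (hY : IsCompact Y) :
    ∃ M : NNReal, (∀ q ∈ X ×ˢ Y, ‖fderiv ℝ (Function.uncurry h) q‖ ≤ M) ∧
      ∀ q ∈ X ×ˢ Y, |Function.uncurry h q| ≤ M := by
  have hs' := hs
  obtain ⟨-, L, hL⟩ := hs
  have hcont : ContinuousOn (fderiv ℝ (Function.uncurry h)) (X ×ˢ Y) := hL.continuousOn
  obtain ⟨M, hM⟩ := (hX.prod hY).exists_bound_of_continuousOn hcont
  obtain ⟨M', hM'⟩ := (hX.prod hY).exists_bound_of_continuousOn hs'.continuousOn
  exact ⟨(max M M').toNNReal,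
    fun q hq => (hM q hq).trans ((le_max_left _ _).trans (Real.le_coe_toNNReal _)),
    fun q hq => (hM' q hq).trans ((le_max_right _ _).trans (Real.le_coe_toNNReal _))⟩

/-- The partial gradients are Riesz representatives of the full derivative composed with the
coordinate inclusions. These have norm at most one and the Riesz map is isometric, so all bounds
descend from the full derivative. -/
theorem SmoothOn.exists_gradBounds (hs : SmoothOn X Y h) (hX : IsCompact X) (hY : IsCompact Y) :
    ∃ L, GradBounds X Y h L := by
  obtain ⟨M, hM, hM'⟩ := hs.exists_norm_fderiv_le hX hY
  obtain ⟨K, hK⟩ := hs.2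
  have hl : ∀ A : E × G →L[ℝ] ℝ, ‖A.comp (ContinuousLinearMap.inl ℝ E G)‖ ≤ ‖A‖ := fun A =>
    (A.opNorm_comp_le _).trans (mul_le_of_le_one_right (norm_nonneg _)
      (ContinuousLinearMap.norm_inl_le_one ℝ E G))
  have hr : ∀ A : E × G →L[ℝ] ℝ, ‖A.comp (ContinuousLinearMap.inr ℝ E G)‖ ≤ ‖A‖ := fun A =>
    (A.opNorm_comp_le _).trans (mul_le_of_le_one_right (norm_nonneg _)
      (ContinuousLinearMap.norm_inr_le_one ℝ E G))
  have hlip : ∀ x₁ ∈ X, ∀ y₁ ∈ Y, ∀ x₂ ∈ X, ∀ y₂ ∈ Y,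
      ‖fderiv ℝ (Function.uncurry h) (x₁, y₁) - fderiv ℝ (Function.uncurry h) (x₂, y₂)‖ ≤
        K * (‖x₁ - x₂‖ + ‖y₁ - y₂‖) := by
    intro x₁ h1 y₁ h2 x₂ h3 y₂ h4
    have := hK.dist_le_mul (x₁, y₁) ⟨h1, h2⟩ (x₂, y₂) ⟨h3, h4⟩
    rw [dist_eq_norm, dist_eq_norm] at this
    refine this.trans (mul_le_mul_of_nonneg_left ?_ K.2)
    -- `E × G` carries the sup norm, which the sum of the component norms dominates.
    rw [Prod.norm_def]
    exact max_le (le_add_of_nonneg_right (norm_nonneg _)) (le_add_of_nonneg_left (norm_nonneg _))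
  have hfin : GradBounds X Y h (max M K) := by
    constructor
    · exact fun x hx y hy => (hM' (x, y) ⟨hx, hy⟩).trans (le_max_left _ _)
    · intro x hx y hy
      rw [hs.gradX_eq hx hy, LinearIsometryEquiv.norm_map]
      exact (hl _).trans ((hM (x, y) ⟨hx, hy⟩).trans (le_max_left _ _))
    · intro x hx y hy
      rw [hs.gradY_eq hx hy, LinearIsometryEquiv.norm_map]
      exact (hr _).trans ((hM (x, y) ⟨hx, hy⟩).trans (le_max_left _ _))
    · intro x₁ h1 y₁ h2 x₂ h3 y₂ h4
      rw [hs.gradX_eq h1 h2, hs.gradX_eq h3 h4, ← map_sub, LinearIsometryEquiv.norm_map,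
        ← ContinuousLinearMap.sub_comp]
      refine (hl _).trans ((hlip _ h1 _ h2 _ h3 _ h4).trans ?_)
      gcongr
      exact le_max_right _ _
    · intro x₁ h1 y₁ h2 x₂ h3 y₂ h4
      rw [hs.gradY_eq h1 h2, hs.gradY_eq h3 h4, ← map_sub, LinearIsometryEquiv.norm_map,
        ← ContinuousLinearMap.sub_comp]
      refine (hr _).trans ((hlip _ h1 _ h2 _ h3 _ h4).trans ?_)
      gcongr
      exact le_max_right _ _
  exact ⟨_, hfin⟩

/-- Squaring removes the kink of the positive part: in each of the four sign patterns the
first-order remainder is at most `(s - t)²`. -/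
theorem hasDerivAt_half_max_sq (t : ℝ) :
    HasDerivAt (fun s : ℝ => 1 / 2 * (max s 0) ^ 2) (max t 0) t := by
  rw [hasDerivAt_iff_isLittleO]
  refine Asymptotics.IsBigO.trans_isLittleO (g := fun s => (s - t) ^ 2) ?_
    (by simpa using (Asymptotics.isLittleO_pow_sub_sub t one_lt_two).norm_norm)
  refine Asymptotics.IsBigO.of_bound 1 (Eventually.of_forall fun s => ?_)
  rw [one_mul, Real.norm_eq_abs, Real.norm_of_nonneg (sq_nonneg _), smul_eq_mul, abs_le]
  rcases max_cases s 0 with ⟨h1, h2⟩ | ⟨h1, h2⟩ <;> rcases max_cases t 0 with ⟨h3, h4⟩ | ⟨h3, h4⟩ <;>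
    rw [h1, h3] <;> constructor <;> nlinarith [sq_nonneg (s - t), mul_self_nonneg s]

theorem contDiff_half_max_sq : ContDiff ℝ 1 (fun s : ℝ => 1 / 2 * (max s 0) ^ 2) := by
  rw [contDiff_one_iff_deriv]
  refine ⟨fun t => (hasDerivAt_half_max_sq t).differentiableAt, ?_⟩
  rw [show deriv (fun s : ℝ => 1 / 2 * (max s 0) ^ 2) = fun t => max t 0 from
    funext fun t => (hasDerivAt_half_max_sq t).deriv]
  fun_prop

theorem SmoothOn.hasFDerivAt_half_max_sq (hs : SmoothOn X Y h) {q : E × G} (hq : q ∈ X ×ˢ Y) :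
    HasFDerivAt (Function.uncurry fun x y => 1 / 2 * (max (h x y) 0) ^ 2)
      (max (Function.uncurry h q) 0 • fderiv ℝ (Function.uncurry h) q) q :=
  (hasDerivAt_half_max_sq _).comp_hasFDerivAt q
    (hs.differentiableAt (x := q.1) (y := q.2) hq.1 hq.2).hasFDerivAt

/-- The derivative is `max h 0` times that of `h`, a product of bounded Lipschitz factors. Convexity
of `X × Y` is what makes `h` itself Lipschitz there. -/
theorem SmoothOn.half_max_sq (hs : SmoothOn X Y h) (hX : IsCompact X) (hY : IsCompact Y)
    (hX' : Convex ℝ X) (hY' : Convex ℝ Y) :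
    SmoothOn X Y (fun x y => 1 / 2 * (max (h x y) 0) ^ 2) := by
  obtain ⟨M, hM, hM'⟩ := hs.exists_norm_fderiv_le hX hY
  obtain ⟨⟨U, hU, hsub, hc⟩, K, hK⟩ := id hs
  refine ⟨⟨U, hU, hsub, contDiff_half_max_sq.comp_contDiffOn hc⟩, M * K + M * M, ?_⟩
  have hL : LipschitzOnWith M (Function.uncurry h) (X ×ˢ Y) :=
    (hX'.prod hY').lipschitzOnWith_of_nnnorm_fderiv_le
      (fun q hq => hs.differentiableAt (x := q.1) (y := q.2) hq.1 hq.2) fun q hq => hM q hq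
  refine LipschitzOnWith.of_dist_le_mul fun a ha b hb => ?_
  rw [(hs.hasFDerivAt_half_max_sq ha).fderiv, (hs.hasFDerivAt_half_max_sq hb).fderiv,
    dist_eq_norm]
  set H : E × G → ℝ := Function.uncurry h
  have e1 := hK.dist_le_mul a ha b hb
  have e2 := hL.dist_le_mul a ha b hb
  rw [dist_eq_norm] at e1
  rw [Real.dist_eq] at e2
  have e3 : |max (H a) 0| ≤ M := by
    refine le_trans ?_ (hM' a ha)
    rw [abs_of_nonneg (le_max_right _ _)]
    exact max_le (le_abs_self _) (abs_nonneg _)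
  have e4 : |max (H a) 0 - max (H b) 0| ≤ M * dist a b :=
    (abs_max_sub_max_le_abs _ _ _).trans e2
  have e5 := hM b hb
  calc ‖max (H a) 0 • fderiv ℝ H a - max (H b) 0 • fderiv ℝ H b‖
      = ‖max (H a) 0 • (fderiv ℝ H a - fderiv ℝ H b)
          + (max (H a) 0 - max (H b) 0) • fderiv ℝ H b‖ := by
        congr 1; module
    _ ≤ |max (H a) 0| * ‖fderiv ℝ H a - fderiv ℝ H b‖
          + |max (H a) 0 - max (H b) 0| * ‖fderiv ℝ H b‖ := by
        refine le_trans (norm_add_le _ _) (le_of_eq ?_)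
        rw [norm_smul, norm_smul, Real.norm_eq_abs, Real.norm_eq_abs]
    _ ≤ M * (K * dist a b) + (M * dist a b) * M := by gcongr
    _ = ((M * K + M * M : NNReal) : ℝ) * dist a b := by push_cast; ring

theorem SmoothOn.sum {h : Fin p → E → G → ℝ} (hs : ∀ i, SmoothOn X Y (h i)) :
    SmoothOn X Y (fun x y => ∑ i, h i x y) := by
  choose U hU hsub hc using fun i => (hs i).1
  choose K hK using fun i => (hs i).2
  have hunc : (Function.uncurry fun x y => ∑ i, h i x y) =
      fun q => ∑ i, Function.uncurry (h i) q := by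
    ext q; rfl
  refine ⟨⟨⋂ i, U i, isOpen_iInter_of_finite hU, subset_iInter hsub, ?_⟩, ∑ i, K i, ?_⟩
  · rw [hunc]
    exact ContDiffOn.sum fun i _ => (hc i).mono (iInter_subset U i)
  · have hd : ∀ q ∈ X ×ˢ Y, fderiv ℝ (fun q => ∑ i, Function.uncurry (h i) q) q =
        ∑ i, fderiv ℝ (Function.uncurry (h i)) q := fun q hq =>
      fderiv_fun_sum fun i _ => (hs i).differentiableAt (x := q.1) (y := q.2) hq.1 hq.2
    refine LipschitzOnWith.of_dist_le_mul fun a ha b hb => ?_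
    rw [hunc, hd a ha, hd b hb, NNReal.coe_sum, Finset.sum_mul]
    exact dist_sum_sum_le_of_le _ fun i _ => (hK i).dist_le_mul a ha b hb

theorem smoothOn_penalty {c : Fin p → E → G → ℝ} (hs : ∀ i, SmoothOn X Y (c i))
    (hX : IsCompact X) (hY : IsCompact Y) (hX' : Convex ℝ X) (hY' : Convex ℝ Y) :
    SmoothOn X Y (penalty c) := by
  have : penalty c = fun x y => ∑ i, 1 / 2 * (max (c i x y) 0) ^ 2 := by
    ext x y; rw [penalty, Finset.mul_sum]
  rw [this]
  exact SmoothOn.sum fun i => (hs i).half_max_sq hX hY hX' hY'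

theorem _root_.HasGradientAt.sum' {F : Type*} [NormedAddCommGroup F] [InnerProductSpace ℝ F]
    [CompleteSpace F] {ι : Type*} {s : Finset ι} {u : ι → F → ℝ} {u' : ι → F} {z : F}
    (h : ∀ i ∈ s, HasGradientAt (u i) (u' i) z) :
    HasGradientAt (fun z => ∑ i ∈ s, u i z) (∑ i ∈ s, u' i) z := by
  rw [hasGradientAt_iff_hasFDerivAt, map_sum]
  exact HasFDerivAt.fun_sum fun i hi => (h i hi).hasFDerivAt

theorem _root_.HasGradientAt.half_max_sq {F : Type*} [NormedAddCommGroup F] [InnerProductSpace ℝ F]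
    [CompleteSpace F] {u : F → ℝ} {u' : F} {z : F} (h : HasGradientAt u u' z) :
    HasGradientAt (fun z => 1 / 2 * (max (u z) 0) ^ 2) (max (u z) 0 • u') z := by
  rw [hasGradientAt_iff_hasFDerivAt, map_smul]
  exact (hasDerivAt_half_max_sq _).comp_hasFDerivAt z h.hasFDerivAt

theorem gradX_penalty {c : Fin p → E → G → ℝ} (hs : ∀ i, SmoothOn X Y (c i)) {x : E} {y : G}
    (hx : x ∈ X) (hy : y ∈ Y) :
    gradX (penalty c) x y = ∑ i, max (c i x y) 0 • gradX (c i) x y := by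
  refine HasGradientAt.gradient ?_
  simp only [penalty, Finset.mul_sum]
  exact HasGradientAt.sum' fun i _ => ((hs i).hasGradientAt_left hx hy).half_max_sq

theorem gradY_penalty {c : Fin p → E → G → ℝ} (hs : ∀ i, SmoothOn X Y (c i)) {x : E} {y : G}
    (hx : x ∈ X) (hy : y ∈ Y) :
    gradY (penalty c) x y = ∑ i, max (c i x y) 0 • gradY (c i) x y := by
  refine HasGradientAt.gradient ?_
  simp only [penalty, Finset.mul_sum]
  exact HasGradientAt.sum' fun i _ => ((hs i).hasGradientAt_right hx hy).half_max_sq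

theorem gradX_lagrangian {f : E → G → ℝ} {c : Fin p → E → G → ℝ} (hf : SmoothOn X Y f)
    (hs : ∀ i, SmoothOn X Y (c i)) {x : E} {y : G} (hx : x ∈ X) (hy : y ∈ Y) (lam : Fin p → ℝ) :
    gradX (lagrangian f c lam) x y = gradX f x y - ∑ i, lam i • gradX (c i) x y := by
  refine HasGradientAt.gradient ?_
  rw [hasGradientAt_iff_hasFDerivAt, map_sub]
  refine (hf.hasGradientAt_left hx hy).hasFDerivAt.sub ?_
  rw [← hasGradientAt_iff_hasFDerivAt]
  refine HasGradientAt.sum' (u := fun i x' => lam i * c i x' y) fun i _ => ?_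
  rw [hasGradientAt_iff_hasFDerivAt, map_smul]
  exact ((hs i).hasGradientAt_left hx hy).hasFDerivAt.const_mul (lam i)

theorem gradY_lagrangian {f : E → G → ℝ} {c : Fin p → E → G → ℝ} (hf : SmoothOn X Y f)
    (hs : ∀ i, SmoothOn X Y (c i)) {x : E} {y : G} (hx : x ∈ X) (hy : y ∈ Y) (lam : Fin p → ℝ) :
    gradY (lagrangian f c lam) x y = gradY f x y - ∑ i, lam i • gradY (c i) x y := by
  refine HasGradientAt.gradient ?_
  rw [hasGradientAt_iff_hasFDerivAt, map_sub]
  refine (hf.hasGradientAt_right hx hy).hasFDerivAt.sub ?_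
  rw [← hasGradientAt_iff_hasFDerivAt]
  refine HasGradientAt.sum' (u := fun i y' => lam i * c i x y') fun i _ => ?_
  rw [hasGradientAt_iff_hasFDerivAt, map_smul]
  exact ((hs i).hasGradientAt_right hx hy).hasFDerivAt.const_mul (lam i)

theorem hasGradientAt_half_norm_sq (σ : ℝ) (y : G) :
    HasGradientAt (fun y' : G => σ / 2 * ‖y'‖ ^ 2) (σ • y) y := by
  rw [hasGradientAt_iff_hasFDerivAt]
  have := ((hasStrictFDerivAt_norm_sq y).hasFDerivAt).const_mul (σ / 2)
  refine this.congr_fderiv ?_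
  ext z
  simp
  ring

theorem gradX_psi {c : Fin p → E → G → ℝ} (hq : SmoothOn X Y (penalty c)) {x : E} {y : G}
    (hx : x ∈ X) (hy : y ∈ Y) (hh : DifferentiableAt ℝ (fun x' => h x' y) x) (ρ σ : ℝ) :
    gradX (psi h c ρ σ) x y = gradX h x y - ρ • gradX (penalty c) x y := by
  refine HasGradientAt.gradient ?_
  rw [hasGradientAt_iff_hasFDerivAt, map_sub, map_smul]
  exact (hh.hasGradientAt.hasFDerivAt.sub
    ((hq.hasGradientAt_left hx hy).hasFDerivAt.const_mul ρ)).sub_const _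

theorem gradY_psi {c : Fin p → E → G → ℝ} (hq : SmoothOn X Y (penalty c)) {x : E} {y : G}
    (hx : x ∈ X) (hy : y ∈ Y) (hh : DifferentiableAt ℝ (fun y' => h x y') y) (ρ σ : ℝ) :
    gradY (psi h c ρ σ) x y = gradY h x y - ρ • gradY (penalty c) x y - σ • y := by
  refine HasGradientAt.gradient ?_
  rw [hasGradientAt_iff_hasFDerivAt, map_sub, map_sub, map_smul]
  exact (hh.hasGradientAt.hasFDerivAt.sub
    ((hq.hasGradientAt_right hx hy).hasFDerivAt.const_mul ρ)).sub
      (hasGradientAt_half_norm_sq σ y).hasFDerivAt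

end Gradients

end SPACO

namespace SPACO

set_option maxSynthPendingDepth 3
set_option linter.unusedSectionVars false

open Filter Topology Set

/-! ### Danskin's theorem and first-order conditions for concave maximization. -/

section Maximizer

theorem sSup_image_eq {G : Type*} {Y : Set G} {g : G → ℝ} {y : G} (hy : y ∈ Y)
    (h : ∀ z ∈ Y, g z ≤ g y) : sSup (g '' Y) = g y :=
  IsGreatest.csSup_eq ⟨mem_image_of_mem g hy, by rintro _ ⟨z, hz, rfl⟩; exact h z hz⟩

/-- Danskin's theorem at a point where the maximizer is unique. -/
theorem hasFDerivAt_sSup {E G : Type*} [NormedAddCommGroup E] [NormedSpace ℝ E]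
    [NormedAddCommGroup G] [NormedSpace ℝ G] {Y : Set G} (hY : IsCompact Y) {Ψ : E → G → ℝ}
    {z : E} {y₀ : G} (hΨ : ∀ y ∈ Y, ContDiffAt ℝ 1 (Function.uncurry Ψ) (z, y)) (hy₀ : y₀ ∈ Y)
    (hmax : ∀ y ∈ Y, y ≠ y₀ → Ψ z y < Ψ z y₀) :
    HasFDerivAt (fun x => sSup ((fun y => Ψ x y) '' Y))
      ((fderiv ℝ (Function.uncurry Ψ) (z, y₀)).comp (ContinuousLinearMap.inl ℝ E G)) z := by
  have hstrict := (hΨ y₀ hy₀).hasStrictFDerivAt (by simp)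
  set A := fderiv ℝ (Function.uncurry Ψ) (z, y₀)
  have hA : ∀ᶠ x in 𝓝 z, ∀ y ∈ Y, ContDiffAt ℝ 1 (Function.uncurry Ψ) (x, y) :=
    hY.eventually_forall_of_forall_eventually fun y hy => (hΨ y hy).eventually (by simp)
  rw [hasFDerivAt_iff_isLittleO, Asymptotics.isLittleO_iff]
  intro ε hε
  obtain ⟨r, hr, hball⟩ := Metric.eventually_nhds_iff.1 (hstrict.isLittleO.def hε)
  -- By compactness of `Y` minus a ball, no point far from `y₀` can be a maximizer for `x` close to
  -- `z`.
  have hB : ∀ᶠ x in 𝓝 z, ∀ y ∈ Y \ Metric.ball y₀ r, Ψ x y < Ψ x y₀ := by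
    refine (hY.diff Metric.isOpen_ball).eventually_forall_of_forall_eventually fun y hy => ?_
    have h1 : ContinuousAt (fun q : E × G => Ψ q.1 q.2) (z, y) := (hΨ y hy.1).continuousAt
    have h2 : ContinuousAt (fun q : E × G => Ψ q.1 y₀) (z, y) :=
      ContinuousAt.comp (f := fun q : E × G => (q.1, y₀)) (g := Function.uncurry Ψ)
        (hΨ y₀ hy₀).continuousAt (by fun_prop)
    refine h1.eventually_lt h2 (hmax y hy.1 ?_)
    rintro rfl
    exact hy.2 (Metric.mem_ball_self hr)
  filter_upwards [hA, hB, Metric.ball_mem_nhds z hr] with x hxA hxB hxC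
  have hcont : ContinuousOn (Ψ x) Y := fun y hy =>
    (ContinuousAt.comp (f := fun y : G => (x, y)) (g := Function.uncurry Ψ)
      (hxA y hy).continuousAt (by fun_prop)).continuousWithinAt
  obtain ⟨w, hw, hwmax⟩ := hY.exists_isMaxOn ⟨y₀, hy₀⟩ hcont
  have hwr : dist w y₀ < r := by
    by_contra hcon
    exact absurd (hwmax hy₀) (not_le.2 (hxB w ⟨hw, hcon⟩))
  have hz : ∀ y ∈ Y, Ψ z y ≤ Ψ z y₀ := fun y hy => by
    rcases eq_or_ne y y₀ with rfl | hne
    · exact le_rfl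
    · exact (hmax y hy hne).le
  -- Strict differentiability is applied to two points with the same second coordinate, so the
  -- estimate is uniform in `y` near `y₀` and only `A (x - z, 0)` survives.
  have key : ∀ y, dist y y₀ < r → |Ψ x y - Ψ z y - A (x - z, 0)| ≤ ε * ‖x - z‖ := by
    intro y hy
    have := hball (y := ((x, y), (z, y))) (by
      simp only [Prod.dist_eq, dist_self]
      simp only [Metric.mem_ball] at hxC
      simp [hxC, hy])
    simpa [Prod.norm_def] using this
  rw [sSup_image_eq hw hwmax, sSup_image_eq hy₀ hz, Real.norm_eq_abs]
  -- The upper bound compares both values at the new maximizer `w`, the lower bound at the old one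
  -- `y₀`.
  have e1 := abs_le.1 (key w hwr)
  have e2 := abs_le.1 (key y₀ (by simpa using hr))
  have e3 := hz w hw
  have e4 : Ψ x y₀ ≤ Ψ x w := hwmax hy₀
  have e5 : (A.comp (ContinuousLinearMap.inl ℝ E G)) (x - z) = A (x - z, 0) := rfl
  rw [e5, abs_le]
  constructor <;> linarith [e1.2, e2.1]

variable {G : Type*} [NormedAddCommGroup G] [InnerProductSpace ℝ G] [CompleteSpace G]

theorem tendsto_slope_of_hasGradientAt {g : G → ℝ} {g' y : G} (h : HasGradientAt g g' y) (v : G) :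
    Tendsto (fun t : ℝ => t⁻¹ * (g (y + t • v) - g y)) (𝓝[>] 0) (𝓝 (inner ℝ g' v)) := by
  have hl : HasDerivAt (fun t : ℝ => y + t • v) v 0 := by
    simpa using ((hasDerivAt_id (0 : ℝ)).smul_const v).const_add y
  have h0 : HasFDerivAt g (InnerProductSpace.toDual ℝ G g') (y + (0 : ℝ) • v) := by
    simpa using h.hasFDerivAt
  have := (h0.comp_hasDerivAt (0 : ℝ) hl).tendsto_slope_zero_right
  simpa using this

theorem segment_point_mem {Y : Set G} (hY : Convex ℝ Y) {y z : G} (hy : y ∈ Y) (hz : z ∈ Y) {t : ℝ}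
    (h0 : 0 ≤ t) (h1 : t ≤ 1) : y + t • (z - y) ∈ Y := by
  have := hY hy hz (sub_nonneg.2 h1) h0 (by ring)
  convert this using 1
  module

theorem eventually_Ioc_nhdsGT_zero : ∀ᶠ t : ℝ in 𝓝[>] 0, 0 < t ∧ t ≤ 1 := by
  filter_upwards [Ioc_mem_nhdsGT (zero_lt_one' ℝ)] with t ht using ht

theorem inner_gradient_nonpos_of_isMaxOn {Y : Set G} (hY : Convex ℝ Y) {g : G → ℝ} {g' y : G}
    (h : HasGradientAt g g' y) (hy : y ∈ Y) (hmax : ∀ z ∈ Y, g z ≤ g y) {z : G} (hz : z ∈ Y) :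
    inner ℝ g' (z - y) ≤ 0 := by
  refine le_of_tendsto (tendsto_slope_of_hasGradientAt h (z - y)) ?_
  filter_upwards [eventually_Ioc_nhdsGT_zero] with t ht
  exact mul_nonpos_of_nonneg_of_nonpos (inv_nonneg.2 ht.1.le)
    (sub_nonpos.2 (hmax _ (segment_point_mem hY hy hz ht.1.le ht.2)))

theorem _root_.ConcaveOn.sub_le_inner_gradient {Y : Set G} {g : G → ℝ} {g' y : G}
    (hg : ConcaveOn ℝ Y g) (h : HasGradientAt g g' y) (hy : y ∈ Y) {z : G} (hz : z ∈ Y) :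
    g z - g y ≤ inner ℝ g' (z - y) := by
  refine ge_of_tendsto (tendsto_slope_of_hasGradientAt h (z - y)) ?_
  filter_upwards [eventually_Ioc_nhdsGT_zero] with t ht
  have h1 := hg.2 hy hz (sub_nonneg.2 ht.2) ht.1.le (by ring)
  rw [show (1 - t) • y + t • z = y + t • (z - y) by module] at h1
  rw [le_inv_mul_iff₀ ht.1]
  simp only [smul_eq_mul] at h1
  linarith

theorem _root_.ConcaveOn.inner_gradient_sub_nonpos {Y : Set G} {g : G → ℝ} {y z y' z' : G}
    (hg : ConcaveOn ℝ Y g) (h : HasGradientAt g y' y) (h' : HasGradientAt g z' z)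
    (hy : y ∈ Y) (hz : z ∈ Y) : inner ℝ (y' - z') (y - z) ≤ 0 := by
  have h1 := hg.sub_le_inner_gradient h hy hz
  have h2 := hg.sub_le_inner_gradient h' hz hy
  have : inner ℝ (y' - z') (y - z) = -(inner ℝ y' (z - y)) - inner ℝ z' (y - z) := by
    rw [inner_sub_left, ← inner_neg_right, neg_sub]
  linarith

end Maximizer

/-! ### The regularized inner problem and its value function. -/

section Value

variable {E G : Type*} [NormedAddCommGroup E] [InnerProductSpace ℝ E] [CompleteSpace E]
  [NormedAddCommGroup G] [InnerProductSpace ℝ G] [CompleteSpace G] {p : ℕ}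
  {X : Set E} {Y : Set G} {f : E → G → ℝ} {c : Fin p → E → G → ℝ}

/-- The maximizer over `Y` of the smooth approximation `ψ_{ρ,σ}(x, ·)`. -/
noncomputable def ystar (Y : Set G) (f : E → G → ℝ) (c : Fin p → E → G → ℝ) (ρ σ : ℝ) (x : E) : G :=
  open Classical in
  if h : ∃ y ∈ Y, ∀ z ∈ Y, psi f c ρ σ x z ≤ psi f c ρ σ x y then h.choose else 0

theorem StandingAssumptions.penalty_smooth (H : StandingAssumptions X Y f c) :
    SmoothOn X Y (penalty c) :=
  smoothOn_penalty H.c_smooth H.X_compact H.Y_compact H.X_convex H.Y_convex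

theorem StandingAssumptions.contDiffAt_psi (H : StandingAssumptions X Y f c) {x : E} {y : G}
    (hx : x ∈ X) (hy : y ∈ Y) (ρ σ : ℝ) :
    ContDiffAt ℝ 1 (Function.uncurry (psi f c ρ σ)) (x, y) := by
  have h1 := H.f_smooth.contDiffAt hx hy
  have h2 := H.penalty_smooth.contDiffAt hx hy
  have h3 : ContDiffAt ℝ 1 (fun q : E × G => σ / 2 * ‖q.2‖ ^ 2) (x, y) :=
    contDiffAt_const.mul (contDiffAt_snd.norm_sq ℝ)
  exact (h1.sub (contDiffAt_const (c := ρ) |>.mul h2)).sub h3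

theorem StandingAssumptions.hasFDerivAt_psi_left (H : StandingAssumptions X Y f c) {x : E} {y : G}
    (hx : x ∈ X) (hy : y ∈ Y) (ρ σ : ℝ) :
    HasFDerivAt (fun x' => psi f c ρ σ x' y)
      ((fderiv ℝ (Function.uncurry (psi f c ρ σ)) (x, y)).comp (ContinuousLinearMap.inl ℝ E G)) x :=
  HasFDerivAt.comp x (f := fun x' => (x', y))
    ((H.contDiffAt_psi hx hy ρ σ).differentiableAt (by simp)).hasFDerivAt
    (hasFDerivAt_prodMk_left x y)

theorem StandingAssumptions.gradX_psi_eq (H : StandingAssumptions X Y f c) {x : E} {y : G}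
    (hx : x ∈ X) (hy : y ∈ Y) (ρ σ : ℝ) :
    gradX (psi f c ρ σ) x y = gradX f x y - ρ • gradX (penalty c) x y :=
  gradX_psi H.penalty_smooth hx hy (H.f_smooth.hasGradientAt_left hx hy).differentiableAt ρ σ

theorem StandingAssumptions.gradY_psi_eq (H : StandingAssumptions X Y f c) {x : E} {y : G}
    (hx : x ∈ X) (hy : y ∈ Y) (ρ σ : ℝ) :
    gradY (psi f c ρ σ) x y = gradY f x y - ρ • gradY (penalty c) x y - σ • y :=
  gradY_psi H.penalty_smooth hx hy (H.f_smooth.hasGradientAt_right hx hy).differentiableAt ρ σ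

theorem StandingAssumptions.hasGradientAt_psi_right (H : StandingAssumptions X Y f c) {x : E}
    {y : G} (hx : x ∈ X) (hy : y ∈ Y) (ρ σ : ℝ) :
    HasGradientAt (fun y' => psi f c ρ σ x y') (gradY (psi f c ρ σ) x y) y :=
  DifferentiableAt.hasGradientAt (HasFDerivAt.comp y (f := fun y' => (x, y'))
    ((H.contDiffAt_psi hx hy ρ σ).differentiableAt (by simp)).hasFDerivAt
    (hasFDerivAt_prodMk_right x y)).differentiableAt

theorem StandingAssumptions.concaveOn_sub_penalty (H : StandingAssumptions X Y f c) {x : E}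
    (hx : x ∈ X) {ρ : ℝ} (hρ : 0 ≤ ρ) :
    ConcaveOn ℝ Y (fun y => f x y - ρ * penalty c x y) := by
  have hpen : ConvexOn ℝ Y (fun y => ∑ i, (max (c i x y) 0) ^ 2) := by
    have : ∀ s : Finset (Fin p), ConvexOn ℝ Y (fun y => ∑ i ∈ s, (max (c i x y) 0) ^ 2) := by
      intro s
      induction s using Finset.induction_on with
      | empty => simpa using convexOn_const 0 H.Y_convex
      | insert i s hi ih =>
        simp only [Finset.sum_insert hi]
        exact (((H.c_convex i x hx).sup (convexOn_const 0 H.Y_convex)).pow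
          (fun y _ => le_max_right _ _) 2).add ih
    exact this _
  refine (H.f_concave x hx).sub ((hpen.smul (c := 1 / 2) (by norm_num)).smul hρ)

/-- The gradient of the concave part is monotone decreasing; the term `-(σ/2)‖y‖²` contributes the
strong monotonicity modulus `σ`. -/
theorem StandingAssumptions.inner_gradY_psi_sub_le (H : StandingAssumptions X Y f c) {x : E}
    (hx : x ∈ X) {ρ : ℝ} (hρ : 0 ≤ ρ) (σ : ℝ) {y z : G} (hy : y ∈ Y) (hz : z ∈ Y) :
    inner ℝ (gradY (psi f c ρ σ) x y - gradY (psi f c ρ σ) x z) (y - z) ≤ -σ * ‖y - z‖ ^ 2 := by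
  have hg : ∀ {y}, y ∈ Y → HasGradientAt (fun y => f x y - ρ * penalty c x y)
      (gradY f x y - ρ • gradY (penalty c) x y) y := fun hy => by
    rw [hasGradientAt_iff_hasFDerivAt, map_sub, map_smul]
    exact (H.f_smooth.hasGradientAt_right hx hy).hasFDerivAt.sub
      ((H.penalty_smooth.hasGradientAt_right hx hy).hasFDerivAt.const_mul ρ)
  have := (H.concaveOn_sub_penalty hx hρ).inner_gradient_sub_nonpos (hg hy) (hg hz) hy hz
  rw [H.gradY_psi_eq hx hy, H.gradY_psi_eq hx hz, ← real_inner_self_eq_norm_sq]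
  set a := gradY f x y - ρ • gradY (penalty c) x y
  set b := gradY f x z - ρ • gradY (penalty c) x z
  rw [show a - σ • y - (b - σ • z) = (a - b) - σ • (y - z) by module, inner_sub_left,
    inner_smul_left]
  simp only [conj_trivial]
  linarith

theorem StandingAssumptions.ystar_spec (H : StandingAssumptions X Y f c) {x : E} (hx : x ∈ X)
    (ρ σ : ℝ) : ystar Y f c ρ σ x ∈ Y ∧
      ∀ z ∈ Y, psi f c ρ σ x z ≤ psi f c ρ σ x (ystar Y f c ρ σ x) := by
  have h : ∃ y ∈ Y, ∀ z ∈ Y, psi f c ρ σ x z ≤ psi f c ρ σ x y := by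
    obtain ⟨y, hy, hmax⟩ := H.Y_compact.exists_isMaxOn H.Y_nonempty (f := psi f c ρ σ x)
      fun y hy => (H.hasGradientAt_psi_right hx hy ρ σ).differentiableAt.continuousAt.continuousWithinAt
    exact ⟨y, hy, fun z hz => hmax hz⟩
  rw [ystar, dif_pos h]
  exact h.choose_spec

theorem StandingAssumptions.ystar_mem (H : StandingAssumptions X Y f c) {x : E} (hx : x ∈ X)
    (ρ σ : ℝ) : ystar Y f c ρ σ x ∈ Y := (H.ystar_spec hx ρ σ).1

theorem StandingAssumptions.gradY_psi_ystar_mem (H : StandingAssumptions X Y f c) {x : E}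
    (hx : x ∈ X) (ρ σ : ℝ) :
    gradY (psi f c ρ σ) x (ystar Y f c ρ σ x) ∈ normalCone Y (ystar Y f c ρ σ x) :=
  ⟨H.ystar_mem hx ρ σ, fun _ hz => inner_gradient_nonpos_of_isMaxOn H.Y_convex
    (H.hasGradientAt_psi_right hx (H.ystar_mem hx ρ σ) ρ σ) (H.ystar_mem hx ρ σ)
    (H.ystar_spec hx ρ σ).2 hz⟩

/-- A second maximizer would satisfy the same first-order condition, and strong monotonicity would
force the two to coincide. Danskin's theorem needs this uniqueness. -/
theorem StandingAssumptions.psi_lt_psi_ystar (H : StandingAssumptions X Y f c) {x : E}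
    (hx : x ∈ X) {ρ σ : ℝ} (hρ : 0 ≤ ρ) (hσ : 0 < σ) {y : G} (hy : y ∈ Y)
    (hne : y ≠ ystar Y f c ρ σ x) : psi f c ρ σ x y < psi f c ρ σ x (ystar Y f c ρ σ x) := by
  by_contra! hcon
  obtain ⟨hm, hmax⟩ := H.ystar_spec hx ρ σ
  set w := ystar Y f c ρ σ x
  have h1 := (H.gradY_psi_ystar_mem hx ρ σ).2 y hy
  have h2 := inner_gradient_nonpos_of_isMaxOn H.Y_convex (H.hasGradientAt_psi_right hx hy ρ σ) hy
    (fun z hz => (hmax z hz).trans hcon) hm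
  have h3 := H.inner_gradY_psi_sub_le hx hρ σ hm hy
  have e : w - y = -(y - w) := (neg_sub y w).symm
  rw [inner_sub_left, e, inner_neg_right, inner_neg_right, norm_neg] at h3
  rw [e, inner_neg_right] at h2
  change inner ℝ (gradY (psi f c ρ σ) x w) (y - w) ≤ 0 at h1
  have : 0 < ‖y - w‖ := norm_pos_iff.2 (sub_ne_zero.2 hne)
  nlinarith [mul_pos hσ (pow_pos this 2)]

theorem StandingAssumptions.hasGradientAt_phi (H : StandingAssumptions X Y f c) {x : E}
    (hx : x ∈ X) {ρ σ : ℝ} (hρ : 0 ≤ ρ) (hσ : 0 < σ) :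
    HasGradientAt (phi Y f c ρ σ) (gradX (psi f c ρ σ) x (ystar Y f c ρ σ x)) x := by
  have hd := hasFDerivAt_sSup H.Y_compact (fun y hy => H.contDiffAt_psi hx hy ρ σ)
    (H.ystar_mem hx ρ σ) (fun y hy hne => H.psi_lt_psi_ystar hx hρ hσ hy hne)
  rw [gradX, gradient, (H.hasFDerivAt_psi_left hx (H.ystar_mem hx ρ σ) ρ σ).fderiv,
    hasGradientAt_iff_hasFDerivAt, LinearIsometryEquiv.apply_symm_apply]
  exact hd

theorem StandingAssumptions.phi_eq (H : StandingAssumptions X Y f c) {x : E} (hx : x ∈ X)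
    (ρ σ : ℝ) : phi Y f c ρ σ x = psi f c ρ σ x (ystar Y f c ρ σ x) :=
  sSup_image_eq (H.ystar_mem hx ρ σ) (H.ystar_spec hx ρ σ).2

/-- A constant `L ≥ 1` bounding the data of the problem. -/
structure ProblemBounds (X : Set E) (Y : Set G) (f : E → G → ℝ) (c : Fin p → E → G → ℝ)
    (L : ℝ) : Prop where
  one_le : 1 ≤ L
  f_bounds : GradBounds X Y f L
  penalty_bounds : GradBounds X Y (penalty c) L
  norm_x_le : ∀ x ∈ X, ‖x‖ ≤ L
  norm_y_le : ∀ y ∈ Y, ‖y‖ ≤ L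

theorem StandingAssumptions.exists_problemBounds (H : StandingAssumptions X Y f c) :
    ∃ L, ProblemBounds X Y f c L := by
  obtain ⟨L₁, h₁⟩ := H.f_smooth.exists_gradBounds H.X_compact H.Y_compact
  obtain ⟨L₂, h₂⟩ := H.penalty_smooth.exists_gradBounds H.X_compact H.Y_compact
  obtain ⟨L₃, h₃⟩ := H.X_compact.exists_bound_of_continuousOn continuousOn_id
  obtain ⟨L₄, h₄⟩ := H.Y_compact.exists_bound_of_continuousOn continuousOn_id
  refine ⟨max 1 (max (max L₁ L₂) (max L₃ L₄)), le_max_left _ _, h₁.mono ?_, h₂.mono ?_,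
    fun x hx => (h₃ x hx).trans ?_, fun y hy => (h₄ y hy).trans ?_⟩ <;> simp

variable {L : ℝ}

theorem ProblemBounds.gradX_psi_lip (B : ProblemBounds X Y f c L)
    (H : StandingAssumptions X Y f c) {ρ : ℝ} (hρ : 0 ≤ ρ) (σ : ℝ) {x₁ x₂ : E} {y₁ y₂ : G}
    (hx₁ : x₁ ∈ X) (hy₁ : y₁ ∈ Y) (hx₂ : x₂ ∈ X) (hy₂ : y₂ ∈ Y) :
    ‖gradX (psi f c ρ σ) x₁ y₁ - gradX (psi f c ρ σ) x₂ y₂‖ ≤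
      (1 + ρ) * L * (‖x₁ - x₂‖ + ‖y₁ - y₂‖) := by
  rw [H.gradX_psi_eq hx₁ hy₁, H.gradX_psi_eq hx₂ hy₂]
  have h1 := B.f_bounds.gradX_lip _ hx₁ _ hy₁ _ hx₂ _ hy₂
  have h2 := B.penalty_bounds.gradX_lip _ hx₁ _ hy₁ _ hx₂ _ hy₂
  rw [sub_sub_sub_comm, ← smul_sub]
  refine (norm_sub_le _ _).trans ?_
  rw [norm_smul, Real.norm_of_nonneg hρ]
  nlinarith [mul_le_mul_of_nonneg_left h2 hρ]

theorem ProblemBounds.gradY_psi_lip (B : ProblemBounds X Y f c L)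
    (H : StandingAssumptions X Y f c) {ρ σ : ℝ} (hρ : 0 ≤ ρ) (hσ : 0 ≤ σ) {x : E} {y₁ y₂ : G}
    (hx : x ∈ X) (hy₁ : y₁ ∈ Y) (hy₂ : y₂ ∈ Y) :
    ‖gradY (psi f c ρ σ) x y₁ - gradY (psi f c ρ σ) x y₂‖ ≤
      ((1 + ρ) * L + σ) * ‖y₁ - y₂‖ := by
  rw [H.gradY_psi_eq hx hy₁, H.gradY_psi_eq hx hy₂]
  have h1 := B.f_bounds.gradY_lip _ hx _ hy₁ _ hx _ hy₂
  have h2 := B.penalty_bounds.gradY_lip _ hx _ hy₁ _ hx _ hy₂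
  rw [sub_self, norm_zero, zero_add] at h1 h2
  rw [sub_sub_sub_comm, ← smul_sub, sub_sub_sub_comm, ← smul_sub]
  refine (norm_sub_le _ _).trans ?_
  refine (add_le_add_left (norm_sub_le _ _) _).trans ?_
  rw [norm_smul, norm_smul, Real.norm_of_nonneg hρ, Real.norm_of_nonneg hσ]
  nlinarith [mul_le_mul_of_nonneg_left h2 hρ]

theorem ProblemBounds.norm_gradY_psi_le (B : ProblemBounds X Y f c L)
    (H : StandingAssumptions X Y f c) {ρ σ : ℝ} (hρ : 0 ≤ ρ) (hσ : 0 ≤ σ) {x : E} {y : G}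
    (hx : x ∈ X) (hy : y ∈ Y) : ‖gradY (psi f c ρ σ) x y‖ ≤ (1 + ρ) * L + σ * L := by
  rw [H.gradY_psi_eq hx hy]
  have h1 := B.f_bounds.gradY_le _ hx _ hy
  have h2 := B.penalty_bounds.gradY_le _ hx _ hy
  have h3 := B.norm_y_le _ hy
  refine (norm_sub_le _ _).trans ((add_le_add_left (norm_sub_le _ _) _).trans ?_)
  rw [norm_smul, norm_smul, Real.norm_of_nonneg hρ, Real.norm_of_nonneg hσ]
  nlinarith [mul_le_mul_of_nonneg_left h2 hρ, mul_le_mul_of_nonneg_left h3 hσ]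

/-- Adding the two variational inequalities and using strong monotonicity for the first parameters
gives `σ₁‖y₁ - y₂‖² ≤ ⟪d, y₁ - y₂⟫`, where `d` is the change of the gradient at the single point
`y₂`. The estimate covers a move of `x` and a change of `ρ, σ` at once. -/
theorem ProblemBounds.norm_ystar_sub_le (B : ProblemBounds X Y f c L)
    (H : StandingAssumptions X Y f c) {ρ₁ σ₁ ρ₂ σ₂ : ℝ} (hρ₁ : 0 ≤ ρ₁) (hσ₁ : 0 < σ₁)
    {x₁ x₂ : E} (hx₁ : x₁ ∈ X) (hx₂ : x₂ ∈ X) :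
    ‖ystar Y f c ρ₁ σ₁ x₁ - ystar Y f c ρ₂ σ₂ x₂‖ ≤
      ((1 + ρ₁) * L * ‖x₁ - x₂‖ + |ρ₁ - ρ₂| * L + |σ₁ - σ₂| * L) / σ₁ := by
  have v₁ := H.gradY_psi_ystar_mem hx₁ ρ₁ σ₁
  have v₂ := H.gradY_psi_ystar_mem hx₂ ρ₂ σ₂
  set y₁ := ystar Y f c ρ₁ σ₁ x₁
  set y₂ := ystar Y f c ρ₂ σ₂ x₂
  have hy₁ : y₁ ∈ Y := v₁.1
  have hy₂ : y₂ ∈ Y := v₂.1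
  have e1 := v₁.2 y₂ hy₂
  have e2 := v₂.2 y₁ hy₁
  have e3 := H.inner_gradY_psi_sub_le hx₁ hρ₁ σ₁ hy₁ hy₂
  set a := gradY (psi f c ρ₁ σ₁) x₁ y₁
  set d := gradY (psi f c ρ₁ σ₁) x₁ y₂ - gradY (psi f c ρ₂ σ₂) x₂ y₂ with hd
  have e4 : σ₁ * ‖y₁ - y₂‖ ^ 2 ≤ ‖d‖ * ‖y₁ - y₂‖ := by
    refine le_trans ?_ (real_inner_le_norm d (y₁ - y₂))
    rw [hd, inner_sub_left]
    rw [inner_sub_left] at e3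
    rw [← neg_sub y₁ y₂, inner_neg_right] at e1
    linarith
  have e5 : ‖d‖ ≤ (1 + ρ₁) * L * ‖x₁ - x₂‖ + |ρ₁ - ρ₂| * L + |σ₁ - σ₂| * L := by
    have h1 := B.f_bounds.gradY_lip _ hx₁ _ hy₂ _ hx₂ _ hy₂
    have h2 := B.penalty_bounds.gradY_lip _ hx₁ _ hy₂ _ hx₂ _ hy₂
    have h3 := B.penalty_bounds.gradY_le _ hx₂ _ hy₂
    have h4 := B.norm_y_le _ hy₂
    rw [sub_self, norm_zero, add_zero] at h1 h2
    rw [hd, H.gradY_psi_eq hx₁ hy₂, H.gradY_psi_eq hx₂ hy₂]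
    calc _ = ‖(gradY f x₁ y₂ - gradY f x₂ y₂)
          - ρ₁ • (gradY (penalty c) x₁ y₂ - gradY (penalty c) x₂ y₂)
          - (ρ₁ - ρ₂) • gradY (penalty c) x₂ y₂ - (σ₁ - σ₂) • y₂‖ := by congr 1; module
      _ ≤ ‖gradY f x₁ y₂ - gradY f x₂ y₂‖
          + ‖ρ₁ • (gradY (penalty c) x₁ y₂ - gradY (penalty c) x₂ y₂)‖
          + ‖(ρ₁ - ρ₂) • gradY (penalty c) x₂ y₂‖ + ‖(σ₁ - σ₂) • y₂‖ := by
        refine (norm_sub_le _ _).trans (add_le_add_left ?_ _)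
        refine (norm_sub_le _ _).trans (add_le_add_left ?_ _)
        exact norm_sub_le _ _
      _ ≤ L * ‖x₁ - x₂‖ + ρ₁ * (L * ‖x₁ - x₂‖) + |ρ₁ - ρ₂| * L + |σ₁ - σ₂| * L := by
        simp only [norm_smul, Real.norm_of_nonneg hρ₁]
        simp only [Real.norm_eq_abs]
        gcongr
      _ = _ := by ring
  rw [le_div_iff₀ hσ₁]
  refine le_trans ?_ e5
  -- One factor `‖y₁ - y₂‖` is cancelled, which requires it to be positive.
  rcases (norm_nonneg (y₁ - y₂)).eq_or_lt with h0 | h0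
  · rw [← h0]; simp
  · nlinarith

/-- A Lipschitz constant of `∇φ_{ρ,σ}` on `X`. -/
noncomputable def phiLip (L ρ σ : ℝ) : ℝ := (1 + ρ) * L * (1 + (1 + ρ) * L / σ)

theorem ProblemBounds.gradient_phi_lip (B : ProblemBounds X Y f c L)
    (H : StandingAssumptions X Y f c) {ρ σ : ℝ} (hρ : 0 ≤ ρ) (hσ : 0 < σ)
    {x₁ x₂ : E} (hx₁ : x₁ ∈ X) (hx₂ : x₂ ∈ X) :
    ‖gradient (phi Y f c ρ σ) x₁ - gradient (phi Y f c ρ σ) x₂‖ ≤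
      phiLip L ρ σ * ‖x₁ - x₂‖ := by
  rw [(H.hasGradientAt_phi hx₁ hρ hσ).gradient, (H.hasGradientAt_phi hx₂ hρ hσ).gradient]
  refine (B.gradX_psi_lip H hρ σ hx₁ (H.ystar_mem hx₁ ρ σ) hx₂ (H.ystar_mem hx₂ ρ σ)).trans ?_
  have h := B.norm_ystar_sub_le H (ρ₂ := ρ) (σ₂ := σ) hρ hσ hx₁ hx₂
  simp only [sub_self, abs_zero, zero_mul, add_zero] at h
  have hL := B.one_le
  calc _ ≤ (1 + ρ) * L * (‖x₁ - x₂‖ + (1 + ρ) * L * ‖x₁ - x₂‖ / σ) := by gcongr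
    _ = _ := by rw [phiLip]; ring

/-- The mean value theorem on the segment suffices, since a loss of the usual factor `1/2` in the
quadratic term is harmless. -/
theorem ProblemBounds.phi_le_add (B : ProblemBounds X Y f c L)
    (H : StandingAssumptions X Y f c) {ρ σ : ℝ} (hρ : 0 ≤ ρ) (hσ : 0 < σ)
    {x₁ x₂ : E} (hx₁ : x₁ ∈ X) (hx₂ : x₂ ∈ X) :
    phi Y f c ρ σ x₂ ≤ phi Y f c ρ σ x₁ + inner ℝ (gradient (phi Y f c ρ σ) x₁) (x₂ - x₁) +
      phiLip L ρ σ * ‖x₂ - x₁‖ ^ 2 := by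
  obtain ⟨z, hz, hmv⟩ := domain_mvt (s := X) (f := phi Y f c ρ σ)
    (f' := fun z => InnerProductSpace.toDual ℝ E (gradient (phi Y f c ρ σ) z))
    (fun z hz => (H.hasGradientAt_phi hz hρ hσ).differentiableAt.hasGradientAt.hasFDerivAt.hasFDerivWithinAt)
    H.X_convex hx₁ hx₂
  have hzX := H.X_convex.segment_subset hx₁ hx₂ hz
  have h1 := B.gradient_phi_lip H hρ hσ hzX hx₁
  have h2 : ‖z - x₁‖ ≤ ‖x₂ - x₁‖ := by
    obtain ⟨t, ⟨ht0, ht1⟩, rfl⟩ := (segment_eq_image' ℝ x₁ x₂ ▸ hz)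
    rw [add_sub_cancel_left, norm_smul, Real.norm_of_nonneg ht0]
    exact mul_le_of_le_one_left (norm_nonneg _) ht1
  have hL := B.one_le
  have hK : 0 ≤ phiLip L ρ σ := by rw [phiLip]; positivity
  rw [InnerProductSpace.toDual_apply_apply] at hmv
  set g := gradient (phi Y f c ρ σ)
  have h3 : inner ℝ (g z - g x₁) (x₂ - x₁) ≤ phiLip L ρ σ * ‖x₂ - x₁‖ ^ 2 := by
    refine (real_inner_le_norm _ _).trans ?_
    calc _ ≤ (phiLip L ρ σ * ‖x₂ - x₁‖) * ‖x₂ - x₁‖ := by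
            gcongr; exact h1.trans (by gcongr)
      _ = _ := by ring
  rw [inner_sub_left] at h3
  linarith

/-- Raising `ρ` can only lower the value, the penalty being nonnegative. Hence only the change of
`σ` costs anything, although `ρ` grows without bound. -/
theorem ProblemBounds.phi_change_le (B : ProblemBounds X Y f c L)
    (H : StandingAssumptions X Y f c) {ρ σ ρ' σ' : ℝ} (hρ : ρ ≤ ρ') {x : E} (hx : x ∈ X) :
    phi Y f c ρ' σ' x ≤ phi Y f c ρ σ x + |σ - σ'| * L ^ 2 := by
  obtain ⟨hm, hmax⟩ := H.ystar_spec hx ρ σ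
  have hm' := H.ystar_mem hx ρ' σ'
  rw [H.phi_eq hx, H.phi_eq hx]
  set y := ystar Y f c ρ' σ' x
  have h1 := hmax y hm'
  have h2 : psi f c ρ' σ' x y ≤ psi f c ρ σ x y + |σ - σ'| * L ^ 2 := by
    have hp : 0 ≤ penalty c x y :=
      mul_nonneg (by norm_num) (Finset.sum_nonneg fun i _ => sq_nonneg _)
    have hy : ‖y‖ ^ 2 ≤ L ^ 2 := by gcongr; exact B.norm_y_le y hm'
    have : (σ - σ') / 2 * ‖y‖ ^ 2 ≤ |σ - σ'| * L ^ 2 := by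
      refine mul_le_mul ?_ hy (sq_nonneg _) (abs_nonneg _)
      linarith [le_abs_self (σ - σ'), abs_nonneg (σ - σ')]
    simp only [psi]
    nlinarith [mul_le_mul_of_nonneg_right hρ hp]
  linarith

/-- The penalty vanishes at a feasible `y`, which makes the lower bound independent of `ρ`. -/
theorem ProblemBounds.le_phi (B : ProblemBounds X Y f c L)
    (H : StandingAssumptions X Y f c) {ρ σ : ℝ} (hσ : 0 ≤ σ) {x : E} (hx : x ∈ X) :
    -L - σ * L ^ 2 ≤ phi Y f c ρ σ x := by
  obtain ⟨y, hy, hc⟩ := H.feasible x hx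
  rw [H.phi_eq hx]
  refine le_trans ?_ ((H.ystar_spec hx ρ σ).2 y hy)
  have hp : penalty c x y = 0 := by simp [penalty, hc]
  have h1 := (abs_le.1 (B.f_bounds.abs_le x hx y hy)).1
  have h2 : ‖y‖ ^ 2 ≤ L ^ 2 := by gcongr; exact B.norm_y_le y hy
  rw [psi, hp]
  nlinarith [sq_nonneg L, mul_le_mul_of_nonneg_left h2 hσ, mul_nonneg hσ (sq_nonneg L)]

/-- Expanding the square, strong monotonicity gives the gain `-2βσ` and the Lipschitz constant of
the gradient gives the loss in `β²`. -/
theorem ProblemBounds.norm_ascent_step_sub_sq_le (B : ProblemBounds X Y f c L)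
    (H : StandingAssumptions X Y f c) {ρ σ β : ℝ} (hρ : 0 ≤ ρ) (hσ : 0 ≤ σ) (hβ : 0 ≤ β) {x : E}
    {y z : G} (hx : x ∈ X) (hy : y ∈ Y) (hz : z ∈ Y) :
    ‖(y + β • gradY (psi f c ρ σ) x y) - (z + β • gradY (psi f c ρ σ) x z)‖ ^ 2 ≤
      (1 - 2 * β * σ + β ^ 2 * ((1 + ρ) * L + σ) ^ 2) * ‖y - z‖ ^ 2 := by
  have h1 := H.inner_gradY_psi_sub_le hx hρ σ hy hz
  have h2 := B.gradY_psi_lip H hρ hσ hx hy hz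
  set d := gradY (psi f c ρ σ) x y - gradY (psi f c ρ σ) x z with hd
  have h3 : ‖d‖ ^ 2 ≤ (((1 + ρ) * L + σ) * ‖y - z‖) ^ 2 := by gcongr
  rw [show (y + β • gradY (psi f c ρ σ) x y) - (z + β • gradY (psi f c ρ σ) x z) =
    (y - z) + β • d by rw [hd]; module, norm_add_sq_real, inner_smul_right, norm_smul,
    Real.norm_of_nonneg hβ, real_inner_comm]
  nlinarith [mul_le_mul_of_nonneg_left h1 hβ, mul_le_mul_of_nonneg_left h3 (sq_nonneg β)]

theorem StandingAssumptions.proj_ystar (H : StandingAssumptions X Y f c) {x : E} (hx : x ∈ X)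
    (ρ σ : ℝ) {β : ℝ} (hβ : 0 ≤ β) :
    proj Y (ystar Y f c ρ σ x + β • gradY (psi f c ρ σ) x (ystar Y f c ρ σ x)) =
      ystar Y f c ρ σ x :=
  proj_add_of_mem_normalCone H.Y_compact H.Y_convex
    (smul_mem_normalCone (H.gradY_psi_ystar_mem hx ρ σ) hβ)

end Value

end SPACO

namespace SPACO

set_option maxSynthPendingDepth 3
set_option linter.unusedSectionVars false

open Filter Topology Set

/-! ### From vanishing residuals to KKT points. -/

section KKT

variable {E G : Type*} [NormedAddCommGroup E] [InnerProductSpace ℝ E] [CompleteSpace E]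
  [NormedAddCommGroup G] [InnerProductSpace ℝ G] [CompleteSpace G] {p : ℕ}
  {X : Set E} {Y : Set G} {f h : E → G → ℝ} {c : Fin p → E → G → ℝ} {L : ℝ}

theorem GradBounds.tendsto_grad (hb : GradBounds X Y h L) {x : ℕ → E} {y : ℕ → G} {x' : E} {y' : G}
    (hx : ∀ j, x j ∈ X) (hy : ∀ j, y j ∈ Y) (hx' : x' ∈ X) (hy' : y' ∈ Y)
    (hxt : Tendsto x atTop (𝓝 x')) (hyt : Tendsto y atTop (𝓝 y')) :
    Tendsto (fun j => gradX h (x j) (y j)) atTop (𝓝 (gradX h x' y')) ∧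
      Tendsto (fun j => gradY h (x j) (y j)) atTop (𝓝 (gradY h x' y')) := by
  have hlim : Tendsto (fun j => L * (‖x j - x'‖ + ‖y j - y'‖)) atTop (𝓝 0) := by
    simpa using ((tendsto_iff_norm_sub_tendsto_zero.1 hxt).add
      (tendsto_iff_norm_sub_tendsto_zero.1 hyt)).const_mul L
  constructor <;> rw [tendsto_iff_norm_sub_tendsto_zero]
  · exact squeeze_zero (fun _ => norm_nonneg _)
      (fun j => hb.gradX_lip _ (hx j) _ (hy j) _ hx' _ hy') hlim
  · exact squeeze_zero (fun _ => norm_nonneg _)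
      (fun j => hb.gradY_lip _ (hx j) _ (hy j) _ hx' _ hy') hlim

theorem SmoothOn.tendsto (hs : SmoothOn X Y h) {x : ℕ → E} {y : ℕ → G} {x' : E} {y' : G}
    (hx' : x' ∈ X) (hy' : y' ∈ Y) (hxt : Tendsto x atTop (𝓝 x')) (hyt : Tendsto y atTop (𝓝 y')) :
    Tendsto (fun j => h (x j) (y j)) atTop (𝓝 (h x' y')) :=
  (hs.differentiableAt hx' hy').continuousAt.tendsto.comp (hxt.prodMk_nhds hyt)

/-- The variational inequality of the projection step, divided by `α`. The cone is taken at the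
projected point `x - α𝒢`, not at `x`. -/
theorem residual_sub_gradient_mem (H : StandingAssumptions X Y f c) {α : ℝ} (hα : 0 < α)
    (ρ σ : ℝ) (x : E) :
    residual X Y f c ρ σ α x - gradient (phi Y f c ρ σ) x ∈
      normalCone X (x - α • residual X Y f c ρ σ α x) := by
  set g := gradient (phi Y f c ρ σ) x with hg
  have hz : x - α • residual X Y f c ρ σ α x = proj X (x - α • g) := by
    rw [residual, smul_smul, mul_one_div_cancel hα.ne', one_smul, ← hg]; abel
  rw [hz]
  refine ⟨proj_mem H.X_compact H.X_nonempty _, fun w hw => ?_⟩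
  have h1 := inner_sub_proj_nonpos H.X_compact H.X_nonempty H.X_convex (x - α • g) hw
  have : residual X Y f c ρ σ α x - g = (1 / α) • (x - α • g - proj X (x - α • g)) := by
    rw [residual, ← hg, sub_right_comm, smul_sub (1 / α) _ (α • g), smul_smul,
      one_div_mul_cancel hα.ne', one_smul]
  rw [this, inner_smul_left]
  exact mul_nonpos_of_nonneg_of_nonpos (by simpa using hα.le) h1

/-- The residual of the penalty at `(x, y*(x))` that enters the constraint qualification. -/
theorem ProblemBounds.penalty_residual_le (B : ProblemBounds X Y f c L)
    (H : StandingAssumptions X Y f c) {ρ σ α b : ℝ} (hρ : 0 < ρ) (hσ : 0 < σ) (hα : 0 < α)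
    (hb : 0 < b) {x : E} (hx : x ∈ X) :
    √(‖x - proj X (x + b • gradX (penalty c) x (ystar Y f c ρ σ x))‖ ^ 2 +
      ‖ystar Y f c ρ σ x -
        proj Y (ystar Y f c ρ σ x - b • gradY (penalty c) x (ystar Y f c ρ σ x))‖ ^ 2) ≤
      2 * α * ‖residual X Y f c ρ σ α x‖ +
        b / ρ * (‖residual X Y f c ρ σ α x‖ + 2 * L + σ * L) := by
  have hn := H.gradY_psi_ystar_mem hx ρ σ
  have hr := residual_sub_gradient_mem H hα ρ σ x
  rw [(H.hasGradientAt_phi hx hρ.le hσ).gradient] at hr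
  set y := ystar Y f c ρ σ x
  have hy : y ∈ Y := hn.1
  set R := residual X Y f c ρ σ α x
  rw [H.gradX_psi_eq hx hy] at hr
  rw [H.gradY_psi_eq hx hy] at hn
  have hbρ : 0 ≤ b / ρ := by positivity
  have hyb : ‖y - proj Y (y - b • gradY (penalty c) x y)‖ ≤ b / ρ * (L + σ * L) := by
    -- The normal vector is scaled by `b/ρ`, so that its penalty part becomes exactly `b ∇_y q` (`q`
    -- the penalty) and cancels against the argument of the other projection; what remains is
    -- `O(1/ρ)`.
    have e := proj_add_of_mem_normalCone H.Y_compact H.Y_convex (smul_mem_normalCone hn hbρ)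
    nth_rw 1 [← e]
    refine (norm_proj_sub_proj_le H.Y_compact H.Y_nonempty H.Y_convex _ _).trans ?_
    have e2 : y + (b / ρ) • (gradY f x y - ρ • gradY (penalty c) x y - σ • y) -
        (y - b • gradY (penalty c) x y) = (b / ρ) • (gradY f x y - σ • y) := by
      have : b = b / ρ * ρ := by field_simp
      nth_rw 2 [this]
      module
    rw [e2, norm_smul, Real.norm_of_nonneg hbρ]
    refine mul_le_mul_of_nonneg_left ((norm_sub_le _ _).trans ?_) hbρ
    rw [norm_smul, Real.norm_of_nonneg hσ.le]
    gcongr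
    · exact B.f_bounds.gradY_le x hx y hy
    · exact B.norm_y_le y hy
  have hxb : ‖x - proj X (x + b • gradX (penalty c) x y)‖ ≤
      2 * α * ‖R‖ + b / ρ * (‖R‖ + L) := by
    -- The same cancellation in `x`, now starting from the projected point `x - αR`; the shift is
    -- paid for twice, hence `2α‖R‖`.
    have e := proj_add_of_mem_normalCone H.X_compact H.X_convex (smul_mem_normalCone hr hbρ)
    set u := proj X (x + b • gradX (penalty c) x y)
    have e1 : ‖x - u‖ ≤ ‖α • R‖ + ‖x - α • R - u‖ := by
      calc ‖x - u‖ = ‖α • R + (x - α • R - u)‖ := by congr 1; abel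
        _ ≤ _ := norm_add_le _ _
    have e2 : ‖x - α • R - u‖ ≤ ‖α • R‖ + b / ρ * (‖R‖ + L) := by
      nth_rw 1 [← e]
      refine (norm_proj_sub_proj_le H.X_compact H.X_nonempty H.X_convex _ _).trans ?_
      have e2 : x - α • R + (b / ρ) • (R - (gradX f x y - ρ • gradX (penalty c) x y)) -
          (x + b • gradX (penalty c) x y) = (b / ρ) • (R - gradX f x y) - α • R := by
        have : b = b / ρ * ρ := by field_simp
        nth_rw 2 [this]
        module
      rw [e2, add_comm]
      refine (norm_sub_le _ _).trans (add_le_add_left ?_ _)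
      rw [norm_smul, Real.norm_of_nonneg hbρ]
      refine mul_le_mul_of_nonneg_left ((norm_sub_le _ _).trans ?_) hbρ
      gcongr
      exact B.f_bounds.gradX_le x hx y hy
    rw [norm_smul, Real.norm_of_nonneg hα.le] at e1 e2
    linarith
  have hs : √(‖x - proj X (x + b • gradX (penalty c) x y)‖ ^ 2 +
      ‖y - proj Y (y - b • gradY (penalty c) x y)‖ ^ 2) ≤
      ‖x - proj X (x + b • gradX (penalty c) x y)‖ +
        ‖y - proj Y (y - b • gradY (penalty c) x y)‖ := by
    rw [Real.sqrt_le_left (by positivity)]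
    nlinarith [norm_nonneg (x - proj X (x + b • gradX (penalty c) x y)),
      norm_nonneg (y - proj Y (y - b • gradY (penalty c) x y))]
  refine hs.trans ((add_le_add hxb hyb).trans (le_of_eq ?_))
  ring

theorem max_le_two_mul_sqrt_penalty (c : Fin p → E → G → ℝ) (x : E) (y : G) (i : Fin p) :
    max (c i x y) 0 ≤ 2 * √(penalty c x y) := by
  have h1 : (max (c i x y) 0) ^ 2 ≤ 2 * penalty c x y := by
    rw [penalty, ← mul_assoc, mul_one_div_cancel two_ne_zero, one_mul]
    exact Finset.single_le_sum (f := fun i => (max (c i x y) 0) ^ 2) (fun _ _ => sq_nonneg _)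
      (Finset.mem_univ i)
  have h0 : 0 ≤ penalty c x y := by nlinarith [sq_nonneg (max (c i x y) 0)]
  refine abs_le_of_sq_le_sq' ?_ (by positivity) |>.2
  rw [mul_pow, Real.sq_sqrt h0]
  linarith

/-- The multipliers are limits of `ρ [c]₊` at `(x, y*(x))`. The constraint qualification is used
only to bound them; after that the normal cone inclusions pass to the limit by closedness of the
graph. -/
theorem ProblemBounds.isKKT_of_tendsto (B : ProblemBounds X Y f c L)
    (H : StandingAssumptions X Y f c) {ρ σ α : ℕ → ℝ} (hρ0 : ∀ j, 0 < ρ j) (hσ0 : ∀ j, 0 < σ j)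
    (hα0 : ∀ j, 0 < α j) (hρ : Tendsto ρ atTop atTop) (hσ : Tendsto σ atTop (𝓝 0))
    (hα : Tendsto α atTop (𝓝 0)) (hαρ : Tendsto (fun j => ρ j * α j) atTop (𝓝 0))
    {x : ℕ → E} {x' : E} {y' : G} (hx : ∀ j, x j ∈ X) (hxt : Tendsto x atTop (𝓝 x'))
    (hyt : Tendsto (fun j => ystar Y f c (ρ j) (σ j) (x j)) atTop (𝓝 y'))
    (hres : Tendsto (fun j => ‖residual X Y f c (ρ j) (σ j) (α j) (x j)‖) atTop (𝓝 0))
    (hcq : GPLCQ X Y c x' y') : IsKKT X Y f c x' y' := by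
  have hx' : x' ∈ X := H.X_compact.isClosed.mem_of_tendsto hxt (Eventually.of_forall hx)
  set y : ℕ → G := fun j => ystar Y f c (ρ j) (σ j) (x j) with hydef
  have hy : ∀ j, y j ∈ Y := fun j => H.ystar_mem (hx j) _ _
  have hy' : y' ∈ Y := H.Y_compact.isClosed.mem_of_tendsto hyt (Eventually.of_forall hy)
  set R : ℕ → E := fun j => residual X Y f c (ρ j) (σ j) (α j) (x j)
  have hR : Tendsto R atTop (𝓝 0) := tendsto_zero_iff_norm_tendsto_zero.2 hres
  set lam : ℕ → Fin p → ℝ := fun j i => ρ j * max (c i (x j) (y j)) 0 with hlamdef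
  have hlam0 : ∀ j i, 0 ≤ lam j i := fun j i => mul_nonneg (hρ0 j).le (le_max_right _ _)
  obtain ⟨δ, hδ, b, hb, γ, hγ, hq⟩ := hcq
  -- Multiplying the constraint qualification by `ρ` leaves `2ρα‖R‖ + b(‖R‖ + 2L + σL)`. The
  -- constant arises once `ρα`, `‖R‖` and `σ` are at most one; the outer factor 2 passes from
  -- `√penalty` to single components.
  have hbdd : ∀ᶠ j in atTop, lam j ∈ Icc (0 : Fin p → ℝ)
      (fun _ => 2 * (γ / b * (2 + b * (1 + 3 * L)))) := by
    filter_upwards [hxt.eventually (Metric.closedBall_mem_nhds x' hδ),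
      hyt.eventually (Metric.closedBall_mem_nhds y' hδ),
      hres.eventually_le_const one_pos, hσ.eventually_le_const one_pos,
      hαρ.eventually_le_const one_pos] with j h1 h2 h3 h4 h5
    have hbd := hq (x j) ⟨h1, hx j⟩ (y j) ⟨h2, hy j⟩
    have hpr := B.penalty_residual_le H (hρ0 j) (hσ0 j) (hα0 j) hb (hx j)
    have hρj := hρ0 j
    have hL := B.one_le
    have hmain : ρ j * √(penalty c (x j) (y j)) ≤ γ / b * (2 + b * (1 + 3 * L)) := by
      calc ρ j * √(penalty c (x j) (y j))
          ≤ ρ j * (γ / b * (2 * α j * ‖R j‖ + b / ρ j * (‖R j‖ + 2 * L + σ j * L))) :=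
            mul_le_mul_of_nonneg_left (hbd.trans (mul_le_mul_of_nonneg_left hpr (by positivity)))
              hρj.le
        _ = γ / b * (2 * (ρ j * α j) * ‖R j‖ + b * (‖R j‖ + 2 * L + σ j * L)) := by
            field_simp
        _ ≤ γ / b * (2 * 1 * 1 + b * (1 + 2 * L + 1 * L)) := by gcongr
        _ = _ := by ring
    refine ⟨fun i => hlam0 j i, fun i => ?_⟩
    have := mul_le_mul_of_nonneg_left (max_le_two_mul_sqrt_penalty c (x j) (y j) i) hρj.le
    simp only [hlamdef]
    linarith
  obtain ⟨mu, -, κ, hκ, hmu⟩ := isCompact_Icc.tendsto_subseq' hbdd.frequently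
  have hκt := hκ.tendsto_atTop
  have hmu_i : ∀ i, Tendsto (fun j => lam (κ j) i) atTop (𝓝 (mu i)) := tendsto_pi_nhds.1 hmu
  have hmu0 : ∀ i, 0 ≤ mu i := fun i => ge_of_tendsto' (hmu_i i) fun j => hlam0 _ i
  have hxκ : Tendsto (fun j => x (κ j)) atTop (𝓝 x') := hxt.comp hκt
  have hyκ : Tendsto (fun j => y (κ j)) atTop (𝓝 y') := hyt.comp hκt
  have hct : ∀ i, Tendsto (fun j => c i (x (κ j)) (y (κ j))) atTop (𝓝 (c i x' y')) := fun i =>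
    (H.c_smooth i).tendsto hx' hy' hxκ hyκ
  have hc0 : ∀ i, c i x' y' ≤ 0 := by
    intro i
    have h1 : Tendsto (fun j => max (c i (x (κ j)) (y (κ j))) 0) atTop (𝓝 (max (c i x' y') 0)) :=
      (hct i).max tendsto_const_nhds
    -- Bounded multipliers divided by `ρ → ∞` force the positive parts of the constraints to vanish
    -- in the limit.
    have h2 : Tendsto (fun j => lam (κ j) i / ρ (κ j)) atTop (𝓝 0) :=
      (hmu_i i).div_atTop (hρ.comp hκt)
    have h3 : (fun j => lam (κ j) i / ρ (κ j)) = fun j => max (c i (x (κ j)) (y (κ j))) 0 := by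
      ext j
      have := (hρ0 (κ j)).ne'
      simp only [hlamdef]
      field_simp
    rw [h3] at h2
    exact max_eq_right_iff.1 (tendsto_nhds_unique h1 h2)
  have hcomp : ∀ i, mu i * c i x' y' = 0 := by
    intro i
    refine le_antisymm (mul_nonpos_of_nonneg_of_nonpos (hmu0 i) (hc0 i)) ?_
    -- Before the limit each product is nonnegative, because the multiplier vanishes where the
    -- constraint is negative.
    refine ge_of_tendsto' ((hmu_i i).mul (hct i)) fun j => ?_
    rcases le_total (c i (x (κ j)) (y (κ j))) 0 with h | h
    · simp [hlamdef, max_eq_right h]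
    · exact mul_nonneg (hlam0 _ i) h
  choose K hK using fun i => (H.c_smooth i).exists_gradBounds H.X_compact H.Y_compact
  have hgf := B.f_bounds.tendsto_grad (fun j => hx (κ j)) (fun j => hy (κ j)) hx' hy' hxκ hyκ
  have hgc := fun i => (hK i).tendsto_grad (fun j => hx (κ j)) (fun j => hy (κ j)) hx' hy' hxκ hyκ
  refine ⟨mu, hmu0, ⟨_, ?_, (add_neg_cancel (gradX (lagrangian f c mu) x' y')).symm⟩,
    ⟨_, ?_, (neg_add_cancel (gradY (lagrangian f c mu) x' y')).symm⟩, hc0,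
    Finset.sum_eq_zero fun i _ => hcomp i⟩
  · rw [gradX_lagrangian H.f_smooth H.c_smooth hx' hy']
    have hz : Tendsto (fun j => x (κ j) - α (κ j) • R (κ j)) atTop (𝓝 x') := by
      simpa using hxκ.sub ((hα.comp hκt).smul (hR.comp hκt))
    have hv : Tendsto (fun j => R (κ j) - (gradX f (x (κ j)) (y (κ j)) -
        ∑ i, lam (κ j) i • gradX (c i) (x (κ j)) (y (κ j)))) atTop
        (𝓝 (0 - (gradX f x' y' - ∑ i, mu i • gradX (c i) x' y'))) :=
      (hR.comp hκt).sub (hgf.1.sub (tendsto_finsetSum _ fun i _ => (hmu_i i).smul (hgc i).1))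
    rw [zero_sub] at hv
    refine mem_normalCone_of_tendsto H.X_compact.isClosed hz hv fun j => ?_
    have := residual_sub_gradient_mem H (hα0 (κ j)) (ρ (κ j)) (σ (κ j)) (x (κ j))
    rw [(H.hasGradientAt_phi (hx _) (hρ0 _).le (hσ0 _)).gradient,
      H.gradX_psi_eq (hx _) (hy (κ j)), gradX_penalty H.c_smooth (hx _) (hy _),
      Finset.smul_sum] at this
    simp only [smul_smul] at this
    exact this
  · rw [gradY_lagrangian H.f_smooth H.c_smooth hx' hy']
    have hv : Tendsto (fun j => gradY f (x (κ j)) (y (κ j)) -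
        ∑ i, lam (κ j) i • gradY (c i) (x (κ j)) (y (κ j)) - σ (κ j) • y (κ j)) atTop
        (𝓝 (gradY f x' y' - ∑ i, mu i • gradY (c i) x' y' - (0 : ℝ) • y')) :=
      (hgf.2.sub (tendsto_finsetSum _ fun i _ => (hmu_i i).smul (hgc i).2)).sub
        ((hσ.comp hκt).smul hyκ)
    rw [zero_smul, sub_zero] at hv
    refine mem_normalCone_of_tendsto H.Y_compact.isClosed hyκ hv fun j => ?_
    have := H.gradY_psi_ystar_mem (hx (κ j)) (ρ (κ j)) (σ (κ j))
    rw [H.gradY_psi_eq (hx _) (hy (κ j)), gradY_penalty H.c_smooth (hx _) (hy _),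
      Finset.smul_sum] at this
    simp only [smul_smul] at this
    exact this

end KKT

end SPACO

namespace SPACO

set_option maxSynthPendingDepth 3
set_option linter.unusedSectionVars false

open Filter Topology Set MeasureTheory ProbabilityTheory

/-! ### Second moments under independent centred noise. -/

section Noise

variable {A Ξ Ω E : Type*} [MeasurableSpace A] [MeasurableSpace Ξ] [MeasurableSpace Ω]
  [NormedAddCommGroup E] [InnerProductSpace ℝ E] [CompleteSpace E] [MeasurableSpace E]
  [BorelSpace E] [SecondCountableTopology E]

theorem integrable_of_norm_sq {D : Measure Ξ} [IsFiniteMeasure D] {g : Ξ → E}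
    (hg : Measurable g) (h : Integrable (fun ξ => ‖g ξ‖ ^ 2) D) : Integrable g D :=
  ((memLp_two_iff_integrable_sq_norm hg.aestronglyMeasurable).2 h).integrable (by norm_num)

/-- Adding independent centred noise to a square integrable vector increases the second moment by
at most the conditional variance of the noise. -/
theorem integral_norm_add_noise_sq_le {P : Measure Ω} [IsProbabilityMeasure P] {D : Measure Ξ}
    [IsProbabilityMeasure D] {Z : Ω → A} {ξ : Ω → Ξ} (hZ : Measurable Z) (hξ : Measurable ξ)
    (hlaw : P.map ξ = D) (hind : IndepFun Z ξ P) {a : A → E} (ha : Measurable a)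
    {N : A × Ξ → E} (hN : Measurable N) (hN0 : ∀ z, ∫ w, N (z, w) ∂D = 0)
    (hNi : ∀ z, Integrable (fun w => ‖N (z, w)‖ ^ 2) D) {v : A → ℝ} (hv : Measurable v)
    (hNv : ∀ z, ∫ w, ‖N (z, w)‖ ^ 2 ∂D ≤ v z) {C : ℝ} (hvC : ∀ z, v z ≤ C)
    (haZ : Integrable (fun ω => ‖a (Z ω)‖ ^ 2) P) :
    Integrable (fun ω => ‖a (Z ω) + N (Z ω, ξ ω)‖ ^ 2) P ∧
      ∫ ω, ‖a (Z ω) + N (Z ω, ξ ω)‖ ^ 2 ∂P ≤ ∫ ω, ‖a (Z ω)‖ ^ 2 ∂P + ∫ ω, v (Z ω) ∂P := by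
  have hZξ : Measurable fun ω => (Z ω, ξ ω) := hZ.prodMk hξ
  set μ := P.map Z with hμ
  have : IsProbabilityMeasure μ := Measure.isProbabilityMeasure_map hZ.aemeasurable
  -- Independence makes the joint law a product, so conditional expectations become inner integrals
  -- in Fubini's theorem.
  have hprod : P.map (fun ω => (Z ω, ξ ω)) = μ.prod D := by
    rw [(indepFun_iff_map_prod_eq_prod_map_map hZ.aemeasurable hξ.aemeasurable).1 hind, hlaw]
  have hv0 : ∀ z, 0 ≤ v z := fun z => (integral_nonneg fun _ => sq_nonneg _).trans (hNv z)
  have hvμ : Integrable v μ := Integrable.of_bound hv.aestronglyMeasurable C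
    (Eventually.of_forall fun z => by rw [Real.norm_of_nonneg (hv0 z)]; exact hvC z)
  have haμ : Integrable (fun z => ‖a z‖ ^ 2) μ :=
    (integrable_map_measure (by fun_prop) hZ.aemeasurable).2 haZ
  have hN2 : Integrable (fun q => ‖N q‖ ^ 2) (μ.prod D) := by
    have hm : AEStronglyMeasurable (fun q => ‖N q‖ ^ 2) (μ.prod D) := by fun_prop
    refine (integrable_prod_iff hm).2 ⟨Eventually.of_forall hNi, ?_⟩
    refine hvμ.mono' hm.norm.integral_prod_right' (Eventually.of_forall fun z => ?_)
    rw [Real.norm_of_nonneg (integral_nonneg fun _ => norm_nonneg _)]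
    simpa using hNv z
  have ha2 : Integrable (fun q : A × Ξ => ‖a q.1‖ ^ 2) (μ.prod D) := haμ.comp_fst D
  have hin : Integrable (fun q : A × Ξ => inner ℝ (a q.1) (N q)) (μ.prod D) := by
    refine (ha2.add hN2).mono' (by fun_prop) (Eventually.of_forall fun q => ?_)
    refine (norm_inner_le_norm _ _).trans ?_
    simp only [Pi.add_apply]
    nlinarith [sq_nonneg (‖a q.1‖ - ‖N q‖), sq_nonneg ‖a q.1‖, sq_nonneg ‖N q‖]
  have hsum : (fun q : A × Ξ => ‖a q.1 + N q‖ ^ 2) =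
      fun q => ‖a q.1‖ ^ 2 + 2 * inner ℝ (a q.1) (N q) + ‖N q‖ ^ 2 := by
    ext q; exact norm_add_sq_real _ _
  have hint : Integrable (fun q : A × Ξ => ‖a q.1 + N q‖ ^ 2) (μ.prod D) := by
    rw [hsum]; exact (ha2.add (hin.const_mul 2)).add hN2
  -- The cross term vanishes: for a frozen state the noise has mean zero.
  have hin0 : ∫ q, inner ℝ (a q.1) (N q) ∂(μ.prod D) = 0 := by
    rw [integral_prod _ hin]
    refine integral_eq_zero_of_ae (Eventually.of_forall fun z => ?_)
    have hi : Integrable (fun w => N (z, w)) D :=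
      integrable_of_norm_sq (hN.comp measurable_prodMk_left) (hNi z)
    simp only [Pi.zero_apply]
    rw [integral_inner hi, hN0, inner_zero_right]
  constructor
  · rw [← hprod] at hint
    exact (integrable_map_measure hint.1 hZξ.aemeasurable).1 hint
  · have e1 : ∫ ω, ‖a (Z ω) + N (Z ω, ξ ω)‖ ^ 2 ∂P = ∫ q, ‖a q.1 + N q‖ ^ 2 ∂(μ.prod D) := by
      rw [← hprod] at hint ⊢
      exact (integral_map hZξ.aemeasurable hint.1).symm
    have e2 : ∫ ω, ‖a (Z ω)‖ ^ 2 ∂P = ∫ q : A × Ξ, ‖a q.1‖ ^ 2 ∂(μ.prod D) := by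
      rw [integral_fun_fst (fun z => ‖a z‖ ^ 2)]
      simp only [probReal_univ, one_smul]
      exact (integral_map hZ.aemeasurable haμ.1).symm
    have e3 : ∫ ω, v (Z ω) ∂P = ∫ z, v z ∂μ := (integral_map hZ.aemeasurable hvμ.1).symm
    have e4 : ∫ q, ‖a q.1 + N q‖ ^ 2 ∂(μ.prod D) = ∫ q : A × Ξ, ‖a q.1‖ ^ 2 ∂(μ.prod D) +
        2 * ∫ q, inner ℝ (a q.1) (N q) ∂(μ.prod D) + ∫ q, ‖N q‖ ^ 2 ∂(μ.prod D) := by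
      rw [hsum, ← integral_const_mul, ← integral_add ha2 (hin.const_mul 2)]
      exact integral_add (ha2.add (hin.const_mul 2)) hN2
    have e5 : ∫ q, ‖N q‖ ^ 2 ∂(μ.prod D) ≤ ∫ z, v z ∂μ := by
      rw [integral_prod _ hN2]
      exact integral_mono hN2.integral_prod_left hvμ hNv
    rw [e1, e2, e3, e4, hin0]
    linarith

end Noise

end SPACO

namespace SPACO

set_option maxSynthPendingDepth 3

open Filter Topology Set

/-! ### The deterministic Lyapunov argument. -/

section Recursion

/-- A sequence that eventually decreases by a fixed multiple of `1/k` is unbounded below. -/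
theorem exists_lt_of_le_sub_div {V : ℕ → ℝ} {m : ℝ} (hm : 0 < m)
    (h : ∀ᶠ k : ℕ in atTop, V (k + 1) ≤ V k - m / k) (b : ℝ) :
    ∃ᶠ k in atTop, V k < b := by
  rw [frequently_atTop]
  intro N
  obtain ⟨K, hK⟩ := eventually_atTop.1 h
  -- Adding one ensures `M ≥ 1`, hence `M + n ≤ M (n + 1)`: the decrements dominate `m/M` times the
  -- harmonic terms.
  set M := K + N + 1 with hM
  have hMpos : (0 : ℝ) < M := by positivity
  have hsum : ∀ n : ℕ, V (M + n) ≤ V M - m / M * ∑ i ∈ Finset.range n, 1 / ((i : ℝ) + 1) := by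
    intro n
    induction n with
    | zero => simp
    | succ n ih =>
      have h1 := hK (M + n) (by omega)
      rw [Finset.sum_range_succ, mul_add, ← add_assoc]
      have h2 : m / M * (1 / ((n : ℝ) + 1)) ≤ m / ((M + n : ℕ) : ℝ) := by
        rw [div_mul_div_comm, mul_one]
        have hM1 : (1 : ℝ) ≤ M := by rw [hM]; push_cast; linarith [K.cast_nonneg (α := ℝ), N.cast_nonneg (α := ℝ)]
        refine div_le_div_of_nonneg_left hm.le (by push_cast; positivity) ?_
        push_cast
        nlinarith [n.cast_nonneg (α := ℝ)]
      linarith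
  have ht := (Real.tendsto_sum_range_one_div_nat_succ_atTop.const_mul_atTop
    (div_pos hm hMpos)).eventually_gt_atTop (V M - b)
  obtain ⟨n, hn⟩ := ht.exists
  exact ⟨M + n, by omega, by linarith [hsum n]⟩

/-- The coupled recursions for the objective, the inner error and the gradient estimation error
force the weighted squared errors to be arbitrarily small infinitely often. -/
theorem frequently_lt_of_recursions {u v Φ D Er S : ℕ → ℝ} {c C b : ℝ} (hc : 0 < c) (hC : 0 < C)
    (hu1 : ∀ᶠ k in atTop, 1 ≤ u k) (hv1 : ∀ᶠ k in atTop, 1 ≤ v k)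
    (humono : ∀ᶠ k in atTop, u k ≤ u (k + 1)) (hu : Tendsto u atTop atTop)
    (huv : Tendsto (fun k => u k ^ 3 / v k) atTop (𝓝 0))
    (hu8 : Tendsto (fun k : ℕ => u k ^ 8 * v k / k) atTop (𝓝 0))
    (hD : ∀ k, 0 ≤ D k) (hE : ∀ k, 0 ≤ Er k) (hS : ∀ k, 0 ≤ S k) (hΦ : ∀ᶠ k in atTop, b ≤ Φ k)
    (hΦrec : ∀ᶠ k : ℕ in atTop, Φ (k + 1) ≤ Φ k - c * (u k ^ 6 * v k) * S k +
      C / (u k ^ 6 * v k) * (Er k + u k ^ 2 * D k + 1 / v k ^ 2) + C / (u k * k))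
    (hDrec : ∀ᶠ k : ℕ in atTop, D (k + 1) ≤ (1 - c / (u k ^ 2 * v k)) * D k +
      C * (1 / (u k * v k) ^ 2 + u k ^ 6 * v k * S k + u k ^ 6 * v k / k ^ 2))
    (hErec : ∀ᶠ k : ℕ in atTop, Er (k + 1) ≤ (1 - c / v k) * Er k + C * (1 / v k ^ 2 + S k))
    {ε : ℝ} (hε : 0 < ε) :
    ∃ᶠ k in atTop, (u k ^ 6 * v k) ^ 2 * S k + Er k + u k ^ 2 * D k < ε := by
  by_contra hcon
  rw [not_frequently] at hcon
  -- With these weights the contraction gains are exactly twice the errors `(C/q) u² D` and `(C/q)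
  -- Er` in the recursion for `Φ`; one copy pays for the errors, the other is left as decrease.
  set A := 2 * C / c with hA
  have hApos : 0 < A := by positivity
  set V : ℕ → ℝ := fun k => Φ k + A / u k ^ 2 * D k + A / u k ^ 6 * Er k with hVdef
  set m := min (c / 2) C with hm
  have hmpos : 0 < m := lt_min (by positivity) hC
  -- All noise contributions multiplied by `q = u⁶v` are dominated by `w`, which tends to zero.
  set w : ℕ → ℝ := fun k => (C + 2 * A * C) * (u k ^ 3 / v k) + C * (u k ^ 8 * v k / k) +
    A * C * (u k ^ 8 * v k / k) ^ 2 with hw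
  have hwt : Tendsto w atTop (𝓝 0) := by
    simpa using ((huv.const_mul (C + 2 * A * C)).add (hu8.const_mul C)).add
      ((hu8.pow 2).const_mul (A * C))
  have hwε := hwt.eventually_le_const (show (0 : ℝ) < m * ε / 2 by positivity)
  -- For `u` this large, the feedback of the step size `S` through the two error recursions costs at
  -- most half of the descent term.
  have hularge := hu.eventually_ge_atTop (2 * (2 * A) * C / c)
  have hk8 := hu8.eventually_le_const one_pos
  have hdec : ∀ᶠ k : ℕ in atTop, V (k + 1) ≤ V k - (m * ε / 2) / k := by
    filter_upwards [hcon, hwε, hularge, hk8, hu1, hv1, humono, hΦrec, hDrec, hErec,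
      eventually_ge_atTop 1] with k k1 k2 k3 k4 k5 k6 k7 k8 k9 k10 k11
    have hkpos : (0 : ℝ) < k := by exact_mod_cast k11
    have hup : 0 < u k := by linarith
    have hvp : 0 < v k := by linarith
    have hup' : 0 < u (k + 1) := by linarith
    have hDk := hD k
    have hEk := hE k
    have hSk := hS k
    -- The weights decrease as `u` increases, so those at `k + 1` may be replaced by those at `k`.
    have hV1 : V (k + 1) ≤ Φ (k + 1) + A / u k ^ 2 * D (k + 1) + A / u k ^ 6 * Er (k + 1) := by
      simp only [hVdef]
      have hD' := hD (k + 1)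
      have hE' := hE (k + 1)
      gcongr
    generalize hU : u k = U at *
    generalize hVv : v k = W at *
    generalize D (k + 1) = D' at *
    generalize Er (k + 1) = E' at *
    generalize Φ (k + 1) = Φ' at *
    have hVk : V k = Φ k + A / U ^ 2 * D k + A / U ^ 6 * Er k := by simp only [hVdef, hU]
    have hwk : w k = (C + 2 * A * C) * (U ^ 3 / W) + C * (U ^ 8 * W / k) +
      A * C * (U ^ 8 * W / k) ^ 2 := by simp only [hw, hU, hVv]
    rw [hVk]
    rw [hwk] at k2
    generalize D k = d at *
    generalize Er k = e at *
    generalize S k = x at *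
    generalize Φ k = φ at *
    set q := U ^ 6 * W with hq
    have hqpos : 0 < q := by positivity
    have step1 : A / U ^ 2 * D' ≤ A / U ^ 2 * ((1 - c / (U ^ 2 * W)) * d +
        C * (1 / (U * W) ^ 2 + q * x + q / k ^ 2)) :=
      mul_le_mul_of_nonneg_left k9 (by positivity)
    have step2 : A / U ^ 6 * E' ≤ A / U ^ 6 * ((1 - c / W) * e + C * (1 / W ^ 2 + x)) :=
      mul_le_mul_of_nonneg_left k10 (by positivity)
    have hcA : c = 2 * C / A := by rw [hA]; field_simp
    have e1 : A / U ^ 2 * ((1 - c / (U ^ 2 * W)) * d +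
        C * (1 / (U * W) ^ 2 + q * x + q / k ^ 2)) = A / U ^ 2 * d - 2 * (C / q * (U ^ 2 * d)) +
        (A * C * (U ^ 2 / W)) / q + A * C * (U ^ 4 * W) * x +
          (A * C * (U ^ 10 * W ^ 2 / k ^ 2)) / q := by
      rw [hcA, hq]; field_simp; ring
    have e2 : A / U ^ 6 * ((1 - c / W) * e + C * (1 / W ^ 2 + x)) =
        A / U ^ 6 * e - 2 * (C / q * e) + (A * C * (1 / W)) / q + A * C / U ^ 6 * x := by
      rw [hcA, hq]; field_simp; ring
    have e3 : C / q * (e + U ^ 2 * d + 1 / W ^ 2) =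
        C / q * e + C / q * (U ^ 2 * d) + (C * (1 / W ^ 2)) / q := by ring
    have e4 : C / (U * k) = (C * (U ^ 5 * W / k)) / q := by rw [hq]; field_simp
    have hW1 : 1 / W ≤ U ^ 3 / W := by gcongr; exact one_le_pow₀ k5
    have hU2 : U ^ 2 / W ≤ U ^ 3 / W := by gcongr; norm_num
    have hW2 : 1 / W ^ 2 ≤ U ^ 3 / W := by
      refine le_trans ?_ hW1
      exact one_div_le_one_div_of_le hvp (le_self_pow₀ k6 two_ne_zero)
    have hU5 : U ^ 5 * W / k ≤ U ^ 8 * W / k := by gcongr; norm_num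
    have hU10 : U ^ 10 * W ^ 2 / k ^ 2 ≤ (U ^ 8 * W / k) ^ 2 := by
      rw [div_pow, mul_pow, ← pow_mul]; gcongr; norm_num
    have hnoise : A * C * (U ^ 2 / W) / q + A * C * (U ^ 10 * W ^ 2 / k ^ 2) / q +
        A * C * (1 / W) / q + C * (1 / W ^ 2) / q + C * (U ^ 5 * W / k) / q ≤
          (m * ε / 2) / q := by
      rw [← add_div, ← add_div, ← add_div, ← add_div]
      refine div_le_div_of_nonneg_right (le_trans ?_ k2) hqpos.le
      have hAC : 0 < A * C := by positivity
      linarith [mul_le_mul_of_nonneg_left hU2 hAC.le, mul_le_mul_of_nonneg_left hU10 hAC.le,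
        mul_le_mul_of_nonneg_left hW1 hAC.le, mul_le_mul_of_nonneg_left hW2 hC.le,
        mul_le_mul_of_nonneg_left hU5 hC.le]
    have hX : A * C * (U ^ 4 * W) * x + A * C / U ^ 6 * x ≤ c / 2 * q * x := by
      rw [← add_mul]
      refine mul_le_mul_of_nonneg_right ?_ hSk
      have h1 : A * C / U ^ 6 ≤ A * C * (U ^ 4 * W) := by
        refine (div_le_self (by positivity) (one_le_pow₀ k5)).trans ?_
        exact le_mul_of_one_le_right (by positivity)
          (one_le_mul_of_one_le_of_one_le (one_le_pow₀ k5) k6)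
      have h2 : 2 * (2 * A) * C ≤ U ^ 2 * c := by
        rw [← div_le_iff₀ hc]
        exact k3.trans (le_self_pow₀ k5 two_ne_zero)
      have h3 := mul_le_mul_of_nonneg_left h2 (show 0 ≤ U ^ 4 * W by positivity)
      have h4 : U ^ 4 * W * (U ^ 2 * c) = q * c := by rw [hq]; ring
      linarith
    -- The assumed lower bound `ε` on the weighted errors, divided by `q`, converts the remaining
    -- gains into a fixed decrease.
    have hmain : (m * ε) / q ≤ c / 2 * q * x + C / q * e + C / q * (U ^ 2 * d) := by
      rw [div_le_iff₀ hqpos]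
      have h1 : (c / 2 * q * x + C / q * e + C / q * (U ^ 2 * d)) * q =
          c / 2 * (q ^ 2 * x) + C * e + C * (U ^ 2 * d) := by field_simp
      rw [h1]
      have hm1 : m ≤ c / 2 := min_le_left _ _
      have hm2 : m ≤ C := min_le_right _ _
      have hx0 : 0 ≤ q ^ 2 * x := by positivity
      have hd0 : 0 ≤ U ^ 2 * d := by positivity
      linarith [mul_le_mul_of_nonneg_left (not_lt.1 k1) hmpos.le,
        mul_le_mul_of_nonneg_right hm1 hx0, mul_le_mul_of_nonneg_right hm2 hEk,
        mul_le_mul_of_nonneg_right hm2 hd0]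
    -- Half of the decrease absorbs the noise; the other half is at least a multiple of `1/k`,
    -- because `q ≤ u⁸v ≤ k`.
    have hfin : (m * ε / 2) / k ≤ (m * ε) / q - (m * ε / 2) / q := by
      have hqk : q ≤ k := by
        have h1 : U ^ 8 * W ≤ k := by rwa [div_le_one hkpos] at k4
        refine le_trans ?_ h1
        rw [hq]
        gcongr
        norm_num
      have h2 : (m * ε / 2) / k ≤ (m * ε / 2) / q :=
        div_le_div_of_nonneg_left (by positivity) hqpos hqk
      have h3 : (m * ε) / q = (m * ε / 2) / q + (m * ε / 2) / q := by ring
      linarith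
    rw [e1] at step1
    rw [e2] at step2
    rw [e3, e4] at k8
    linarith
  have hbdd : ∀ᶠ k in atTop, b ≤ V k := by
    filter_upwards [hΦ] with k hk
    have h1 : 0 ≤ A / u k ^ 2 * D k := mul_nonneg (by positivity) (hD k)
    have h2 : 0 ≤ A / u k ^ 6 * Er k :=
      mul_nonneg (div_nonneg hApos.le (Even.pow_nonneg (by decide) _)) (hE k)
    simp only [hVdef]
    linarith
  obtain ⟨k, hk, hk'⟩ :=
    ((exists_lt_of_le_sub_div (by positivity) hdec b).and_eventually hbdd).exists
  exact absurd hk (not_lt.2 hk')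

end Recursion

end SPACO

namespace SPACO

set_option maxSynthPendingDepth 3
set_option linter.unusedSectionVars false

open Filter Topology Set MeasureTheory ProbabilityTheory

/-! ### Measurability of the oracle and moments of its noise. -/

section Measurability

variable {E G : Type*} [NormedAddCommGroup E] [InnerProductSpace ℝ E] [CompleteSpace E]
  [MeasurableSpace E] [BorelSpace E] [SecondCountableTopology E]
  [NormedAddCommGroup G] [InnerProductSpace ℝ G] [CompleteSpace G]
  [MeasurableSpace G] [BorelSpace G] [SecondCountableTopology G] {p : ℕ}
  {X : Set E} {Y : Set G} {f h : E → G → ℝ} {c : Fin p → E → G → ℝ} {L : ℝ}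
  {Ξ : Type*} [MeasurableSpace Ξ] {D : Measure Ξ} [IsProbabilityMeasure D] {F : Ξ → E → G → ℝ}

theorem continuous_of_lipschitz_bound {M : Type*} [NormedAddCommGroup M] {g : X × Y → M} {K : ℝ}
    (hg : ∀ q r : X × Y, ‖g q - g r‖ ≤ K * (‖(q.1 : E) - r.1‖ + ‖(q.2 : G) - r.2‖)) :
    Continuous g := by
  rw [continuous_iff_continuousAt]
  intro r
  rw [ContinuousAt, tendsto_iff_norm_sub_tendsto_zero]
  refine squeeze_zero (fun _ => norm_nonneg _) (fun q => hg q r) ?_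
  have : Continuous fun q : X × Y => K * (‖(q.1 : E) - r.1‖ + ‖(q.2 : G) - r.2‖) := by fun_prop
  simpa using this.tendsto r

theorem GradBounds.continuous_gradX (hb : GradBounds X Y h L) :
    Continuous fun q : X × Y => gradX h (q.1 : E) (q.2 : G) :=
  continuous_of_lipschitz_bound fun q r => hb.gradX_lip _ q.1.2 _ q.2.2 _ r.1.2 _ r.2.2

theorem GradBounds.continuous_gradY (hb : GradBounds X Y h L) :
    Continuous fun q : X × Y => gradY h (q.1 : E) (q.2 : G) :=
  continuous_of_lipschitz_bound fun q r => hb.gradY_lip _ q.1.2 _ q.2.2 _ r.1.2 _ r.2.2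

theorem ProblemBounds.continuous_ystar (B : ProblemBounds X Y f c L)
    (H : StandingAssumptions X Y f c) {ρ σ : ℝ} (hρ : 0 ≤ ρ) (hσ : 0 < σ) :
    Continuous fun x : X => ystar Y f c ρ σ (x : E) := by
  have hL := B.one_le
  refine (LipschitzWith.of_dist_le_mul (K := ((1 + ρ) * L / σ).toNNReal) fun x₁ x₂ => ?_).continuous
  have h := B.norm_ystar_sub_le H (ρ₂ := ρ) (σ₂ := σ) hρ hσ x₁.2 x₂.2
  simp only [sub_self, abs_zero, zero_mul, add_zero] at h
  rw [Real.coe_toNNReal _ (by positivity), dist_eq_norm, Subtype.dist_eq, dist_eq_norm]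
  exact h.trans (le_of_eq (by ring))

theorem StandingAssumptions.continuous_phi (H : StandingAssumptions X Y f c) {ρ σ : ℝ}
    (hρ : 0 ≤ ρ) (hσ : 0 < σ) : Continuous fun x : X => phi Y f c ρ σ (x : E) :=
  continuousOn_iff_continuous_domRestrict.1 fun _ hx =>
    (H.hasGradientAt_phi hx hρ hσ).differentiableAt.continuousAt.continuousWithinAt

theorem OracleAssumptions.measurable_gradX (O : OracleAssumptions X Y D F f) {x : E} {y : G}
    (hx : x ∈ X) (hy : y ∈ Y) : Measurable fun ξ => gradX (F ξ) x y :=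
  O.measurable_x.comp
    (f := fun ξ : Ξ => (ξ, (⟨x, hx⟩ : X), (⟨y, hy⟩ : Y))) (by fun_prop)

theorem OracleAssumptions.measurable_gradY (O : OracleAssumptions X Y D F f) {x : E} {y : G}
    (hx : x ∈ X) (hy : y ∈ Y) : Measurable fun ξ => gradY (F ξ) x y :=
  O.measurable_y.comp
    (f := fun ξ : Ξ => (ξ, (⟨x, hx⟩ : X), (⟨y, hy⟩ : Y))) (by fun_prop)

theorem OracleAssumptions.integral_noiseX (O : OracleAssumptions X Y D F f) {x : E} {y : G}
    (hx : x ∈ X) (hy : y ∈ Y) : Integrable (fun ξ => gradX (F ξ) x y - gradX f x y) D ∧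
      ∫ ξ, (gradX (F ξ) x y - gradX f x y) ∂D = 0 := by
  obtain ⟨δ, hδ, hv⟩ := O.variance
  have hi : Integrable (fun ξ => gradX (F ξ) x y - gradX f x y) D :=
    integrable_of_norm_sq ((O.measurable_gradX hx hy).sub_const _) (hv x hx y hy).1.1
  have hi' : Integrable (fun ξ => gradX (F ξ) x y) D := by
    refine (hi.add (integrable_const (gradX f x y))).congr (Eventually.of_forall fun ξ => ?_)
    simp
  refine ⟨hi, ?_⟩
  rw [integral_sub hi' (integrable_const _), O.unbiased_x x hx y hy]
  simp

theorem OracleAssumptions.integral_noiseY (O : OracleAssumptions X Y D F f) {x : E} {y : G}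
    (hx : x ∈ X) (hy : y ∈ Y) : Integrable (fun ξ => gradY (F ξ) x y - gradY f x y) D ∧
      ∫ ξ, (gradY (F ξ) x y - gradY f x y) ∂D = 0 := by
  obtain ⟨δ, hδ, hv⟩ := O.variance
  have hi : Integrable (fun ξ => gradY (F ξ) x y - gradY f x y) D :=
    integrable_of_norm_sq ((O.measurable_gradY hx hy).sub_const _) (hv x hx y hy).2.1
  have hi' : Integrable (fun ξ => gradY (F ξ) x y) D := by
    refine (hi.add (integrable_const (gradY f x y))).congr (Eventually.of_forall fun ξ => ?_)
    simp
  refine ⟨hi, ?_⟩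
  rw [integral_sub hi' (integrable_const _), O.unbiased_y x hx y hy]
  simp

/-- The oracle is measurable only on `Ξ × X × Y`, so the iterates are viewed as points of the
subtypes. The σ-algebra on `Ω` is left free, to be applied to each stage of the filtration. -/
theorem OracleAssumptions.measurable_gradX_psi (O : OracleAssumptions X Y D F f)
    (H : StandingAssumptions X Y f c) (B : ProblemBounds X Y f c L) {Ω : Type*}
    {m : MeasurableSpace Ω} {ξ : Ω → Ξ} {x' : Ω → E} {y' : Ω → G}
    (hξ : Measurable[m] ξ) (hx : Measurable[m] x') (hy : Measurable[m] y') (hxm : ∀ ω, x' ω ∈ X)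
    (hym : ∀ ω, y' ω ∈ Y) (ρ σ : ℝ) :
    Measurable[m] fun ω => gradX (psi (F (ξ ω)) c ρ σ) (x' ω) (y' ω) := by
  have e : (fun ω => gradX (psi (F (ξ ω)) c ρ σ) (x' ω) (y' ω)) =
      fun ω => gradX (F (ξ ω)) (x' ω) (y' ω) - ρ • gradX (penalty c) (x' ω) (y' ω) := by
    ext1 ω
    exact gradX_psi H.penalty_smooth (hxm ω) (hym ω)
      (O.differentiable_x _ _ (hxm ω) _ (hym ω)) ρ σ
  rw [e]
  have hq : Measurable[m] fun ω => ((⟨x' ω, hxm ω⟩ : X), (⟨y' ω, hym ω⟩ : Y)) :=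
    (hx.subtype_mk).prodMk hy.subtype_mk
  exact (O.measurable_x.comp (hξ.prodMk hq)).sub
    ((B.penalty_bounds.continuous_gradX.measurable.comp hq).const_smul ρ)

theorem OracleAssumptions.measurable_gradY_psi (O : OracleAssumptions X Y D F f)
    (H : StandingAssumptions X Y f c) (B : ProblemBounds X Y f c L) {Ω : Type*}
    {m : MeasurableSpace Ω} {ξ : Ω → Ξ} {x' : Ω → E} {y' : Ω → G}
    (hξ : Measurable[m] ξ) (hx : Measurable[m] x') (hy : Measurable[m] y') (hxm : ∀ ω, x' ω ∈ X)
    (hym : ∀ ω, y' ω ∈ Y) (ρ σ : ℝ) :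
    Measurable[m] fun ω => gradY (psi (F (ξ ω)) c ρ σ) (x' ω) (y' ω) := by
  have e : (fun ω => gradY (psi (F (ξ ω)) c ρ σ) (x' ω) (y' ω)) =
      fun ω => gradY (F (ξ ω)) (x' ω) (y' ω) - ρ • gradY (penalty c) (x' ω) (y' ω) - σ • y' ω := by
    ext1 ω
    exact gradY_psi H.penalty_smooth (hxm ω) (hym ω)
      (O.differentiable_y _ _ (hxm ω) _ (hym ω)) ρ σ
  rw [e]
  have hq : Measurable[m] fun ω => ((⟨x' ω, hxm ω⟩ : X), (⟨y' ω, hym ω⟩ : Y)) :=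
    (hx.subtype_mk).prodMk hy.subtype_mk
  exact ((O.measurable_y.comp (hξ.prodMk hq)).sub
    ((B.penalty_bounds.continuous_gradY.measurable.comp hq).const_smul ρ)).sub
      (hy.const_smul σ)

theorem measurable_proj_add_smul {C : Set E} (hC : IsCompact C) (hne : C.Nonempty)
    (hconv : Convex ℝ C) {Ω : Type*} {m : MeasurableSpace Ω} {a g : Ω → E} (ha : Measurable a)
    (hg : Measurable g) (b : ℝ) : Measurable fun ω => proj C (a ω + b • g ω) :=
  (continuous_proj hC hne hconv).measurable.comp (ha.add (hg.const_smul b))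

theorem measurable_smul_sub_add {Ω : Type*} {m : MeasurableSpace Ω} {a b d : Ω → E}
    (ha : Measurable a) (hb : Measurable b) (hd : Measurable d) (r : ℝ) :
    Measurable fun ω => r • (a ω - b ω) + d ω :=
  ((ha.sub hb).const_smul r).add hd

theorem norm_sub_sq_le_two_mul {M : Type*} [SeminormedAddCommGroup M] (a b : M) :
    ‖a - b‖ ^ 2 ≤ 2 * ‖a‖ ^ 2 + 2 * ‖b‖ ^ 2 := by
  have h := norm_sub_le a b
  nlinarith [norm_nonneg (a - b), sq_nonneg (‖a‖ - ‖b‖)]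

theorem norm_add_sq_le_two_mul {M : Type*} [SeminormedAddCommGroup M] (a b : M) :
    ‖a + b‖ ^ 2 ≤ 2 * ‖a‖ ^ 2 + 2 * ‖b‖ ^ 2 := by
  simpa using norm_sub_sq_le_two_mul a (-b)

/-- Second moment of the noise `n₂ - (1 - η) n₁` in the recursive gradient estimator, where `n₁` and
`n₂` are the noises at two points for the same sample. -/
theorem OracleAssumptions.recursive_noise_le (O : OracleAssumptions X Y D F f)
    (hb : GradBounds X Y f L) {δ LF : ℝ}
    (hv : ∀ x ∈ X, ∀ y ∈ Y, Integrable (fun ξ => ‖gradX (F ξ) x y - gradX f x y‖ ^ 2) D ∧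
      ∫ ξ, ‖gradX (F ξ) x y - gradX f x y‖ ^ 2 ∂D ≤ δ ^ 2)
    (hLF : ∀ x₁ ∈ X, ∀ y₁ ∈ Y, ∀ x₂ ∈ X, ∀ y₂ ∈ Y,
      ∫ ξ, ‖gradX (F ξ) x₁ y₁ - gradX (F ξ) x₂ y₂‖ ^ 2 ∂D ≤
        LF ^ 2 * (‖x₁ - x₂‖ ^ 2 + ‖y₁ - y₂‖ ^ 2)) (η : ℝ)
    {x₁ x₂ : E} {y₁ y₂ : G} (hx₁ : x₁ ∈ X) (hy₁ : y₁ ∈ Y) (hx₂ : x₂ ∈ X) (hy₂ : y₂ ∈ Y) :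
    Integrable (fun ξ => ‖(gradX (F ξ) x₂ y₂ - gradX f x₂ y₂) -
      (1 - η) • (gradX (F ξ) x₁ y₁ - gradX f x₁ y₁)‖ ^ 2) D ∧
    ∫ ξ, ‖(gradX (F ξ) x₂ y₂ - gradX f x₂ y₂) -
      (1 - η) • (gradX (F ξ) x₁ y₁ - gradX f x₁ y₁)‖ ^ 2 ∂D ≤
      (4 * LF ^ 2 + 8 * L ^ 2) * (‖x₂ - x₁‖ ^ 2 + ‖y₂ - y₁‖ ^ 2) + 2 * η ^ 2 * δ ^ 2 := by
  have m₁ := O.measurable_gradX hx₁ hy₁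
  have m₂ := O.measurable_gradX hx₂ hy₂
  obtain ⟨i₁, v₁⟩ := hv _ hx₁ _ hy₁
  obtain ⟨i₂, v₂⟩ := hv _ hx₂ _ hy₂
  have hint : Integrable (fun ξ => ‖(gradX (F ξ) x₂ y₂ - gradX f x₂ y₂) -
      (1 - η) • (gradX (F ξ) x₁ y₁ - gradX f x₁ y₁)‖ ^ 2) D := by
    refine ((i₂.const_mul 2).add (i₁.const_mul (2 * (1 - η) ^ 2))).mono' (by fun_prop)
      (Eventually.of_forall fun ξ => ?_)
    rw [Real.norm_of_nonneg (sq_nonneg _)]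
    refine (norm_sub_sq_le_two_mul _ _).trans (le_of_eq ?_)
    rw [norm_smul, mul_pow, Real.norm_eq_abs, sq_abs]
    simp only [Pi.add_apply]
    ring
  refine ⟨hint, ?_⟩
  set q := ‖x₂ - x₁‖ ^ 2 + ‖y₂ - y₁‖ ^ 2 with hq
  have hgf : ‖gradX f x₂ y₂ - gradX f x₁ y₁‖ ^ 2 ≤ 2 * L ^ 2 * q := by
    have h := hb.gradX_lip _ hx₂ _ hy₂ _ hx₁ _ hy₁
    have h2 := pow_le_pow_left₀ (norm_nonneg _) h 2
    refine h2.trans ?_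
    rw [mul_pow, hq]
    nlinarith [mul_nonneg (sq_nonneg L) (sq_nonneg (‖x₂ - x₁‖ - ‖y₂ - y₁‖))]
  -- Integrability of the gradient difference is recovered from the two finite variances.
  have hGi : Integrable (fun ξ => ‖gradX (F ξ) x₂ y₂ - gradX (F ξ) x₁ y₁‖ ^ 2) D := by
    refine (((i₂.const_mul 4).add (i₁.const_mul 4)).add
      (integrable_const (2 * ‖gradX f x₂ y₂ - gradX f x₁ y₁‖ ^ 2))).mono' (by fun_prop)
      (Eventually.of_forall fun ξ => ?_)
    rw [Real.norm_of_nonneg (sq_nonneg _)]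
    have e : gradX (F ξ) x₂ y₂ - gradX (F ξ) x₁ y₁ =
        ((gradX (F ξ) x₂ y₂ - gradX f x₂ y₂) - (gradX (F ξ) x₁ y₁ - gradX f x₁ y₁)) +
          (gradX f x₂ y₂ - gradX f x₁ y₁) := by abel
    rw [e]
    have h1 := norm_add_sq_le_two_mul ((gradX (F ξ) x₂ y₂ - gradX f x₂ y₂) -
      (gradX (F ξ) x₁ y₁ - gradX f x₁ y₁)) (gradX f x₂ y₂ - gradX f x₁ y₁)
    have h2 := norm_sub_sq_le_two_mul (gradX (F ξ) x₂ y₂ - gradX f x₂ y₂)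
      (gradX (F ξ) x₁ y₁ - gradX f x₁ y₁)
    simp only [Pi.add_apply]
    linarith
  have hle : ∀ ξ, ‖(gradX (F ξ) x₂ y₂ - gradX f x₂ y₂) -
      (1 - η) • (gradX (F ξ) x₁ y₁ - gradX f x₁ y₁)‖ ^ 2 ≤
      4 * ‖gradX (F ξ) x₂ y₂ - gradX (F ξ) x₁ y₁‖ ^ 2 + 8 * L ^ 2 * q +
        2 * η ^ 2 * ‖gradX (F ξ) x₁ y₁ - gradX f x₁ y₁‖ ^ 2 := by
    intro ξ
    -- Regrouping as increment noise plus `η` times the noise at the old point: the first part is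
    -- small with the move, the second with `η`.
    have e : (gradX (F ξ) x₂ y₂ - gradX f x₂ y₂) -
        (1 - η) • (gradX (F ξ) x₁ y₁ - gradX f x₁ y₁) =
        ((gradX (F ξ) x₂ y₂ - gradX (F ξ) x₁ y₁) - (gradX f x₂ y₂ - gradX f x₁ y₁)) +
          η • (gradX (F ξ) x₁ y₁ - gradX f x₁ y₁) := by module
    rw [e]
    have h1 := norm_add_sq_le_two_mul ((gradX (F ξ) x₂ y₂ - gradX (F ξ) x₁ y₁) -
      (gradX f x₂ y₂ - gradX f x₁ y₁)) (η • (gradX (F ξ) x₁ y₁ - gradX f x₁ y₁))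
    have h2 := norm_sub_sq_le_two_mul (gradX (F ξ) x₂ y₂ - gradX (F ξ) x₁ y₁)
      (gradX f x₂ y₂ - gradX f x₁ y₁)
    rw [norm_smul, mul_pow, Real.norm_eq_abs, sq_abs] at h1
    linarith
  have hi1 := (hGi.const_mul 4).add (integrable_const (μ := D) (8 * L ^ 2 * q))
  have hi2 := i₁.const_mul (2 * η ^ 2)
  refine (integral_mono hint (hi1.add hi2) hle).trans ?_
  simp only [Pi.add_apply]
  have e1 : ∫ ξ, (4 * ‖gradX (F ξ) x₂ y₂ - gradX (F ξ) x₁ y₁‖ ^ 2 + 8 * L ^ 2 * q +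
      2 * η ^ 2 * ‖gradX (F ξ) x₁ y₁ - gradX f x₁ y₁‖ ^ 2) ∂D =
      4 * ∫ ξ, ‖gradX (F ξ) x₂ y₂ - gradX (F ξ) x₁ y₁‖ ^ 2 ∂D + 8 * L ^ 2 * q +
        2 * η ^ 2 * ∫ ξ, ‖gradX (F ξ) x₁ y₁ - gradX f x₁ y₁‖ ^ 2 ∂D := by
    rw [← integral_const_mul, ← integral_const_mul]
    refine (integral_add hi1 hi2).trans ?_
    congr 1
    refine (integral_add (hGi.const_mul 4) (integrable_const _)).trans ?_
    simp
  rw [e1]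
  have h3 := hLF _ hx₂ _ hy₂ _ hx₁ _ hy₁
  nlinarith [mul_le_mul_of_nonneg_left v₁ (sq_nonneg η)]

variable {Ω : Type*} {ξy ξx : ℕ → Ω → Ξ} {ρ σ α β η : ℕ → ℝ} {x₀ : E} {y₀ : G} {x : ℕ → Ω → E}
  {y : ℕ → Ω → G} {dx : ℕ → Ω → E}

theorem IsSPACO.x_mem (r : IsSPACO X Y F c ρ σ α β η ξy ξx x₀ y₀ x y dx)
    (H : StandingAssumptions X Y f c) (k : ℕ) (ω : Ω) : x k ω ∈ X := by
  cases k with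
  | zero => rw [r.x_zero]; exact r.x₀_mem
  | succ k => rw [r.x_succ]; exact proj_mem H.X_compact H.X_nonempty _

theorem IsSPACO.y_mem (r : IsSPACO X Y F c ρ σ α β η ξy ξx x₀ y₀ x y dx)
    (H : StandingAssumptions X Y f c) (k : ℕ) (ω : Ω) : y k ω ∈ Y := by
  cases k with
  | zero => rw [r.y_zero]; exact r.y₀_mem
  | succ k => rw [r.y_succ]; exact proj_mem H.Y_compact H.Y_nonempty _

theorem IsSPACO.measurable_y_succ
    (r : IsSPACO X Y F c ρ σ α β η ξy ξx x₀ y₀ x y dx)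
    (H : StandingAssumptions X Y f c) (B : ProblemBounds X Y f c L)
    (O : OracleAssumptions X Y D F f) {m : MeasurableSpace Ω} {k : ℕ} (hξ : Measurable[m] (ξy k))
    (hx : Measurable[m] (x k)) (hy : Measurable[m] (y k)) : Measurable[m] (y (k + 1)) := by
  rw [show y (k + 1) = _ from funext (r.y_succ k)]
  exact measurable_proj_add_smul H.Y_compact H.Y_nonempty H.Y_convex hy
    (O.measurable_gradY_psi H B hξ hx hy (r.x_mem H k) (r.y_mem H k) _ _) _

theorem IsSPACO.measurable_x_succ
    (r : IsSPACO X Y F c ρ σ α β η ξy ξx x₀ y₀ x y dx)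
    (H : StandingAssumptions X Y f c) {m : MeasurableSpace Ω} {k : ℕ} (hx : Measurable[m] (x k))
    (hd : Measurable[m] (dx k)) : Measurable[m] (x (k + 1)) := by
  have e : x (k + 1) = fun ω => proj X (x k ω + (-α k) • dx k ω) := by
    ext1 ω; rw [r.x_succ, neg_smul, sub_eq_add_neg]
  rw [e]
  exact measurable_proj_add_smul H.X_compact H.X_nonempty H.X_convex hx hd _

end Measurability

/-! ### The sampling filtration and adaptedness of the iterates. -/

section Filtration

variable {Ω Ξ : Type*} [MeasurableSpace Ξ]

theorem past_le_pastHalf (ξy ξx : ℕ → Ω → Ξ) (k : ℕ) : past ξy ξx k ≤ pastHalf ξy ξx k :=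
  le_sup_left

theorem measurable_ξy_pastHalf (ξy ξx : ℕ → Ω → Ξ) (k : ℕ) :
    Measurable[pastHalf ξy ξx k] (ξy k) :=
  measurable_iff_comap_le.2 le_sup_right

theorem pastHalf_le_past_succ (ξy ξx : ℕ → Ω → Ξ) (k : ℕ) :
    pastHalf ξy ξx k ≤ past ξy ξx (k + 1) := by
  refine sup_le ?_ ?_
  · exact iSup_mono fun j => iSup_mono' fun hj => ⟨hj.trans k.lt_succ_self, le_rfl⟩
  · exact le_iSup₂_of_le k k.lt_succ_self le_sup_left

theorem measurable_ξx_past_succ (ξy ξx : ℕ → Ω → Ξ) (k : ℕ) :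
    Measurable[past ξy ξx (k + 1)] (ξx k) :=
  measurable_iff_comap_le.2 (le_iSup₂_of_le k k.lt_succ_self le_sup_right)

end Filtration

section Run

variable {E G : Type*} [NormedAddCommGroup E] [InnerProductSpace ℝ E] [CompleteSpace E]
  [MeasurableSpace E] [BorelSpace E] [SecondCountableTopology E]
  [NormedAddCommGroup G] [InnerProductSpace ℝ G] [CompleteSpace G]
  [MeasurableSpace G] [BorelSpace G] [SecondCountableTopology G] {p : ℕ}
  {X : Set E} {Y : Set G} {f : E → G → ℝ} {c : Fin p → E → G → ℝ} {L : ℝ}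
  {Ξ Ω : Type*} [MeasurableSpace Ξ] {D : Measure Ξ} [IsProbabilityMeasure D] {F : Ξ → E → G → ℝ}
  [MeasurableSpace Ω] {P : Measure Ω} [IsProbabilityMeasure P] {ξy ξx : ℕ → Ω → Ξ}
  {ρ σ α β η : ℕ → ℝ} {x₀ : E} {y₀ : G} {x : ℕ → Ω → E} {y : ℕ → Ω → G} {dx : ℕ → Ω → E}

/-- A run of the algorithm together with all standing assumptions and a bound `L` for the data. -/
structure RunSetting (X : Set E) (Y : Set G) (f : E → G → ℝ) (c : Fin p → E → G → ℝ) (L : ℝ)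
    (D : Measure Ξ) (F : Ξ → E → G → ℝ) (P : Measure Ω) (ξy ξx : ℕ → Ω → Ξ)
    (ρ σ α β η : ℕ → ℝ) (x₀ : E) (y₀ : G) (x : ℕ → Ω → E) (y : ℕ → Ω → G) (dx : ℕ → Ω → E) :
    Prop where
  std : StandingAssumptions X Y f c
  bounds : ProblemBounds X Y f c L
  oracle : OracleAssumptions X Y D F f
  sampling : IsSampling P D ξy ξx
  run : IsSPACO X Y F c ρ σ α β η ξy ξx x₀ y₀ x y dx
  ρ_pos : ∀ k, 0 < ρ k
  σ_pos : ∀ k, 0 < σ k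
  α_pos : ∀ k, 0 < α k
  β_pos : ∀ k, 0 < β k

/-- The error `d_x^k - ∇ₓψ_k(x^k, y^{k+1})` of the search direction. -/
noncomputable def dirError (f : E → G → ℝ) (c : Fin p → E → G → ℝ) (ρ σ : ℕ → ℝ) (x : ℕ → Ω → E)
    (y : ℕ → Ω → G) (dx : ℕ → Ω → E) (k : ℕ) (ω : Ω) : E :=
  dx k ω - gradX (psi f c (ρ k) (σ k)) (x k ω) (y (k + 1) ω)

namespace RunSetting

theorem x_mem
    (R : RunSetting X Y f c L D F P ξy ξx ρ σ α β η x₀ y₀ x y dx) (k : ℕ) (ω : Ω) : x k ω ∈ X :=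
  R.run.x_mem R.std k ω

theorem y_mem
    (R : RunSetting X Y f c L D F P ξy ξx ρ σ α β η x₀ y₀ x y dx) (k : ℕ) (ω : Ω) : y k ω ∈ Y :=
  R.run.y_mem R.std k ω

theorem y_succ_eq
    (R : RunSetting X Y f c L D F P ξy ξx ρ σ α β η x₀ y₀ x y dx) (k : ℕ) (ω : Ω) : y (k + 1) ω =
    proj Y (y k ω + β k • gradY (psi f c (ρ k) (σ k)) (x k ω) (y k ω) +
      β k • (gradY (F (ξy k ω)) (x k ω) (y k ω) - gradY f (x k ω) (y k ω))) := by
  have hx := R.x_mem k ω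
  have hy := R.y_mem k ω
  rw [R.run.y_succ, R.std.gradY_psi_eq hx hy,
    gradY_psi R.std.penalty_smooth hx hy (R.oracle.differentiable_y _ _ hx _ hy)]
  congr 1
  module

theorem dirError_zero
    (R : RunSetting X Y f c L D F P ξy ξx ρ σ α β η x₀ y₀ x y dx) (ω : Ω) : dirError f c ρ σ x y dx 0 ω =
    gradX (F (ξx 0 ω)) (x 0 ω) (y 1 ω) - gradX f (x 0 ω) (y 1 ω) := by
  have hx := R.x_mem 0 ω
  have hy := R.y_mem 1 ω
  rw [dirError, R.run.dx_zero, R.std.gradX_psi_eq hx hy,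
    gradX_psi R.std.penalty_smooth hx hy (R.oracle.differentiable_x _ _ hx _ hy)]
  module

/-- Penalty and regularization are deterministic and enter the estimator exactly, so they cancel and
the growing `ρ` does not amplify the noise. The remaining innovation is centred given the earlier
data. -/
theorem dirError_succ
    (R : RunSetting X Y f c L D F P ξy ξx ρ σ α β η x₀ y₀ x y dx) (k : ℕ) (ω : Ω) : dirError f c ρ σ x y dx (k + 1) ω =
    (1 - η (k + 1)) • dirError f c ρ σ x y dx k ω +
      ((gradX (F (ξx (k + 1) ω)) (x (k + 1) ω) (y (k + 2) ω) -
          gradX f (x (k + 1) ω) (y (k + 2) ω)) -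
        (1 - η (k + 1)) • (gradX (F (ξx (k + 1) ω)) (x k ω) (y (k + 1) ω) -
          gradX f (x k ω) (y (k + 1) ω))) := by
  have hx := R.x_mem k ω
  have hy := R.y_mem (k + 1) ω
  have hx' := R.x_mem (k + 1) ω
  have hy' := R.y_mem (k + 2) ω
  rw [dirError, dirError, R.run.dx_succ, R.std.gradX_psi_eq hx hy, R.std.gradX_psi_eq hx' hy',
    gradX_psi R.std.penalty_smooth hx hy (R.oracle.differentiable_x _ _ hx _ hy),
    gradX_psi R.std.penalty_smooth hx' hy' (R.oracle.differentiable_x _ _ hx' _ hy')]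
  module

theorem past_le
    (R : RunSetting X Y f c L D F P ξy ξx ρ σ α β η x₀ y₀ x y dx) (k : ℕ) : past ξy ξx k ≤ ‹MeasurableSpace Ω› :=
  iSup₂_le fun j _ => sup_le (R.sampling.measurable_y j).comap_le (R.sampling.measurable_x j).comap_le

theorem pastHalf_le
    (R : RunSetting X Y f c L D F P ξy ξx ρ σ α β η x₀ y₀ x y dx) (k : ℕ) : pastHalf ξy ξx k ≤ ‹MeasurableSpace Ω› :=
  (pastHalf_le_past_succ ξy ξx k).trans (R.past_le (k + 1))

/-- The direction `dx k` uses the sample `ξx k`, which is why it is known only at stage `k + 1`. -/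
theorem adapted
    (R : RunSetting X Y f c L D F P ξy ξx ρ σ α β η x₀ y₀ x y dx) (k : ℕ) : Measurable[past ξy ξx k] (x k) ∧ Measurable[past ξy ξx k] (y k) ∧
    Measurable[past ξy ξx (k + 1)] (dx k) := by
  have hmono : ∀ k, past ξy ξx k ≤ past ξy ξx (k + 1) := fun k =>
    (past_le_pastHalf ξy ξx k).trans (pastHalf_le_past_succ ξy ξx k)
  have hyk : ∀ k, Measurable[past ξy ξx k] (x k) → Measurable[past ξy ξx k] (y k) →
      Measurable[past ξy ξx (k + 1)] (y (k + 1)) := fun k hx hy =>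
    R.run.measurable_y_succ R.std R.bounds R.oracle ((measurable_ξy_pastHalf ξy ξx k).mono (pastHalf_le_past_succ ξy ξx k) le_rfl)
      (hx.mono (hmono k) le_rfl) (hy.mono (hmono k) le_rfl)
  induction k with
  | zero =>
    have hx : Measurable[past ξy ξx 0] (x 0) := by
      rw [show x 0 = fun _ => x₀ from funext R.run.x_zero]; exact measurable_const
    have hy : Measurable[past ξy ξx 0] (y 0) := by
      rw [show y 0 = fun _ => y₀ from funext R.run.y_zero]; exact measurable_const
    refine ⟨hx, hy, ?_⟩
    rw [show dx 0 = _ from funext R.run.dx_zero]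
    exact R.oracle.measurable_gradX_psi R.std R.bounds (measurable_ξx_past_succ ξy ξx 0) (hx.mono (hmono 0) le_rfl)
      (hyk 0 hx hy) (R.x_mem 0) (R.y_mem 1) _ _
  | succ k ih =>
    obtain ⟨hx, hy, hd⟩ := ih
    have hx' := R.run.measurable_x_succ R.std (hx.mono (hmono k) le_rfl) hd
    have hy' := hyk k hx hy
    refine ⟨hx', hy', ?_⟩
    rw [show dx (k + 1) = _ from funext (R.run.dx_succ k)]
    have hξ := measurable_ξx_past_succ ξy ξx (k + 1)
    have h2 := (hmono k).trans (hmono (k + 1))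
    exact measurable_smul_sub_add (hd.mono (hmono _) le_rfl)
      (R.oracle.measurable_gradX_psi R.std R.bounds hξ (hx.mono h2 le_rfl)
        (hy'.mono (hmono _) le_rfl) (R.x_mem k) (R.y_mem _) _ _)
      (R.oracle.measurable_gradX_psi R.std R.bounds hξ (hx'.mono (hmono _) le_rfl) (hyk _ hx' hy') (R.x_mem _)
        (R.y_mem _) _ _) _

theorem measurable_y_succ_pastHalf
    (R : RunSetting X Y f c L D F P ξy ξx ρ σ α β η x₀ y₀ x y dx) (k : ℕ) : Measurable[pastHalf ξy ξx k] (y (k + 1)) :=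
  R.run.measurable_y_succ R.std R.bounds R.oracle (measurable_ξy_pastHalf ξy ξx k)
    ((R.adapted k).1.mono (past_le_pastHalf ξy ξx k) le_rfl)
    ((R.adapted k).2.1.mono (past_le_pastHalf ξy ξx k) le_rfl)

theorem measurable_x
    (R : RunSetting X Y f c L D F P ξy ξx ρ σ α β η x₀ y₀ x y dx) (k : ℕ) : Measurable (x k) := (R.adapted k).1.mono (R.past_le k) le_rfl

theorem measurable_y
    (R : RunSetting X Y f c L D F P ξy ξx ρ σ α β η x₀ y₀ x y dx) (k : ℕ) : Measurable (y k) := (R.adapted k).2.1.mono (R.past_le k) le_rfl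

end RunSetting

end Run

end SPACO

namespace SPACO

set_option maxSynthPendingDepth 3
set_option linter.unusedSectionVars false

open Filter Topology Set MeasureTheory ProbabilityTheory

/-! ### One-step moment estimates along a run. -/

section Run

variable {E G : Type*} [NormedAddCommGroup E] [InnerProductSpace ℝ E] [CompleteSpace E]
  [MeasurableSpace E] [BorelSpace E] [SecondCountableTopology E]
  [NormedAddCommGroup G] [InnerProductSpace ℝ G] [CompleteSpace G]
  [MeasurableSpace G] [BorelSpace G] [SecondCountableTopology G] {p : ℕ}
  {X : Set E} {Y : Set G} {f : E → G → ℝ} {c : Fin p → E → G → ℝ} {L : ℝ}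
  {Ξ Ω : Type*} [MeasurableSpace Ξ] {D : Measure Ξ} [IsProbabilityMeasure D] {F : Ξ → E → G → ℝ}
  [MeasurableSpace Ω] {P : Measure Ω} [IsProbabilityMeasure P] {ξy ξx : ℕ → Ω → Ξ}
  {ρ σ α β η : ℕ → ℝ} {x₀ : E} {y₀ : G} {x : ℕ → Ω → E} {y : ℕ → Ω → G} {dx : ℕ → Ω → E}

theorem ProblemBounds.continuous_gradX_psi (B : ProblemBounds X Y f c L)
    (H : StandingAssumptions X Y f c) (ρ σ : ℝ) :
    Continuous fun q : X × Y => gradX (psi f c ρ σ) (q.1 : E) (q.2 : G) := by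
  simp_rw [fun q : X × Y => H.gradX_psi_eq q.1.2 q.2.2 ρ σ]
  exact B.f_bounds.continuous_gradX.sub (B.penalty_bounds.continuous_gradX.const_smul ρ)

theorem ProblemBounds.continuous_gradY_psi (B : ProblemBounds X Y f c L)
    (H : StandingAssumptions X Y f c) (ρ σ : ℝ) :
    Continuous fun q : X × Y => gradY (psi f c ρ σ) (q.1 : E) (q.2 : G) := by
  simp_rw [fun q : X × Y => H.gradY_psi_eq q.1.2 q.2.2 ρ σ]
  have h1 := B.f_bounds.continuous_gradY
  have h2 := B.penalty_bounds.continuous_gradY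
  fun_prop

theorem integrable_norm_sq_of_le {M : Type*} [NormedAddCommGroup M] [MeasurableSpace M]
    [OpensMeasurableSpace M] {g : Ω → M} (hg : Measurable g) {K : ℝ} (hK : ∀ ω, ‖g ω‖ ≤ K) :
    Integrable (fun ω => ‖g ω‖ ^ 2) P :=
  Integrable.of_bound (hg.norm.pow_const 2).aestronglyMeasurable (K ^ 2)
    (Eventually.of_forall fun ω => by
      rw [Real.norm_of_nonneg (sq_nonneg _)]
      exact pow_le_pow_left₀ (norm_nonneg _) (hK ω) 2)

/-- The exact solution `y*_k(x^k)` of the inner problem. -/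
noncomputable def innerSol (Y : Set G) (f : E → G → ℝ) (c : Fin p → E → G → ℝ) (ρ σ : ℕ → ℝ)
    (x : ℕ → Ω → E) (k : ℕ) (ω : Ω) : G :=
  ystar Y f c (ρ k) (σ k) (x k ω)

theorem measurable_dirError {Ω : Type*} {m : MeasurableSpace Ω} {x : ℕ → Ω → E} {y : ℕ → Ω → G}
    {dx : ℕ → Ω → E} (H : StandingAssumptions X Y f c) (B : ProblemBounds X Y f c L) {k : ℕ}
    (hx : Measurable (x k)) (hy : Measurable (y (k + 1))) (hd : Measurable (dx k))
    (hxm : ∀ ω, x k ω ∈ X) (hym : ∀ ω, y (k + 1) ω ∈ Y) :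
    Measurable (dirError f c ρ σ x y dx k) :=
  hd.sub ((B.continuous_gradX_psi H (ρ k) (σ k)).measurable.comp
    ((hx.subtype_mk (h := hxm)).prodMk (hy.subtype_mk (h := hym))))

theorem measurable_pairs {Ω : Type*} {m : MeasurableSpace Ω} {x₁ x₂ e : Ω → E} {y₁ y₂ : Ω → G}
    (hx₁ : Measurable x₁) (hx₂ : Measurable x₂) (he : Measurable e) (hy₁ : Measurable y₁)
    (hy₂ : Measurable y₂) (mx₁ : ∀ ω, x₁ ω ∈ X) (mx₂ : ∀ ω, x₂ ω ∈ X) (my₁ : ∀ ω, y₁ ω ∈ Y)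
    (my₂ : ∀ ω, y₂ ω ∈ Y) :
    Measurable fun ω => ((((⟨x₁ ω, mx₁ ω⟩ : X), (⟨y₁ ω, my₁ ω⟩ : Y)),
      ((⟨x₂ ω, mx₂ ω⟩ : X), (⟨y₂ ω, my₂ ω⟩ : Y))), e ω) :=
  ((hx₁.subtype_mk.prodMk hy₁.subtype_mk).prodMk (hx₂.subtype_mk.prodMk hy₂.subtype_mk)).prodMk he

theorem measurable_pair {Ω : Type*} {m : MeasurableSpace Ω} {x : Ω → E} {y : Ω → G}
    (hx : Measurable x) (hy : Measurable y) (mx : ∀ ω, x ω ∈ X) (my : ∀ ω, y ω ∈ Y) :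
    Measurable fun ω => ((⟨x ω, mx ω⟩ : X), (⟨y ω, my ω⟩ : Y)) :=
  hx.subtype_mk.prodMk hy.subtype_mk

namespace RunSetting

theorem innerSol_mem (R : RunSetting X Y f c L D F P ξy ξx ρ σ α β η x₀ y₀ x y dx) (k : ℕ)
    (ω : Ω) : innerSol Y f c ρ σ x k ω ∈ Y :=
  R.std.ystar_mem (R.x_mem k ω) _ _

theorem measurable_innerSol (R : RunSetting X Y f c L D F P ξy ξx ρ σ α β η x₀ y₀ x y dx) (k : ℕ) :
    Measurable (innerSol Y f c ρ σ x k) :=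
  (R.bounds.continuous_ystar R.std (R.ρ_pos k).le (R.σ_pos k)).measurable.comp
    ((R.measurable_x k).subtype_mk (h := R.x_mem k))

theorem integrable_sq_y_sub (R : RunSetting X Y f c L D F P ξy ξx ρ σ α β η x₀ y₀ x y dx)
    {g h : Ω → G} (hg : Measurable g) (hh : Measurable h) (mg : ∀ ω, g ω ∈ Y)
    (mh : ∀ ω, h ω ∈ Y) : Integrable (fun ω => ‖g ω - h ω‖ ^ 2) P :=
  integrable_norm_sq_of_le (hg.sub hh) (K := L + L) fun ω => (norm_sub_le _ _).trans
    (add_le_add (R.bounds.norm_y_le _ (mg ω)) (R.bounds.norm_y_le _ (mh ω)))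

theorem integrable_sq_dist_inner (R : RunSetting X Y f c L D F P ξy ξx ρ σ α β η x₀ y₀ x y dx)
    (j k : ℕ) : Integrable (fun ω => ‖y j ω - innerSol Y f c ρ σ x k ω‖ ^ 2) P :=
  R.integrable_sq_y_sub (R.measurable_y j) (R.measurable_innerSol k) (R.y_mem j) (R.innerSol_mem k)

theorem integrable_sq_y_step (R : RunSetting X Y f c L D F P ξy ξx ρ σ α β η x₀ y₀ x y dx)
    (j k : ℕ) : Integrable (fun ω => ‖y j ω - y k ω‖ ^ 2) P :=
  R.integrable_sq_y_sub (R.measurable_y j) (R.measurable_y k) (R.y_mem j) (R.y_mem k)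

theorem integrable_sq_x_step (R : RunSetting X Y f c L D F P ξy ξx ρ σ α β η x₀ y₀ x y dx)
    (j k : ℕ) : Integrable (fun ω => ‖x j ω - x k ω‖ ^ 2) P :=
  integrable_norm_sq_of_le ((R.measurable_x j).sub (R.measurable_x k)) (K := L + L) fun ω =>
    (norm_sub_le _ _).trans
      (add_le_add (R.bounds.norm_x_le _ (R.x_mem j ω)) (R.bounds.norm_x_le _ (R.x_mem k ω)))

/-- Second moment of a deterministic function of `(x^k, y^k)` plus the noise of the ascent step. -/
theorem integral_add_noiseY_le (R : RunSetting X Y f c L D F P ξy ξx ρ σ α β η x₀ y₀ x y dx)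
    {δ : ℝ}
    (hv : ∀ x ∈ X, ∀ y ∈ Y, Integrable (fun ξ => ‖gradY (F ξ) x y - gradY f x y‖ ^ 2) D ∧
      ∫ ξ, ‖gradY (F ξ) x y - gradY f x y‖ ^ 2 ∂D ≤ δ ^ 2) (k : ℕ) {a : X × Y → G}
    (ha : Measurable a) {K : ℝ} (hK : ∀ z, ‖a z‖ ≤ K) :
    Integrable (fun ω => ‖a (⟨x k ω, R.x_mem k ω⟩, ⟨y k ω, R.y_mem k ω⟩) +
      β k • (gradY (F (ξy k ω)) (x k ω) (y k ω) - gradY f (x k ω) (y k ω))‖ ^ 2) P ∧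
    ∫ ω, ‖a (⟨x k ω, R.x_mem k ω⟩, ⟨y k ω, R.y_mem k ω⟩) +
      β k • (gradY (F (ξy k ω)) (x k ω) (y k ω) - gradY f (x k ω) (y k ω))‖ ^ 2 ∂P ≤
    ∫ ω, ‖a (⟨x k ω, R.x_mem k ω⟩, ⟨y k ω, R.y_mem k ω⟩)‖ ^ 2 ∂P + β k ^ 2 * δ ^ 2 := by
  have hZ := measurable_pair (R.adapted k).1 (R.adapted k).2.1 (R.x_mem k) (R.y_mem k)
  have hZ' := hZ.mono (R.past_le k) le_rfl
  have hind : IndepFun (fun ω => ((⟨x k ω, R.x_mem k ω⟩ : X), (⟨y k ω, R.y_mem k ω⟩ : Y)))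
      (ξy k) P :=
    indep_of_indep_of_le_left (R.sampling.indep_y k).symm (measurable_iff_comap_le.1 hZ)
  have hswap : Measurable fun q : (X × Y) × Ξ => (q.2, q.1) := measurable_swap
  have hN : Measurable fun q : (X × Y) × Ξ =>
      β k • (gradY (F q.2) (q.1.1 : E) (q.1.2 : G) - gradY f (q.1.1 : E) (q.1.2 : G)) :=
    ((R.oracle.measurable_y.comp hswap).sub
      (R.bounds.f_bounds.continuous_gradY.measurable.comp measurable_fst)).const_smul (β k)
  have hnsq : ∀ (z : X × Y) (w : Ξ),
      ‖β k • (gradY (F w) (z.1 : E) (z.2 : G) - gradY f (z.1 : E) (z.2 : G))‖ ^ 2 =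
        β k ^ 2 * ‖gradY (F w) (z.1 : E) (z.2 : G) - gradY f (z.1 : E) (z.2 : G)‖ ^ 2 := by
    intro z w
    rw [norm_smul, mul_pow, Real.norm_eq_abs, sq_abs]
  have h := integral_norm_add_noise_sq_le (P := P) (D := D) hZ' (R.sampling.measurable_y k)
    (R.sampling.law_y k) hind ha hN
    (fun z => by
      simp only
      rw [integral_smul, (R.oracle.integral_noiseY z.1.2 z.2.2).2, smul_zero])
    (fun z => by
      simp only [hnsq]
      exact (hv _ z.1.2 _ z.2.2).1.const_mul _)
    (v := fun _ => β k ^ 2 * δ ^ 2) measurable_const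
    (fun z => by
      simp only [hnsq]
      rw [integral_const_mul]
      exact mul_le_mul_of_nonneg_left (hv _ z.1.2 _ z.2.2).2 (sq_nonneg _))
    (C := β k ^ 2 * δ ^ 2) (fun _ => le_rfl)
    (integrable_norm_sq_of_le (ha.comp hZ') fun ω => hK _)
  simpa using h

/-- The inner solution is a fixed point of the exact projected ascent step. Subtracting it leaves
the contraction factor of that step plus centred noise, which adds only its variance. -/
theorem inner_error_ascent_le (R : RunSetting X Y f c L D F P ξy ξx ρ σ α β η x₀ y₀ x y dx)
    {δ : ℝ}
    (hv : ∀ x ∈ X, ∀ y ∈ Y, Integrable (fun ξ => ‖gradY (F ξ) x y - gradY f x y‖ ^ 2) D ∧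
      ∫ ξ, ‖gradY (F ξ) x y - gradY f x y‖ ^ 2 ∂D ≤ δ ^ 2) (k : ℕ) :
    ∫ ω, ‖y (k + 1) ω - innerSol Y f c ρ σ x k ω‖ ^ 2 ∂P ≤
      (1 - 2 * β k * σ k + β k ^ 2 * ((1 + ρ k) * L + σ k) ^ 2) *
        ∫ ω, ‖y k ω - innerSol Y f c ρ σ x k ω‖ ^ 2 ∂P + β k ^ 2 * δ ^ 2 := by
  have H := R.std
  have B := R.bounds
  have hρ := (R.ρ_pos k).le
  have hσ := R.σ_pos k
  have hβ := (R.β_pos k).le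
  set q := 1 - 2 * β k * σ k + β k ^ 2 * ((1 + ρ k) * L + σ k) ^ 2 with hq
  set a : X × Y → G := fun z =>
    ((z.2 : G) + β k • gradY (psi f c (ρ k) (σ k)) (z.1 : E) (z.2 : G)) -
      (ystar Y f c (ρ k) (σ k) (z.1 : E) + β k • gradY (psi f c (ρ k) (σ k)) (z.1 : E)
        (ystar Y f c (ρ k) (σ k) (z.1 : E))) with ha
  have hcs : Continuous fun z : X × Y => ystar Y f c (ρ k) (σ k) (z.1 : E) :=
    (B.continuous_ystar H hρ hσ).comp continuous_fst
  have hcg : Continuous fun z : X × Y => gradY (psi f c (ρ k) (σ k)) (z.1 : E)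
      (ystar Y f c (ρ k) (σ k) (z.1 : E)) :=
    (B.continuous_gradY_psi H (ρ k) (σ k)).comp
      (continuous_fst.prodMk (hcs.subtype_mk fun z => H.ystar_mem z.1.2 _ _))
  have hac : Continuous a :=
    ((continuous_subtype_val.comp continuous_snd).add
      ((B.continuous_gradY_psi H (ρ k) (σ k)).const_smul _)).sub (hcs.add (hcg.const_smul _))
  have haq : ∀ z : X × Y, ‖a z‖ ^ 2 ≤ q * ‖(z.2 : G) - ystar Y f c (ρ k) (σ k) (z.1 : E)‖ ^ 2 :=
    fun z => B.norm_ascent_step_sub_sq_le H hρ hσ.le hβ z.1.2 z.2.2 (H.ystar_mem z.1.2 _ _)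
  have : CompactSpace X := isCompact_iff_compactSpace.1 H.X_compact
  have : CompactSpace Y := isCompact_iff_compactSpace.1 H.Y_compact
  obtain ⟨K, hK⟩ := isCompact_univ.exists_bound_of_continuousOn hac.continuousOn
  obtain ⟨hi, hle⟩ := R.integral_add_noiseY_le hv k hac.measurable fun z => hK z (mem_univ z)
  have h1 : ∀ ω, ‖y (k + 1) ω - innerSol Y f c ρ σ x k ω‖ ^ 2 ≤
      ‖a (⟨x k ω, R.x_mem k ω⟩, ⟨y k ω, R.y_mem k ω⟩) +
        β k • (gradY (F (ξy k ω)) (x k ω) (y k ω) - gradY f (x k ω) (y k ω))‖ ^ 2 := by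
    intro ω
    refine pow_le_pow_left₀ (norm_nonneg _) ?_ 2
    rw [R.y_succ_eq, innerSol, ← H.proj_ystar (R.x_mem k ω) (ρ k) (σ k) hβ]
    refine (norm_proj_sub_proj_le H.Y_compact H.Y_nonempty H.Y_convex _ _).trans (le_of_eq ?_)
    congr 1
    simp only [ha]
    abel
  have h2 : ∫ ω, ‖a (⟨x k ω, R.x_mem k ω⟩, ⟨y k ω, R.y_mem k ω⟩)‖ ^ 2 ∂P ≤
      q * ∫ ω, ‖y k ω - innerSol Y f c ρ σ x k ω‖ ^ 2 ∂P := by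
    rw [← integral_const_mul]
    exact integral_mono_of_nonneg (Eventually.of_forall fun ω => sq_nonneg _)
      ((R.integrable_sq_dist_inner k k).const_mul q) (Eventually.of_forall fun ω => haq _)
  have h3 := integral_mono (R.integrable_sq_dist_inner (k + 1) k) hi h1
  linarith

theorem y_step_le (R : RunSetting X Y f c L D F P ξy ξx ρ σ α β η x₀ y₀ x y dx)
    {δ : ℝ}
    (hv : ∀ x ∈ X, ∀ y ∈ Y, Integrable (fun ξ => ‖gradY (F ξ) x y - gradY f x y‖ ^ 2) D ∧
      ∫ ξ, ‖gradY (F ξ) x y - gradY f x y‖ ^ 2 ∂D ≤ δ ^ 2) (k : ℕ) :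
    ∫ ω, ‖y (k + 1) ω - y k ω‖ ^ 2 ∂P ≤
      β k ^ 2 * (((1 + ρ k) * L + σ k * L) ^ 2 + δ ^ 2) := by
  have H := R.std
  have B := R.bounds
  have hρ := (R.ρ_pos k).le
  have hσ := R.σ_pos k
  have hβ := (R.β_pos k).le
  set a : X × Y → G := fun z => β k • gradY (psi f c (ρ k) (σ k)) (z.1 : E) (z.2 : G) with ha
  have hac : Continuous a := (B.continuous_gradY_psi H (ρ k) (σ k)).const_smul _
  have haK : ∀ z, ‖a z‖ ≤ β k * ((1 + ρ k) * L + σ k * L) := fun z => by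
    simp only [ha]
    rw [norm_smul, Real.norm_of_nonneg hβ]
    exact mul_le_mul_of_nonneg_left (B.norm_gradY_psi_le H hρ hσ.le z.1.2 z.2.2) hβ
  obtain ⟨hi, hle⟩ := R.integral_add_noiseY_le hv k hac.measurable haK
  have h1 : ∀ ω, ‖y (k + 1) ω - y k ω‖ ^ 2 ≤
      ‖a (⟨x k ω, R.x_mem k ω⟩, ⟨y k ω, R.y_mem k ω⟩) +
        β k • (gradY (F (ξy k ω)) (x k ω) (y k ω) - gradY f (x k ω) (y k ω))‖ ^ 2 := by
    intro ω
    refine pow_le_pow_left₀ (norm_nonneg _) ?_ 2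
    have e : proj Y (y k ω) = y k ω :=
      proj_eq H.Y_compact H.Y_convex (R.y_mem k ω) fun z _ => by simp
    have h := norm_proj_sub_proj_le H.Y_compact H.Y_nonempty H.Y_convex
      (y k ω + β k • gradY (psi f c (ρ k) (σ k)) (x k ω) (y k ω) +
        β k • (gradY (F (ξy k ω)) (x k ω) (y k ω) - gradY f (x k ω) (y k ω))) (y k ω)
    rw [e, ← R.y_succ_eq] at h
    refine h.trans (le_of_eq ?_)
    congr 1
    simp only [ha]
    abel
  have h2 : ∫ ω, ‖a (⟨x k ω, R.x_mem k ω⟩, ⟨y k ω, R.y_mem k ω⟩)‖ ^ 2 ∂P ≤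
      (β k * ((1 + ρ k) * L + σ k * L)) ^ 2 := by
    have := integral_mono_of_nonneg (μ := P)
      (f := fun ω => ‖a (⟨x k ω, R.x_mem k ω⟩, ⟨y k ω, R.y_mem k ω⟩)‖ ^ 2)
      (Eventually.of_forall fun ω => sq_nonneg _)
      (integrable_const ((β k * ((1 + ρ k) * L + σ k * L)) ^ 2))
      (Eventually.of_forall fun ω => pow_le_pow_left₀ (norm_nonneg _) (haK _) 2)
    simpa using this
  have h3 := integral_mono (R.integrable_sq_y_step (k + 1) k) hi h1
  rw [mul_pow] at h2
  linarith

/-- The target moves with `x`, `ρ` and `σ`. Young's inequality with a free `θ` separates the old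
error from this motion; `θ` is later half of the ascent contraction. -/
theorem inner_error_drift_le (R : RunSetting X Y f c L D F P ξy ξx ρ σ α β η x₀ y₀ x y dx)
    (k : ℕ) {θ : ℝ} (hθ : 0 < θ) :
    ∫ ω, ‖y (k + 1) ω - innerSol Y f c ρ σ x (k + 1) ω‖ ^ 2 ∂P ≤
      (1 + θ) * ∫ ω, ‖y (k + 1) ω - innerSol Y f c ρ σ x k ω‖ ^ 2 ∂P +
      (1 + 1 / θ) * (2 * ((1 + ρ k) * L / σ k) ^ 2 * ∫ ω, ‖x (k + 1) ω - x k ω‖ ^ 2 ∂P +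
        2 * ((|ρ k - ρ (k + 1)| * L + |σ k - σ (k + 1)| * L) / σ k) ^ 2) := by
  have H := R.std
  have B := R.bounds
  set A := (1 + ρ k) * L / σ k with hA
  set b := (|ρ k - ρ (k + 1)| * L + |σ k - σ (k + 1)| * L) / σ k with hb
  have hpt : ∀ ω, ‖y (k + 1) ω - innerSol Y f c ρ σ x (k + 1) ω‖ ^ 2 ≤
      (1 + θ) * ‖y (k + 1) ω - innerSol Y f c ρ σ x k ω‖ ^ 2 +
      (1 + 1 / θ) * (2 * A ^ 2 * ‖x (k + 1) ω - x k ω‖ ^ 2 + 2 * b ^ 2) := by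
    intro ω
    have h1 := B.norm_ystar_sub_le H (ρ₂ := ρ (k + 1)) (σ₂ := σ (k + 1)) (R.ρ_pos k).le
      (R.σ_pos k) (R.x_mem k ω) (R.x_mem (k + 1) ω)
    have h2 : ‖innerSol Y f c ρ σ x k ω - innerSol Y f c ρ σ x (k + 1) ω‖ ≤
        A * ‖x (k + 1) ω - x k ω‖ + b := by
      refine h1.trans (le_of_eq ?_)
      rw [norm_sub_rev (x k ω), hA, hb]
      ring
    have h3 : ‖innerSol Y f c ρ σ x k ω - innerSol Y f c ρ σ x (k + 1) ω‖ ^ 2 ≤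
        2 * A ^ 2 * ‖x (k + 1) ω - x k ω‖ ^ 2 + 2 * b ^ 2 := by
      refine (pow_le_pow_left₀ (norm_nonneg _) h2 2).trans ?_
      nlinarith [sq_nonneg (A * ‖x (k + 1) ω - x k ω‖ - b)]
    set u := ‖y (k + 1) ω - innerSol Y f c ρ σ x k ω‖
    set w := ‖innerSol Y f c ρ σ x k ω - innerSol Y f c ρ σ x (k + 1) ω‖
    have h4 : ‖y (k + 1) ω - innerSol Y f c ρ σ x (k + 1) ω‖ ≤ u + w :=
      norm_sub_le_norm_sub_add_norm_sub _ _ _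
    have h5 : (u + w) ^ 2 ≤ (1 + θ) * u ^ 2 + (1 + 1 / θ) * w ^ 2 := by
      have e : (1 + θ) * u ^ 2 + (1 + 1 / θ) * w ^ 2 - (u + w) ^ 2 = (θ * u - w) ^ 2 / θ := by
        field_simp
        ring
      have : 0 ≤ (θ * u - w) ^ 2 / θ := by positivity
      linarith
    have h6 : (1 + 1 / θ) * w ^ 2 ≤
        (1 + 1 / θ) * (2 * A ^ 2 * ‖x (k + 1) ω - x k ω‖ ^ 2 + 2 * b ^ 2) :=
      mul_le_mul_of_nonneg_left h3 (by positivity)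
    linarith [pow_le_pow_left₀ (norm_nonneg _) h4 2]
  have i1 := (R.integrable_sq_dist_inner (k + 1) k).const_mul (1 + θ)
  have i2 := (R.integrable_sq_x_step (k + 1) k).const_mul (2 * A ^ 2)
  have i3 := (i2.add (integrable_const (2 * b ^ 2))).const_mul (1 + 1 / θ)
  refine (integral_mono (R.integrable_sq_dist_inner (k + 1) (k + 1)) (i1.add i3) hpt).trans
    (le_of_eq ?_)
  refine (integral_add i1 i3).trans ?_
  rw [integral_const_mul]
  congr 1
  rw [integral_const_mul]
  congr 1
  refine (integral_add i2 (integrable_const _)).trans ?_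
  rw [integral_const_mul]
  simp

theorem dirError_step (R : RunSetting X Y f c L D F P ξy ξx ρ σ α β η x₀ y₀ x y dx) {δ LF : ℝ}
    (hv : ∀ x ∈ X, ∀ y ∈ Y, Integrable (fun ξ => ‖gradX (F ξ) x y - gradX f x y‖ ^ 2) D ∧
      ∫ ξ, ‖gradX (F ξ) x y - gradX f x y‖ ^ 2 ∂D ≤ δ ^ 2)
    (hLF : ∀ x₁ ∈ X, ∀ y₁ ∈ Y, ∀ x₂ ∈ X, ∀ y₂ ∈ Y,
      ∫ ξ, ‖gradX (F ξ) x₁ y₁ - gradX (F ξ) x₂ y₂‖ ^ 2 ∂D ≤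
        LF ^ 2 * (‖x₁ - x₂‖ ^ 2 + ‖y₁ - y₂‖ ^ 2)) (k : ℕ)
    (hi : Integrable (fun ω => ‖dirError f c ρ σ x y dx k ω‖ ^ 2) P) :
    Integrable (fun ω => ‖dirError f c ρ σ x y dx (k + 1) ω‖ ^ 2) P ∧
    ∫ ω, ‖dirError f c ρ σ x y dx (k + 1) ω‖ ^ 2 ∂P ≤
      (1 - η (k + 1)) ^ 2 * ∫ ω, ‖dirError f c ρ σ x y dx k ω‖ ^ 2 ∂P +
      (4 * LF ^ 2 + 8 * L ^ 2) * (∫ ω, ‖x (k + 1) ω - x k ω‖ ^ 2 ∂P +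
        ∫ ω, ‖y (k + 2) ω - y (k + 1) ω‖ ^ 2 ∂P) + 2 * η (k + 1) ^ 2 * δ ^ 2 := by
  have B := R.bounds
  set r := η (k + 1)
  have hle := past_le_pastHalf ξy ξx (k + 1)
  have hle' := pastHalf_le_past_succ ξy ξx k
  have hx := (R.adapted k).1.mono ((past_le_pastHalf ξy ξx k).trans (hle'.trans hle)) le_rfl
  have hy := (R.adapted (k + 1)).2.1.mono hle le_rfl
  have hx' := (R.adapted (k + 1)).1.mono hle le_rfl
  have hd := (R.adapted k).2.2.mono hle le_rfl
  have hy' := R.measurable_y_succ_pastHalf (k + 1)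
  have he : Measurable[pastHalf ξy ξx (k + 1)] (dirError f c ρ σ x y dx k) :=
    measurable_dirError R.std R.bounds hx hy hd (R.x_mem k) (R.y_mem (k + 1))
  have hZ := measurable_pairs hx hx' he hy hy' (R.x_mem k) (R.x_mem (k + 1)) (R.y_mem (k + 1))
    (R.y_mem (k + 2))
  have hZ' := hZ.mono (R.pastHalf_le (k + 1)) le_rfl
  -- The state fixed before `ξx (k + 1)` is drawn: both evaluation points and the current error. It
  -- already contains `y (k + 2)`, so half-step measurability is essential.
  set Z : Ω → ((X × Y) × X × Y) × E := fun ω =>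
    ((((⟨x k ω, R.x_mem k ω⟩ : X), (⟨y (k + 1) ω, R.y_mem (k + 1) ω⟩ : Y)),
      ((⟨x (k + 1) ω, R.x_mem (k + 1) ω⟩ : X), (⟨y (k + 2) ω, R.y_mem (k + 2) ω⟩ : Y))),
        dirError f c ρ σ x y dx k ω) with hZdef
  have hind : IndepFun Z (ξx (k + 1)) P :=
    indep_of_indep_of_le_left (R.sampling.indep_x (k + 1)).symm (measurable_iff_comap_le.1 hZ)
  have hn : Measurable fun q : (X × Y) × Ξ =>
      gradX (F q.2) (q.1.1 : E) (q.1.2 : G) - gradX f (q.1.1 : E) (q.1.2 : G) :=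
    (R.oracle.measurable_x.comp measurable_swap).sub
      (B.f_bounds.continuous_gradX.measurable.comp measurable_fst)
  have hN : Measurable fun q : (((X × Y) × X × Y) × E) × Ξ =>
      (gradX (F q.2) (q.1.1.2.1 : E) (q.1.1.2.2 : G) -
          gradX f (q.1.1.2.1 : E) (q.1.1.2.2 : G)) -
        (1 - r) • (gradX (F q.2) (q.1.1.1.1 : E) (q.1.1.1.2 : G) -
          gradX f (q.1.1.1.1 : E) (q.1.1.1.2 : G)) :=
    (hn.comp (f := fun q : (((X × Y) × X × Y) × E) × Ξ => (q.1.1.2, q.2)) (by fun_prop)).sub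
      ((hn.comp (f := fun q : (((X × Y) × X × Y) × E) × Ξ => (q.1.1.1, q.2))
        (by fun_prop)).const_smul (1 - r))
  have hnoise := fun z : ((X × Y) × X × Y) × E => R.oracle.recursive_noise_le B.f_bounds hv hLF r
    z.1.1.1.2 z.1.1.2.2 z.1.2.1.2 z.1.2.2.2
  have h := integral_norm_add_noise_sq_le (P := P) (D := D) hZ' (R.sampling.measurable_x (k + 1))
    (R.sampling.law_x (k + 1)) hind (a := fun z => (1 - r) • z.2) (by fun_prop) hN
    (fun z => by
      obtain ⟨i1, e1⟩ := R.oracle.integral_noiseX z.1.1.1.2 z.1.1.2.2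
      obtain ⟨i2, e2⟩ := R.oracle.integral_noiseX z.1.2.1.2 z.1.2.2.2
      refine (integral_sub i2 (i1.smul (1 - r))).trans ?_
      simp only [Pi.smul_apply]
      rw [integral_smul, e1, e2, smul_zero, sub_zero])
    (fun z => (hnoise z).1)
    (v := fun z => (4 * LF ^ 2 + 8 * L ^ 2) * (‖(z.1.2.1 : E) - z.1.1.1‖ ^ 2 +
      ‖(z.1.2.2 : G) - z.1.1.2‖ ^ 2) + 2 * r ^ 2 * δ ^ 2)
    (by fun_prop) (fun z => (hnoise z).2)
    (C := (4 * LF ^ 2 + 8 * L ^ 2) * ((L + L) ^ 2 + (L + L) ^ 2) + 2 * r ^ 2 * δ ^ 2)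
    (fun z => by
      have h1 : ‖(z.1.2.1 : E) - z.1.1.1‖ ≤ L + L := (norm_sub_le _ _).trans
        (add_le_add (B.norm_x_le _ z.1.2.1.2) (B.norm_x_le _ z.1.1.1.2))
      have h2 : ‖(z.1.2.2 : G) - z.1.1.2‖ ≤ L + L := (norm_sub_le _ _).trans
        (add_le_add (B.norm_y_le _ z.1.2.2.2) (B.norm_y_le _ z.1.1.2.2))
      gcongr)
    (by
      simp only [norm_smul, mul_pow]
      exact hi.const_mul _)
  have hfun : ∀ ω, dirError f c ρ σ x y dx (k + 1) ω = _ := R.dirError_succ k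
  obtain ⟨hint, hbound⟩ := h
  have hint' : Integrable (fun ω => ‖dirError f c ρ σ x y dx (k + 1) ω‖ ^ 2) P := by
    simp_rw [hfun]
    exact hint
  refine ⟨hint', ?_⟩
  have e1 : ∫ ω, ‖dirError f c ρ σ x y dx (k + 1) ω‖ ^ 2 ∂P = ∫ ω, ‖_‖ ^ 2 ∂P :=
    integral_congr_ae (Eventually.of_forall fun ω => by simp only [hfun]; rfl)
  refine (e1.le.trans hbound).trans (le_of_eq ?_)
  have e2 : ∫ ω, ‖(1 - r) • (Z ω).2‖ ^ 2 ∂P =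
      (1 - r) ^ 2 * ∫ ω, ‖dirError f c ρ σ x y dx k ω‖ ^ 2 ∂P := by
    rw [← integral_const_mul]
    refine integral_congr_ae (Eventually.of_forall fun ω => ?_)
    simp only [norm_smul, mul_pow, Real.norm_eq_abs, sq_abs, hZdef]
  have i1 := R.integrable_sq_x_step (k + 1) k
  have i2 := R.integrable_sq_y_step (k + 2) (k + 1)
  have e3 : ∫ ω, ((4 * LF ^ 2 + 8 * L ^ 2) * (‖x (k + 1) ω - x k ω‖ ^ 2 +
      ‖y (k + 2) ω - y (k + 1) ω‖ ^ 2) + 2 * r ^ 2 * δ ^ 2) ∂P =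
      (4 * LF ^ 2 + 8 * L ^ 2) * (∫ ω, ‖x (k + 1) ω - x k ω‖ ^ 2 ∂P +
        ∫ ω, ‖y (k + 2) ω - y (k + 1) ω‖ ^ 2 ∂P) + 2 * r ^ 2 * δ ^ 2 := by
    rw [← integral_add i1 i2, ← integral_const_mul]
    refine (integral_add ((i1.add i2).const_mul _) (integrable_const _)).trans ?_
    simp
  rw [e2, add_assoc]
  congr 1

theorem integrable_dirError (R : RunSetting X Y f c L D F P ξy ξx ρ σ α β η x₀ y₀ x y dx) (k : ℕ) :
    Integrable (fun ω => ‖dirError f c ρ σ x y dx k ω‖ ^ 2) P := by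
  obtain ⟨δ, -, hv⟩ := R.oracle.variance
  obtain ⟨LF, -, hLF⟩ := R.oracle.mean_square_smooth
  induction k with
  | succ k ih => exact (R.dirError_step (fun x hx y hy => (hv x hx y hy).1) hLF k ih).1
  | zero =>
    have hZ := measurable_pair ((R.adapted 0).1.mono (past_le_pastHalf ξy ξx 0) le_rfl)
      (R.measurable_y_succ_pastHalf 0) (R.x_mem 0) (R.y_mem 1)
    have hZ' := hZ.mono (R.pastHalf_le 0) le_rfl
    have hind : IndepFun (fun ω => ((⟨x 0 ω, R.x_mem 0 ω⟩ : X), (⟨y 1 ω, R.y_mem 1 ω⟩ : Y)))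
        (ξx 0) P :=
      indep_of_indep_of_le_left (R.sampling.indep_x 0).symm (measurable_iff_comap_le.1 hZ)
    have hn : Measurable fun q : (X × Y) × Ξ =>
        gradX (F q.2) (q.1.1 : E) (q.1.2 : G) - gradX f (q.1.1 : E) (q.1.2 : G) :=
      (R.oracle.measurable_x.comp measurable_swap).sub
        (R.bounds.f_bounds.continuous_gradX.measurable.comp measurable_fst)
    -- The initial error is pure noise, whence the zero function in place of a previous error.
    have h := integral_norm_add_noise_sq_le (P := P) (D := D) hZ' (R.sampling.measurable_x 0)
      (R.sampling.law_x 0) hind (a := fun _ => (0 : E)) measurable_const hn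
      (fun z => (R.oracle.integral_noiseX z.1.2 z.2.2).2)
      (fun z => (hv _ z.1.2 _ z.2.2).1.1) (v := fun _ => δ ^ 2) measurable_const
      (fun z => (hv _ z.1.2 _ z.2.2).1.2) (C := δ ^ 2) (fun _ => le_rfl) (by simp)
    simp_rw [R.dirError_zero]
    simpa using h.1

theorem gradient_phi_sub_dx_sq_le (R : RunSetting X Y f c L D F P ξy ξx ρ σ α β η x₀ y₀ x y dx)
    (k : ℕ) (ω : Ω) : ‖gradient (phi Y f c (ρ k) (σ k)) (x k ω) - dx k ω‖ ^ 2 ≤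
      2 * ‖dirError f c ρ σ x y dx k ω‖ ^ 2 +
        2 * ((1 + ρ k) * L) ^ 2 * ‖y (k + 1) ω - innerSol Y f c ρ σ x k ω‖ ^ 2 := by
  have hx := R.x_mem k ω
  have hm := R.innerSol_mem k ω
  rw [(R.std.hasGradientAt_phi hx (R.ρ_pos k).le (R.σ_pos k)).gradient]
  change ‖gradX (psi f c (ρ k) (σ k)) (x k ω) (innerSol Y f c ρ σ x k ω) - dx k ω‖ ^ 2 ≤ _
  have h1 := R.bounds.gradX_psi_lip R.std (R.ρ_pos k).le (σ k) hx hm hx (R.y_mem (k + 1) ω)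
  rw [sub_self, norm_zero, zero_add, norm_sub_rev (innerSol Y f c ρ σ x k ω)] at h1
  have e : gradX (psi f c (ρ k) (σ k)) (x k ω) (innerSol Y f c ρ σ x k ω) - dx k ω =
      (gradX (psi f c (ρ k) (σ k)) (x k ω) (innerSol Y f c ρ σ x k ω) -
        gradX (psi f c (ρ k) (σ k)) (x k ω) (y (k + 1) ω)) - dirError f c ρ σ x y dx k ω := by
    rw [dirError]; abel
  rw [e]
  refine (norm_sub_sq_le_two_mul _ _).trans ?_
  have h2 := pow_le_pow_left₀ (norm_nonneg _) h1 2
  rw [mul_pow] at h2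
  linarith

/-- The true projected step and the one taken differ only in their direction; nonexpansiveness
bounds the discrepancy by the gradient error after division by `α`. -/
theorem residual_sq_le (R : RunSetting X Y f c L D F P ξy ξx ρ σ α β η x₀ y₀ x y dx)
    (k : ℕ) (ω : Ω) : ‖residual X Y f c (ρ k) (σ k) (α k) (x k ω)‖ ^ 2 ≤
      2 * (1 / α k) ^ 2 * ‖x (k + 1) ω - x k ω‖ ^ 2 +
      4 * ‖dirError f c ρ σ x y dx k ω‖ ^ 2 +
        4 * ((1 + ρ k) * L) ^ 2 * ‖y (k + 1) ω - innerSol Y f c ρ σ x k ω‖ ^ 2 := by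
  have H := R.std
  have hα := R.α_pos k
  have h0 := R.gradient_phi_sub_dx_sq_le k ω
  set g := gradient (phi Y f c (ρ k) (σ k)) (x k ω) with hg
  have e : residual X Y f c (ρ k) (σ k) (α k) (x k ω) =
      (1 / α k) • (proj X (x k ω - α k • dx k ω) - proj X (x k ω - α k • g)) -
        (1 / α k) • (x (k + 1) ω - x k ω) := by
    rw [residual, R.run.x_succ, ← hg]; module
  have h1 := norm_proj_sub_proj_le H.X_compact H.X_nonempty H.X_convex
    (x k ω - α k • dx k ω) (x k ω - α k • g)
  rw [sub_sub_sub_cancel_left, ← smul_sub, norm_smul, Real.norm_of_nonneg hα.le] at h1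
  have h2 : ‖(1 / α k) • (proj X (x k ω - α k • dx k ω) - proj X (x k ω - α k • g))‖ ≤
      ‖g - dx k ω‖ := by
    rw [norm_smul, Real.norm_of_nonneg (by positivity), one_div, inv_mul_le_iff₀ hα]
    exact h1
  rw [e]
  refine (norm_sub_sq_le_two_mul _ _).trans ?_
  rw [norm_smul (1 / α k) (x (k + 1) ω - x k ω), mul_pow, Real.norm_eq_abs, sq_abs]
  have h3 := pow_le_pow_left₀ (norm_nonneg _) h2 2
  linarith

/-- Lipschitz smoothness of `φ`, the variational inequality of the projected step and Young's
inequality for the direction error, followed by the price of changing the parameters. -/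
theorem phi_descent (R : RunSetting X Y f c L D F P ξy ξx ρ σ α β η x₀ y₀ x y dx)
    (k : ℕ) (hρ : ρ k ≤ ρ (k + 1)) :
    ∫ ω, phi Y f c (ρ (k + 1)) (σ (k + 1)) (x (k + 1) ω) ∂P ≤
      ∫ ω, phi Y f c (ρ k) (σ k) (x k ω) ∂P -
      (3 / (4 * α k) - phiLip L (ρ k) (σ k)) * ∫ ω, ‖x (k + 1) ω - x k ω‖ ^ 2 ∂P +
      α k * (2 * ∫ ω, ‖dirError f c ρ σ x y dx k ω‖ ^ 2 ∂P +
        2 * ((1 + ρ k) * L) ^ 2 * ∫ ω, ‖y (k + 1) ω - innerSol Y f c ρ σ x k ω‖ ^ 2 ∂P) +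
      |σ k - σ (k + 1)| * L ^ 2 := by
  have H := R.std
  have B := R.bounds
  have hα := R.α_pos k
  have hpt : ∀ ω, phi Y f c (ρ (k + 1)) (σ (k + 1)) (x (k + 1) ω) ≤
      phi Y f c (ρ k) (σ k) (x k ω) +
      (-(3 / (4 * α k) - phiLip L (ρ k) (σ k))) * ‖x (k + 1) ω - x k ω‖ ^ 2 +
      α k * (2 * ‖dirError f c ρ σ x y dx k ω‖ ^ 2 +
        2 * ((1 + ρ k) * L) ^ 2 * ‖y (k + 1) ω - innerSol Y f c ρ σ x k ω‖ ^ 2) +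
      |σ k - σ (k + 1)| * L ^ 2 := by
    intro ω
    have hx := R.x_mem k ω
    have hx' := R.x_mem (k + 1) ω
    have h1 := B.phi_change_le H (σ := σ k) (σ' := σ (k + 1)) hρ hx'
    have h2 := B.phi_le_add H (R.ρ_pos k).le (R.σ_pos k) hx hx'
    have h3 := R.gradient_phi_sub_dx_sq_le k ω
    set g := gradient (phi Y f c (ρ k) (σ k)) (x k ω)
    set d := x (k + 1) ω - x k ω with hd
    have h4 : α k * inner ℝ (dx k ω) d ≤ -‖d‖ ^ 2 := by
      have := inner_sub_proj_nonpos H.X_compact H.X_nonempty H.X_convex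
        (x k ω - α k • dx k ω) hx
      rw [← R.run.x_succ, show x k ω - α k • dx k ω - x (k + 1) ω = -(α k • dx k ω + d) by
        rw [hd]; abel, show x k ω - x (k + 1) ω = -d by rw [hd]; abel, inner_neg_neg,
        inner_add_left, inner_smul_left, real_inner_self_eq_norm_sq] at this
      simp only [conj_trivial] at this
      linarith
    have h5 : inner ℝ (dx k ω) d ≤ -(1 / α k) * ‖d‖ ^ 2 := by
      rw [neg_mul, one_div, ← mul_neg, le_inv_mul_iff₀ hα]
      exact h4
    -- The Young weights spend a quarter of the available `1/α`, leaving the coefficient `3/(4α)`.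
    have h6 : inner ℝ (g - dx k ω) d ≤ α k * ‖g - dx k ω‖ ^ 2 + 1 / (4 * α k) * ‖d‖ ^ 2 := by
      refine (real_inner_le_norm _ _).trans ?_
      have e : α k * ‖g - dx k ω‖ ^ 2 + 1 / (4 * α k) * ‖d‖ ^ 2 - ‖g - dx k ω‖ * ‖d‖ =
          α k * (‖g - dx k ω‖ - ‖d‖ / (2 * α k)) ^ 2 := by field_simp; ring
      have : 0 ≤ α k * (‖g - dx k ω‖ - ‖d‖ / (2 * α k)) ^ 2 := by positivity
      linarith
    rw [inner_sub_left] at h6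
    have h7 := mul_le_mul_of_nonneg_left h3 hα.le
    have e : 3 / (4 * α k) = 1 / α k - 1 / (4 * α k) := by field_simp; norm_num
    rw [e]
    linarith
  have : CompactSpace X := isCompact_iff_compactSpace.1 H.X_compact
  have hphi : ∀ j, Integrable (fun ω => phi Y f c (ρ j) (σ j) (x j ω)) P := by
    intro j
    have hc := H.continuous_phi (R.ρ_pos j).le (R.σ_pos j)
    obtain ⟨K, hK⟩ := isCompact_univ.exists_bound_of_continuousOn hc.continuousOn
    exact Integrable.of_bound (hc.measurable.comp
      ((R.measurable_x j).subtype_mk (h := R.x_mem j))).aestronglyMeasurable K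
      (Eventually.of_forall fun ω => hK ⟨x j ω, R.x_mem j ω⟩ (mem_univ _))
  have i1 := (R.integrable_sq_x_step (k + 1) k).const_mul
    (-(3 / (4 * α k) - phiLip L (ρ k) (σ k)))
  have i2 := (R.integrable_dirError k).const_mul 2
  have i3 := (R.integrable_sq_dist_inner (k + 1) k).const_mul (2 * ((1 + ρ k) * L) ^ 2)
  have i4 := (i2.add i3).const_mul (α k)
  refine (integral_mono (hphi (k + 1)) ((((hphi k).add i1).add i4).add (integrable_const _))
    hpt).trans (le_of_eq ?_)
  refine (integral_add (((hphi k).add i1).add i4) (integrable_const _)).trans ?_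
  refine congrArg₂ _ ((integral_add ((hphi k).add i1) i4).trans ?_) (by simp)
  refine congrArg₂ _ ((integral_add (hphi k) i1).trans ?_) ?_
  · rw [integral_const_mul, sub_eq_add_neg _ (_ * _), neg_mul]
  · rw [integral_const_mul]
    congr 1
    refine (integral_add i2 i3).trans ?_
    rw [integral_const_mul, integral_const_mul]

theorem le_integral_phi (R : RunSetting X Y f c L D F P ξy ξx ρ σ α β η x₀ y₀ x y dx) (k : ℕ) :
    -L - σ k * L ^ 2 ≤ ∫ ω, phi Y f c (ρ k) (σ k) (x k ω) ∂P := by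
  have hc := R.std.continuous_phi (R.ρ_pos k).le (R.σ_pos k)
  have : CompactSpace X := isCompact_iff_compactSpace.1 R.std.X_compact
  obtain ⟨K, hK⟩ := isCompact_univ.exists_bound_of_continuousOn hc.continuousOn
  have hi : Integrable (fun ω => phi Y f c (ρ k) (σ k) (x k ω)) P :=
    Integrable.of_bound (hc.measurable.comp
      ((R.measurable_x k).subtype_mk (h := R.x_mem k))).aestronglyMeasurable K
      (Eventually.of_forall fun ω => hK ⟨x k ω, R.x_mem k ω⟩ (mem_univ _))
  have := integral_mono (integrable_const (-L - σ k * L ^ 2)) hi fun ω =>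
    R.bounds.le_phi R.std (R.σ_pos k).le (R.x_mem k ω)
  simpa using this

end RunSetting

end Run

end SPACO

/-! ### The recursions expressed in the scales `u` and `v`. -/

namespace SPACO

set_option maxSynthPendingDepth 3
set_option linter.unusedSectionVars false

open Filter Topology Set MeasureTheory ProbabilityTheory

/-- The parameters expressed through `u = k^t` and `v = k^s`, with the growth properties of
these two scales that the convergence analysis uses. -/
structure ScaleSchedule (ρ₀ σ₀ α₀ β₀ η₀ : ℝ) (u v ρ σ α β η : ℕ → ℝ) : Prop where
  ρ₀_pos : 0 < ρ₀
  σ₀_pos : 0 < σ₀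
  α₀_pos : 0 < α₀
  β₀_pos : 0 < β₀
  η₀_pos : 0 < η₀
  one_le_u : ∀ k, 1 ≤ k → 1 ≤ u k
  one_le_v : ∀ k, 1 ≤ k → 1 ≤ v k
  u_mono : ∀ k, 1 ≤ k → u k ≤ u (k + 1)
  u_diff : ∀ k : ℕ, 1 ≤ k → u (k + 1) - u k ≤ u k / k
  v_mono : ∀ k, 1 ≤ k → v k ≤ v (k + 1)
  v_double : ∀ k, 1 ≤ k → v (k + 1) ≤ 2 * v k
  u_tendsto : Tendsto u atTop atTop
  ratio_tendsto : Tendsto (fun k => u k ^ 3 / v k) atTop (𝓝 0)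
  u8_tendsto : Tendsto (fun k : ℕ => u k ^ 8 * v k / k) atTop (𝓝 0)
  ρ_eq : ∀ k, 1 ≤ k → ρ k = ρ₀ * u k
  σ_eq : ∀ k, 1 ≤ k → σ k = σ₀ / u k
  α_eq : ∀ k, 1 ≤ k → α k = α₀ / (u k ^ 6 * v k)
  β_eq : ∀ k, 1 ≤ k → β k = β₀ / (u k * v k)
  η_eq : ∀ k, 1 ≤ k → η k = η₀ / v k

theorem tendsto_natCast_rpow_neg {a : ℝ} (ha : a < 0) :
    Tendsto (fun k : ℕ => (k : ℝ) ^ a) atTop (𝓝 0) := by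
  have := (tendsto_rpow_neg_atTop (neg_pos.2 ha)).comp tendsto_natCast_atTop_atTop
  simpa [Function.comp_def] using this

/-- Factor out `k^a`; since `1 + 1/k ≥ 1`, replacing the exponent `a` by one only increases the
power. -/
theorem add_one_rpow_le {a : ℝ} (ha1 : a ≤ 1) {k : ℕ} (hk : 1 ≤ k) :
    ((k + 1 : ℕ) : ℝ) ^ a ≤ (k : ℝ) ^ a + (k : ℝ) ^ a / k := by
  have hk0 : (0 : ℝ) < k := by exact_mod_cast hk
  have e : ((k + 1 : ℕ) : ℝ) = k * (1 + 1 / k) := by push_cast; field_simp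
  rw [e, Real.mul_rpow hk0.le (by positivity)]
  have h1 : (1 + 1 / (k : ℝ)) ^ a ≤ (1 + 1 / (k : ℝ)) ^ (1 : ℝ) :=
    Real.rpow_le_rpow_of_exponent_le (le_add_of_nonneg_right (by positivity)) ha1
  rw [Real.rpow_one] at h1
  calc _ ≤ (k : ℝ) ^ a * (1 + 1 / k) := by gcongr
    _ = _ := by ring

theorem IsSchedule.scaleSchedule {ρ₀ σ₀ α₀ β₀ η₀ s t : ℝ} {ρ σ α β η : ℕ → ℝ}
    (h : IsSchedule ρ₀ σ₀ α₀ β₀ η₀ s t ρ σ α β η) (hρ₀ : 0 < ρ₀) (hσ₀ : 0 < σ₀) (hα₀ : 0 < α₀)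
    (hβ₀ : 0 < β₀) (hη₀ : 0 < η₀) (ht0 : 0 < t) (ht1 : t < 1) (hs0 : 0 < s) (hs1 : s < 1)
    (hst : 3 * t < s) (hts : 8 * t + s < 1) :
    ScaleSchedule ρ₀ σ₀ α₀ β₀ η₀ (fun k : ℕ => (k : ℝ) ^ t) (fun k : ℕ => (k : ℝ) ^ s)
      ρ σ α β η := by
  have hpos : ∀ k : ℕ, 1 ≤ k → (0 : ℝ) < k := fun k hk => by exact_mod_cast hk
  have hone : ∀ k : ℕ, 1 ≤ k → (1 : ℝ) ≤ k := fun k hk => by exact_mod_cast hk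
  refine ⟨hρ₀, hσ₀, hα₀, hβ₀, hη₀, fun k hk => Real.one_le_rpow (hone k hk) ht0.le,
    fun k hk => Real.one_le_rpow (hone k hk) hs0.le, fun k _ => ?_, fun k hk => ?_, fun k _ => ?_,
    fun k hk => ?_, (tendsto_rpow_atTop ht0).comp tendsto_natCast_atTop_atTop, ?_, ?_,
    h.ρ_eq, fun k hk => ?_, fun k hk => ?_, fun k hk => ?_, fun k hk => ?_⟩
  · exact Real.rpow_le_rpow (by positivity) (by push_cast; linarith) ht0.le
  · linarith [add_one_rpow_le ht1.le hk]
  · exact Real.rpow_le_rpow (by positivity) (by push_cast; linarith) hs0.le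
  · have := div_le_self (show 0 ≤ (k : ℝ) ^ s by positivity) (hone k hk)
    linarith [add_one_rpow_le hs1.le hk]
  · refine (tendsto_natCast_rpow_neg (a := 3 * t - s) (by linarith)).congr' ?_
    filter_upwards [eventually_ge_atTop 1] with k hk
    rw [Real.rpow_sub (hpos k hk), mul_comm, Real.rpow_mul (hpos k hk).le]
    norm_cast
  · refine (tendsto_natCast_rpow_neg (a := t * 8 + s - 1) (by linarith)).congr' ?_
    filter_upwards [eventually_ge_atTop 1] with k hk
    rw [Real.rpow_sub (hpos k hk), Real.rpow_add (hpos k hk), Real.rpow_mul (hpos k hk).le,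
      Real.rpow_one]
    norm_cast
  · rw [h.σ_eq k hk, Real.rpow_neg (hpos k hk).le, div_eq_mul_inv]
  · rw [h.α_eq k hk, show -6 * t - s = -(t * 6 + s) by ring, Real.rpow_neg (hpos k hk).le,
      Real.rpow_add (hpos k hk), Real.rpow_mul (hpos k hk).le, div_eq_mul_inv]
    norm_cast
  · rw [h.β_eq k hk, show -t - s = -(t + s) by ring, Real.rpow_neg (hpos k hk).le,
      Real.rpow_add (hpos k hk), div_eq_mul_inv]
  · rw [h.η_eq k hk, Real.rpow_neg (hpos k hk).le, div_eq_mul_inv]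

theorem ScaleSchedule.v_tendsto {ρ₀ σ₀ α₀ β₀ η₀ : ℝ} {u v ρ σ α β η : ℕ → ℝ}
    (S : ScaleSchedule ρ₀ σ₀ α₀ β₀ η₀ u v ρ σ α β η) : Tendsto v atTop atTop := by
  refine tendsto_atTop_mono' _ ?_ S.u_tendsto
  filter_upwards [eventually_ge_atTop 1, S.ratio_tendsto.eventually_le_const one_pos] with k hk h1
  have hu := S.one_le_u k hk
  rw [div_le_one (by linarith [S.one_le_v k hk])] at h1
  exact (le_self_pow₀ hu (by norm_num)).trans h1

theorem ScaleSchedule.abs_diff_le {ρ₀ σ₀ α₀ β₀ η₀ : ℝ} {u v ρ σ α β η : ℕ → ℝ}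
    (S : ScaleSchedule ρ₀ σ₀ α₀ β₀ η₀ u v ρ σ α β η) {k : ℕ} (hk : 1 ≤ k) :
    |ρ k - ρ (k + 1)| ≤ ρ₀ * (u k / k) ∧ |σ k - σ (k + 1)| ≤ σ₀ / (u k * k) := by
  have hk0 : (0 : ℝ) < k := by exact_mod_cast hk
  have h1 := S.u_mono k hk
  have h2 := S.u_diff k hk
  have hu : 0 < u k := by linarith [S.one_le_u k hk]
  have hu' : 0 < u (k + 1) := by linarith
  have hρ₀ := S.ρ₀_pos
  have hσ₀ := S.σ₀_pos
  rw [S.ρ_eq k hk, S.ρ_eq (k + 1) (by omega), S.σ_eq k hk, S.σ_eq (k + 1) (by omega)]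
  constructor
  · rw [← mul_sub, abs_mul, abs_of_pos hρ₀, abs_sub_comm, abs_of_nonneg (by linarith)]
    gcongr
  · have e : σ₀ / u k - σ₀ / u (k + 1) = σ₀ * (u (k + 1) - u k) / (u k * u (k + 1)) := by
      field_simp
    rw [e, abs_of_nonneg (by have : 0 ≤ u (k + 1) - u k := by linarith
                             positivity)]
    calc _ ≤ σ₀ * (u k / k) / (u k * u k) := by gcongr
      _ = _ := by field_simp

section Run

variable {E G : Type*} [NormedAddCommGroup E] [InnerProductSpace ℝ E] [CompleteSpace E]
  [MeasurableSpace E] [BorelSpace E] [SecondCountableTopology E]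
  [NormedAddCommGroup G] [InnerProductSpace ℝ G] [CompleteSpace G]
  [MeasurableSpace G] [BorelSpace G] [SecondCountableTopology G] {p : ℕ}
  {X : Set E} {Y : Set G} {f : E → G → ℝ} {c : Fin p → E → G → ℝ} {L : ℝ}
  {Ξ Ω : Type*} [MeasurableSpace Ξ] {D : Measure Ξ} [IsProbabilityMeasure D] {F : Ξ → E → G → ℝ}
  [MeasurableSpace Ω] {P : Measure Ω} [IsProbabilityMeasure P] {ξy ξx : ℕ → Ω → Ξ}
  {ρ σ α β η : ℕ → ℝ} {x₀ : E} {y₀ : G} {x : ℕ → Ω → E} {y : ℕ → Ω → G} {dx : ℕ → Ω → E}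
  {ρ₀ σ₀ α₀ β₀ η₀ : ℝ} {u v : ℕ → ℝ}

/-- `E ‖y^k - y*_k(x^k)‖²`. -/
noncomputable def innerErr (Y : Set G) (f : E → G → ℝ) (c : Fin p → E → G → ℝ) (ρ σ : ℕ → ℝ)
    (x : ℕ → Ω → E) (y : ℕ → Ω → G) (P : Measure Ω) (k : ℕ) : ℝ :=
  ∫ ω, ‖y k ω - innerSol Y f c ρ σ x k ω‖ ^ 2 ∂P

/-- `E ‖d_x^k - ∇ₓψ_k(x^k, y^{k+1})‖²`. -/
noncomputable def dirErr (f : E → G → ℝ) (c : Fin p → E → G → ℝ) (ρ σ : ℕ → ℝ)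
    (x : ℕ → Ω → E) (y : ℕ → Ω → G) (dx : ℕ → Ω → E) (P : Measure Ω) (k : ℕ) : ℝ :=
  ∫ ω, ‖dirError f c ρ σ x y dx k ω‖ ^ 2 ∂P

/-- `E ‖x^{k+1} - x^k‖²`. -/
noncomputable def stepSq (x : ℕ → Ω → E) (P : Measure Ω) (k : ℕ) : ℝ :=
  ∫ ω, ‖x (k + 1) ω - x k ω‖ ^ 2 ∂P

namespace RunSetting

theorem inner_ascent_scaled (R : RunSetting X Y f c L D F P ξy ξx ρ σ α β η x₀ y₀ x y dx)
    (S : ScaleSchedule ρ₀ σ₀ α₀ β₀ η₀ u v ρ σ α β η) :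
    ∃ C > 0, ∀ᶠ k in atTop,
      ∫ ω, ‖y (k + 1) ω - innerSol Y f c ρ σ x k ω‖ ^ 2 ∂P ≤
        (1 - β₀ * σ₀ / (u k ^ 2 * v k)) * innerErr Y f c ρ σ x y P k + C / (u k * v k) ^ 2 := by
  obtain ⟨δ, hδ, hv⟩ := R.oracle.variance
  have hL := R.bounds.one_le
  have hρ₀ := S.ρ₀_pos
  have hσ₀ := S.σ₀_pos
  have hβ₀ := S.β₀_pos
  set M := (1 + ρ₀) * L + σ₀ with hM
  have hMpos : 0 < M := by positivity
  refine ⟨β₀ ^ 2 * δ ^ 2, by positivity, ?_⟩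
  filter_upwards [eventually_ge_atTop 1,
    S.ratio_tendsto.eventually_le_const (show 0 < σ₀ / (β₀ * M ^ 2) by positivity)] with k hk h1
  have hu := S.one_le_u k hk
  have hvk := S.one_le_v k hk
  have hstep := R.inner_error_ascent_le (fun x hx y hy => (hv x hx y hy).2) k
  change _ ≤ _ * innerErr Y f c ρ σ x y P k + _ at hstep
  have hD : 0 ≤ innerErr Y f c ρ σ x y P k := integral_nonneg fun _ => sq_nonneg _
  rw [S.ρ_eq k hk, S.σ_eq k hk, S.β_eq k hk] at hstep
  generalize innerErr Y f c ρ σ x y P k = d at *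
  generalize u k = U at *
  generalize v k = W at *
  have hUp : 0 < U := by linarith
  have hWp : 0 < W := by linarith
  refine hstep.trans ?_
  have e1 : (β₀ / (U * W)) ^ 2 * δ ^ 2 = β₀ ^ 2 * δ ^ 2 / (U * W) ^ 2 := by ring
  rw [e1]
  refine add_le_add (mul_le_mul_of_nonneg_right ?_ hD) le_rfl
  have h2 : (1 + ρ₀ * U) * L + σ₀ / U ≤ M * U := by
    have : σ₀ / U ≤ σ₀ * U := by
      rw [div_le_iff₀ hUp]; nlinarith [mul_le_mul hu hu zero_le_one hUp.le]
    rw [hM]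
    nlinarith [mul_le_mul_of_nonneg_right hu (show 0 ≤ L by linarith)]
  -- Since `u²/v` is eventually small, the quadratic loss in `β` takes at most half of the gain
  -- `2βσ`.
  have h3 : β₀ * M ^ 2 * U ^ 2 ≤ σ₀ * W := by
    rw [div_le_div_iff₀ hWp (by positivity)] at h1
    have : U ^ 2 ≤ U ^ 3 := pow_le_pow_right₀ hu (by norm_num)
    nlinarith [mul_le_mul_of_nonneg_left this (show 0 ≤ β₀ * M ^ 2 by positivity)]
  have h4 : (β₀ / (U * W)) ^ 2 * ((1 + ρ₀ * U) * L + σ₀ / U) ^ 2 ≤ β₀ * σ₀ / (U ^ 2 * W) := by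
    calc _ ≤ (β₀ / (U * W)) ^ 2 * (M * U) ^ 2 := by gcongr
      _ = β₀ * (β₀ * M ^ 2 * U ^ 2) / (U ^ 2 * W ^ 2) := by field_simp
      _ ≤ β₀ * (σ₀ * W) / (U ^ 2 * W ^ 2) := by gcongr
      _ = _ := by field_simp
  have e2 : 2 * (β₀ / (U * W)) * (σ₀ / U) = 2 * (β₀ * σ₀ / (U ^ 2 * W)) := by field_simp
  linarith

/-- With `θ` half of the contraction rate, `(1 + θ)(1 - 2θ) ≤ 1 - θ`. The drift is multiplied by `1
+ 1/θ`, of order `u²v`, and the squared Lipschitz constant of `y*` has order `u⁴`; this produces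
`u⁶v`. -/
theorem innerErr_recursion (R : RunSetting X Y f c L D F P ξy ξx ρ σ α β η x₀ y₀ x y dx)
    (S : ScaleSchedule ρ₀ σ₀ α₀ β₀ η₀ u v ρ σ α β η) :
    ∃ C > 0, ∀ᶠ k : ℕ in atTop, innerErr Y f c ρ σ x y P (k + 1) ≤
      (1 - β₀ * σ₀ / 2 / (u k ^ 2 * v k)) * innerErr Y f c ρ σ x y P k +
      C * (1 / (u k * v k) ^ 2 + u k ^ 6 * v k * stepSq x P k + u k ^ 6 * v k / k ^ 2) := by
  obtain ⟨C, hC, hasc⟩ := R.inner_ascent_scaled S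
  have hL := R.bounds.one_le
  have hρ₀ := S.ρ₀_pos
  have hσ₀ := S.σ₀_pos
  have hβ₀ := S.β₀_pos
  set A := (1 + ρ₀) * L / σ₀ with hA
  set b := (ρ₀ + σ₀) * L / σ₀ with hb
  have hApos : 0 < A := by positivity
  have hbpos : 0 < b := by positivity
  set w := β₀ * σ₀ / 2 with hw
  have hwpos : 0 < w := by positivity
  refine ⟨2 * C + 4 * A ^ 2 / w + 4 * b ^ 2 / w, by positivity, ?_⟩
  filter_upwards [eventually_ge_atTop 1, hasc, S.u_tendsto.eventually_ge_atTop w] with k hk h1 h2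
  have hk0 : (0 : ℝ) < k := by exact_mod_cast hk
  have hu := S.one_le_u k hk
  have hvk := S.one_le_v k hk
  have hUp : 0 < u k := by linarith
  have hWp : 0 < v k := by linarith
  have hθ : 0 < w / (u k ^ 2 * v k) := by positivity
  have hdr := R.inner_error_drift_le k hθ
  change innerErr Y f c ρ σ x y P (k + 1) ≤ _ + _ * (_ * stepSq x P k + _) at hdr
  refine hdr.trans ?_
  have hD : 0 ≤ innerErr Y f c ρ σ x y P k := integral_nonneg fun _ => sq_nonneg _
  have hX : 0 ≤ stepSq x P k := integral_nonneg fun _ => sq_nonneg _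
  obtain ⟨hρd, hσd⟩ := S.abs_diff_le hk
  have hA' : (1 + ρ k) * L / σ k ≤ A * u k ^ 2 := by
    rw [S.ρ_eq k hk, S.σ_eq k hk, hA]
    calc (1 + ρ₀ * u k) * L / (σ₀ / u k) ≤ (1 * u k + ρ₀ * u k) * L / (σ₀ / u k) := by
          gcongr; linarith
      _ = _ := by field_simp
  have hb' : (|ρ k - ρ (k + 1)| * L + |σ k - σ (k + 1)| * L) / σ k ≤ b * (u k ^ 2 / k) := by
    have h3 : σ₀ / (u k * k) ≤ σ₀ * (u k / k) := by
      rw [← div_div, mul_div_assoc']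
      gcongr
      rw [div_le_iff₀ hUp]; nlinarith [mul_le_mul hu hu zero_le_one hUp.le]
    rw [S.σ_eq k hk, hb] at *
    calc _ ≤ (ρ₀ * (u k / k) * L + σ₀ * (u k / k) * L) / (σ₀ / u k) := by
          gcongr; exact hσd.trans h3
      _ = _ := by field_simp
  have hApos' : 0 ≤ (1 + ρ k) * L / σ k := by
    have := R.ρ_pos k; have := R.σ_pos k; positivity
  have hbpos' : 0 ≤ (|ρ k - ρ (k + 1)| * L + |σ k - σ (k + 1)| * L) / σ k := by
    have := R.σ_pos k; positivity
  generalize ((1 + ρ k) * L / σ k) = A' at *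
  generalize ((|ρ k - ρ (k + 1)| * L + |σ k - σ (k + 1)| * L) / σ k) = b' at *
  generalize ∫ ω, ‖y (k + 1) ω - innerSol Y f c ρ σ x k ω‖ ^ 2 ∂P = d' at *
  generalize innerErr Y f c ρ σ x y P k = d at *
  generalize stepSq x P k = X' at *
  generalize u k = U at *
  generalize v k = W at *
  set θ := w / (U ^ 2 * W) with hθdef
  have hθ1 : θ ≤ 1 := by
    rw [hθdef, div_le_one (by positivity)]
    calc w ≤ U := h2
      _ ≤ U ^ 2 * W := by nlinarith [mul_le_mul hu hvk zero_le_one hUp.le]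
  have e2 : β₀ * σ₀ / (U ^ 2 * W) = 2 * θ := by rw [hθdef, hw]; ring
  rw [e2] at h1
  have s1 : (1 + θ) * d' ≤ (1 - θ) * d + 2 * C * (1 / (U * W) ^ 2) := by
    have h3 : (1 + θ) * d' ≤ (1 + θ) * ((1 - 2 * θ) * d + C / (U * W) ^ 2) :=
      mul_le_mul_of_nonneg_left h1 (by positivity)
    have h4 : (1 + θ) * (C / (U * W) ^ 2) ≤ 2 * (C / (U * W) ^ 2) :=
      mul_le_mul_of_nonneg_right (by linarith) (by positivity)
    have h5 : (1 + θ) * (1 - 2 * θ) * d ≤ (1 - θ) * d :=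
      mul_le_mul_of_nonneg_right (by nlinarith [sq_nonneg θ]) hD
    have e3 : 2 * C * (1 / (U * W) ^ 2) = 2 * (C / (U * W) ^ 2) := by ring
    linarith
  have s2 : (1 + 1 / θ) ≤ 2 * (U ^ 2 * W) / w := by
    have h3 : 1 ≤ 1 / θ := (one_le_div hθ).2 hθ1
    have e3 : 1 / θ = U ^ 2 * W / w := by rw [hθdef, one_div_div]
    rw [mul_div_assoc, ← e3]
    linarith
  have s3 : (1 + 1 / θ) * (2 * A' ^ 2 * X' + 2 * b' ^ 2) ≤
      4 * A ^ 2 / w * (U ^ 6 * W * X') + 4 * b ^ 2 / w * (U ^ 6 * W / k ^ 2) := by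
    calc _ ≤ 2 * (U ^ 2 * W) / w * (2 * (A * U ^ 2) ^ 2 * X' + 2 * (b * (U ^ 2 / k)) ^ 2) := by
          gcongr
      _ = _ := by field_simp; ring
  have t1 : 0 ≤ 1 / (U * W) ^ 2 := by positivity
  have t2 : 0 ≤ U ^ 6 * W * X' := by positivity
  have t3 : 0 ≤ U ^ 6 * W / (k : ℝ) ^ 2 := by positivity
  have t4 : 0 < 4 * A ^ 2 / w := by positivity
  have t5 : 0 < 4 * b ^ 2 / w := by positivity
  have t6 : 2 * C * (1 / (U * W) ^ 2) + (4 * A ^ 2 / w * (U ^ 6 * W * X') +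
      4 * b ^ 2 / w * (U ^ 6 * W / k ^ 2)) ≤ (2 * C + 4 * A ^ 2 / w + 4 * b ^ 2 / w) *
        (1 / (U * W) ^ 2 + U ^ 6 * W * X' + U ^ 6 * W / k ^ 2) := by
    generalize 4 * A ^ 2 / w = a1 at *
    generalize 4 * b ^ 2 / w = a2 at *
    generalize 1 / (U * W) ^ 2 = r1 at *
    generalize U ^ 6 * W * X' = r2 at *
    generalize U ^ 6 * W / (k : ℝ) ^ 2 = r3 at *
    have q1 := mul_nonneg hC.le t2
    have q2 := mul_nonneg hC.le t3
    have q3 := mul_nonneg t4.le t1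
    have q4 := mul_nonneg t4.le t3
    have q5 := mul_nonneg t5.le t1
    have q6 := mul_nonneg t5.le t2
    linarith
  linarith

/-- The `y`-step has second moment of order `β²ρ²`, that is `v⁻²`, the same as the noise `η²`. The
parameters sit at index `k + 1`; doubling of `v` moves the contraction back to index `k` at the
price of a factor 2. -/
theorem dirErr_recursion (R : RunSetting X Y f c L D F P ξy ξx ρ σ α β η x₀ y₀ x y dx)
    (S : ScaleSchedule ρ₀ σ₀ α₀ β₀ η₀ u v ρ σ α β η) :
    ∃ C > 0, ∀ᶠ k : ℕ in atTop, dirErr f c ρ σ x y dx P (k + 1) ≤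
      (1 - η₀ / 2 / v k) * dirErr f c ρ σ x y dx P k + C * (1 / v k ^ 2 + stepSq x P k) := by
  obtain ⟨δ, hδ, hv⟩ := R.oracle.variance
  obtain ⟨LF, -, hLF⟩ := R.oracle.mean_square_smooth
  have hL := R.bounds.one_le
  have hρ₀ := S.ρ₀_pos
  have hσ₀ := S.σ₀_pos
  have hβ₀ := S.β₀_pos
  have hη₀ := S.η₀_pos
  set K := 4 * LF ^ 2 + 8 * L ^ 2 with hK
  have hKpos : 0 < K := by positivity
  set M := (1 + ρ₀) * L + σ₀ * L with hM
  refine ⟨K + K * (β₀ ^ 2 * (M ^ 2 + δ ^ 2)) + 2 * η₀ ^ 2 * δ ^ 2, by positivity, ?_⟩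
  filter_upwards [eventually_ge_atTop 1, S.v_tendsto.eventually_ge_atTop η₀] with k hk hvη
  have hk1 : 1 ≤ k + 1 := by omega
  have hu := S.one_le_u (k + 1) hk1
  have hvk := S.one_le_v k hk
  have hvm := S.v_mono k hk
  have hvd := S.v_double k hk
  have hstep := (R.dirError_step (fun x hx y hy => (hv x hx y hy).1) hLF k
    (R.integrable_dirError k)).2
  have hys := R.y_step_le (fun x hx y hy => (hv x hx y hy).2) (k + 1)
  change dirErr f c ρ σ x y dx P (k + 1) ≤ _ * dirErr f c ρ σ x y dx P k +
    _ * (stepSq x P k + _) + _ at hstep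
  refine hstep.trans ?_
  have hE : 0 ≤ dirErr f c ρ σ x y dx P k := integral_nonneg fun _ => sq_nonneg _
  have hX : 0 ≤ stepSq x P k := integral_nonneg fun _ => sq_nonneg _
  rw [S.ρ_eq (k + 1) hk1, S.σ_eq (k + 1) hk1, S.β_eq (k + 1) hk1] at hys
  rw [S.η_eq (k + 1) hk1]
  change ∫ ω, ‖y (k + 2) ω - y (k + 1) ω‖ ^ 2 ∂P ≤ _ at hys
  generalize ∫ ω, ‖y (k + 2) ω - y (k + 1) ω‖ ^ 2 ∂P = s at *
  generalize dirErr f c ρ σ x y dx P k = e at *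
  generalize stepSq x P k = X' at *
  generalize u (k + 1) = U at *
  generalize v (k + 1) = W' at *
  generalize v k = W at *
  have hUp : 0 < U := by linarith
  have hWp : 0 < W := by linarith
  have hWp' : 0 < W' := by linarith
  have s1 : s ≤ β₀ ^ 2 * (M ^ 2 + δ ^ 2) * (1 / W ^ 2) := by
    have h2 : (1 + ρ₀ * U) * L + σ₀ / U * L ≤ M * U := by
      have : σ₀ / U ≤ σ₀ * U := by
        rw [div_le_iff₀ hUp]; nlinarith [mul_le_mul hu hu zero_le_one hUp.le]
      rw [hM]
      nlinarith [mul_le_mul_of_nonneg_right hu (show 0 ≤ L by linarith),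
        mul_le_mul_of_nonneg_right this (show 0 ≤ L by linarith)]
    have h3 : δ ^ 2 ≤ δ ^ 2 * U ^ 2 := le_mul_of_one_le_right (sq_nonneg _) (one_le_pow₀ hu)
    calc s ≤ (β₀ / (U * W')) ^ 2 * (((1 + ρ₀ * U) * L + σ₀ / U * L) ^ 2 + δ ^ 2) := hys
      _ ≤ (β₀ / (U * W')) ^ 2 * ((M * U) ^ 2 + δ ^ 2 * U ^ 2) := by gcongr
      _ = β₀ ^ 2 * (M ^ 2 + δ ^ 2) * (1 / W' ^ 2) := by field_simp
      _ ≤ _ := by gcongr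
  have hη1 : η₀ / W' ≤ 1 := by rw [div_le_one hWp']; linarith
  have hη0 : 0 < η₀ / W' := by positivity
  have hη2 : η₀ / 2 / W ≤ η₀ / W' := by
    rw [div_div]; gcongr
  have hη3 : (η₀ / W') ^ 2 ≤ η₀ ^ 2 * (1 / W ^ 2) := by
    rw [div_pow, div_eq_mul_one_div]; gcongr
  have s2 : (1 - η₀ / W') ^ 2 * e ≤ (1 - η₀ / 2 / W) * e := by
    refine mul_le_mul_of_nonneg_right ?_ hE
    have h1 : (η₀ / W') ^ 2 ≤ η₀ / W' := by
      -- For `η ≤ 1` one has `(1 - η)² ≤ 1 - η`.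
      rw [sq]; exact mul_le_of_le_one_right hη0.le hη1
    have h2 : (1 - η₀ / W') ^ 2 = 1 - 2 * (η₀ / W') + (η₀ / W') ^ 2 := by ring
    linarith
  have s3 : K * (X' + s) ≤ K * X' + K * (β₀ ^ 2 * (M ^ 2 + δ ^ 2)) * (1 / W ^ 2) := by
    rw [mul_add, mul_assoc K]
    gcongr
  have s4 : 2 * (η₀ / W') ^ 2 * δ ^ 2 ≤ 2 * η₀ ^ 2 * δ ^ 2 * (1 / W ^ 2) := by
    calc _ ≤ 2 * (η₀ ^ 2 * (1 / W ^ 2)) * δ ^ 2 := by gcongr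
      _ = _ := by ring
  have hr : 0 ≤ 1 / W ^ 2 := by positivity
  have q0 : 0 ≤ K * (β₀ ^ 2 * (M ^ 2 + δ ^ 2)) := by positivity
  have q1 : 0 ≤ 2 * η₀ ^ 2 * δ ^ 2 := by positivity
  generalize K * (β₀ ^ 2 * (M ^ 2 + δ ^ 2)) = a1 at *
  generalize 2 * η₀ ^ 2 * δ ^ 2 = a2 at *
  generalize 1 / W ^ 2 = r at *
  have q2 := mul_nonneg q0 hX
  have q3 := mul_nonneg q1 hX
  have q4 := mul_nonneg hKpos.le hr
  linarith

/-- The Lipschitz constant of `∇φ` is of order `u³`, far below `1/α` of order `u⁶v`. It is absorbed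
by a further quarter of `1/α`, so half remains. -/
theorem phi_recursion (R : RunSetting X Y f c L D F P ξy ξx ρ σ α β η x₀ y₀ x y dx)
    (S : ScaleSchedule ρ₀ σ₀ α₀ β₀ η₀ u v ρ σ α β η) :
    ∃ C > 0, ∀ᶠ k : ℕ in atTop, ∫ ω, phi Y f c (ρ (k + 1)) (σ (k + 1)) (x (k + 1) ω) ∂P ≤
      ∫ ω, phi Y f c (ρ k) (σ k) (x k ω) ∂P - 1 / (2 * α₀) * (u k ^ 6 * v k) * stepSq x P k +
      C / (u k ^ 6 * v k) * (dirErr f c ρ σ x y dx P k +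
        u k ^ 2 * innerErr Y f c ρ σ x y P k + 1 / v k ^ 2) + C / (u k * k) := by
  obtain ⟨C, hC, hasc⟩ := R.inner_ascent_scaled S
  have hL := R.bounds.one_le
  have hρ₀ := S.ρ₀_pos
  have hσ₀ := S.σ₀_pos
  have hβ₀ := S.β₀_pos
  have hα₀ := S.α₀_pos
  set r := (1 + ρ₀) * L with hr
  have hrpos : 0 < r := by positivity
  set K := r * (1 + r / σ₀) with hK
  have hKpos : 0 < K := by positivity
  refine ⟨α₀ * (2 + 2 * r ^ 2 + 2 * r ^ 2 * C) + σ₀ * L ^ 2, by positivity, ?_⟩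
  filter_upwards [eventually_ge_atTop 1, hasc,
    S.u_tendsto.eventually_ge_atTop (4 * α₀ * K)] with k hk h1 h2
  have hk0 : (0 : ℝ) < k := by exact_mod_cast hk
  have hu := S.one_le_u k hk
  have hvk := S.one_le_v k hk
  have hρm : ρ k ≤ ρ (k + 1) := by
    rw [S.ρ_eq k hk, S.ρ_eq (k + 1) (by omega)]
    exact mul_le_mul_of_nonneg_left (S.u_mono k hk) hρ₀.le
  have hstep := R.phi_descent k hρm
  change _ ≤ _ - _ * stepSq x P k + α k * (2 * dirErr f c ρ σ x y dx P k + _) + _ at hstep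
  refine hstep.trans ?_
  have hE : 0 ≤ dirErr f c ρ σ x y dx P k := integral_nonneg fun _ => sq_nonneg _
  have hX : 0 ≤ stepSq x P k := integral_nonneg fun _ => sq_nonneg _
  have hD : 0 ≤ innerErr Y f c ρ σ x y P k := integral_nonneg fun _ => sq_nonneg _
  have hσd := (S.abs_diff_le hk).2
  generalize |σ k - σ (k + 1)| = ds at *
  rw [S.ρ_eq k hk, S.σ_eq k hk, S.α_eq k hk]
  generalize ∫ ω, phi Y f c (ρ₀ * u k) (σ₀ / u k) (x k ω) ∂P = φ at *
  generalize ∫ ω, ‖y (k + 1) ω - innerSol Y f c ρ σ x k ω‖ ^ 2 ∂P = d' at *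
  generalize innerErr Y f c ρ σ x y P k = d at *
  generalize dirErr f c ρ σ x y dx P k = e at *
  generalize stepSq x P k = X' at *
  generalize u k = U at *
  generalize v k = W at *
  have hUp : 0 < U := by linarith
  have hWp : 0 < W := by linarith
  have hr' : (1 + ρ₀ * U) * L ≤ r * U := by
    rw [hr]; nlinarith [mul_le_mul_of_nonneg_right hu (show 0 ≤ L by linarith)]
  have hq1 : U ^ 4 ≤ U ^ 6 * W := (pow_le_pow_right₀ hu (by norm_num)).trans
    (le_mul_of_one_le_right (by positivity) hvk)
  have hK' : phiLip L (ρ₀ * U) (σ₀ / U) ≤ K * U ^ 3 := by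
    rw [phiLip, hK]
    calc (1 + ρ₀ * U) * L * (1 + (1 + ρ₀ * U) * L / (σ₀ / U))
        ≤ r * U * (1 * U ^ 2 + r * U / (σ₀ / U)) := by
          gcongr
          rw [one_mul]
          exact one_le_pow₀ hu
      _ = _ := by field_simp
  have s1 : 1 / (2 * α₀) * (U ^ 6 * W) * X' ≤
      (3 / (4 * (α₀ / (U ^ 6 * W))) - phiLip L (ρ₀ * U) (σ₀ / U)) * X' := by
    refine mul_le_mul_of_nonneg_right ?_ hX
    have e1 : 3 / (4 * (α₀ / (U ^ 6 * W))) =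
        1 / (2 * α₀) * (U ^ 6 * W) + 1 / (4 * α₀) * (U ^ 6 * W) := by field_simp; norm_num
    have e2 : K * U ^ 3 ≤ 1 / (4 * α₀) * (U ^ 6 * W) := by
      rw [one_div, le_inv_mul_iff₀ (by positivity)]
      calc 4 * α₀ * (K * U ^ 3) = (4 * α₀ * K) * U ^ 3 := by ring
        _ ≤ U * U ^ 3 := by gcongr
        _ = U ^ 4 := by ring
        _ ≤ _ := hq1
    linarith
  -- The contraction may be dropped here; the added variance, multiplied by `u²`, becomes the term
  -- `v⁻²`.
  have s2 : d' ≤ d + C / (U * W) ^ 2 := by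
    have : 0 ≤ β₀ * σ₀ / (U ^ 2 * W) * d := by positivity
    linarith
  set q := U ^ 6 * W with hq
  have hqp : 0 < q := by positivity
  have s3 : α₀ / q * (2 * e + 2 * ((1 + ρ₀ * U) * L) ^ 2 * d') ≤
      α₀ * (2 + 2 * r ^ 2 + 2 * r ^ 2 * C) / q * (e + U ^ 2 * d + 1 / W ^ 2) := by
    have h3 : 2 * ((1 + ρ₀ * U) * L) ^ 2 * d' ≤ 2 * (r * U) ^ 2 * (d + C / (U * W) ^ 2) := by
      calc _ ≤ 2 * ((1 + ρ₀ * U) * L) ^ 2 * (d + C / (U * W) ^ 2) := by gcongr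
        _ ≤ _ := by gcongr
    have e3 : 2 * (r * U) ^ 2 * (d + C / (U * W) ^ 2) =
        2 * r ^ 2 * (U ^ 2 * d) + 2 * r ^ 2 * C * (1 / W ^ 2) := by field_simp
    have e4 : α₀ * (2 + 2 * r ^ 2 + 2 * r ^ 2 * C) / q * (e + U ^ 2 * d + 1 / W ^ 2) =
        α₀ / q * ((2 + 2 * r ^ 2 + 2 * r ^ 2 * C) * (e + U ^ 2 * d + 1 / W ^ 2)) := by ring
    rw [e4]
    refine mul_le_mul_of_nonneg_left ?_ (by positivity)
    rw [e3] at h3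
    have t1 : 0 ≤ U ^ 2 * d := by positivity
    have t2 : 0 ≤ 1 / W ^ 2 := by positivity
    have t3 : 0 ≤ 2 * r ^ 2 := by positivity
    have t4 : 0 ≤ 2 * r ^ 2 * C := by positivity
    generalize 2 * r ^ 2 * C = a2 at *
    generalize 2 * r ^ 2 = a1 at *
    have := mul_nonneg t3 hE
    have := mul_nonneg t4 hE
    have := mul_nonneg t4 t1
    have := mul_nonneg t3 t2
    linarith
  have s4 : ds * L ^ 2 ≤ σ₀ * L ^ 2 / (U * k) := by
    calc ds * L ^ 2 ≤ σ₀ / (U * k) * L ^ 2 := by gcongr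
      _ = _ := by ring
  have t1 : 0 ≤ e + U ^ 2 * d + 1 / W ^ 2 := by positivity
  have s5 : α₀ * (2 + 2 * r ^ 2 + 2 * r ^ 2 * C) / q * (e + U ^ 2 * d + 1 / W ^ 2) ≤
      (α₀ * (2 + 2 * r ^ 2 + 2 * r ^ 2 * C) + σ₀ * L ^ 2) / q * (e + U ^ 2 * d + 1 / W ^ 2) := by
    gcongr
    exact le_add_of_nonneg_right (by positivity)
  have s6 : σ₀ * L ^ 2 / (U * k) ≤
      (α₀ * (2 + 2 * r ^ 2 + 2 * r ^ 2 * C) + σ₀ * L ^ 2) / (U * k) := by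
    gcongr
    exact le_add_of_nonneg_left (by positivity)
  linarith

theorem frequently_error_lt (R : RunSetting X Y f c L D F P ξy ξx ρ σ α β η x₀ y₀ x y dx)
    (S : ScaleSchedule ρ₀ σ₀ α₀ β₀ η₀ u v ρ σ α β η) {ε : ℝ} (hε : 0 < ε) :
    ∃ᶠ k in atTop, (u k ^ 6 * v k) ^ 2 * stepSq x P k + dirErr f c ρ σ x y dx P k +
      u k ^ 2 * innerErr Y f c ρ σ x y P k < ε := by
  obtain ⟨C₁, hC₁, h₁⟩ := R.phi_recursion S
  obtain ⟨C₂, hC₂, h₂⟩ := R.innerErr_recursion S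
  obtain ⟨C₃, hC₃, h₃⟩ := R.dirErr_recursion S
  have hσ₀ := S.σ₀_pos
  have hβ₀ := S.β₀_pos
  have hα₀ := S.α₀_pos
  have hη₀ := S.η₀_pos
  have hE : ∀ k, 0 ≤ dirErr f c ρ σ x y dx P k := fun k => integral_nonneg fun _ => sq_nonneg _
  have hX : ∀ k, 0 ≤ stepSq x P k := fun k => integral_nonneg fun _ => sq_nonneg _
  have hD : ∀ k, 0 ≤ innerErr Y f c ρ σ x y P k := fun k => integral_nonneg fun _ => sq_nonneg _
  set b := min (1 / (2 * α₀)) (min (β₀ * σ₀ / 2) (η₀ / 2)) with hb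
  have hb1 : b ≤ 1 / (2 * α₀) := min_le_left _ _
  have hb2 : b ≤ β₀ * σ₀ / 2 := (min_le_right _ _).trans (min_le_left _ _)
  have hb3 : b ≤ η₀ / 2 := (min_le_right _ _).trans (min_le_right _ _)
  have hbpos : 0 < b := lt_min (by positivity) (lt_min (by positivity) (by positivity))
  set C := max C₁ (max C₂ C₃) with hC
  have hC1 : C₁ ≤ C := le_max_left _ _
  have hC2 : C₂ ≤ C := (le_max_left _ _).trans (le_max_right _ _)
  have hC3 : C₃ ≤ C := (le_max_right _ _).trans (le_max_right _ _)
  have hge := eventually_ge_atTop (α := ℕ) 1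
  refine frequently_lt_of_recursions (Φ := fun k => ∫ ω, phi Y f c (ρ k) (σ k) (x k ω) ∂P)
    (b := -L - σ₀ * L ^ 2) hbpos (hC₁.trans_le hC1) (hge.mono S.one_le_u) (hge.mono S.one_le_v)
    (hge.mono S.u_mono) S.u_tendsto S.ratio_tendsto S.u8_tendsto hD hE hX ?_ ?_ ?_ ?_ hε
  · filter_upwards [hge] with k hk
    refine le_trans ?_ (R.le_integral_phi k)
    have : σ k ≤ σ₀ := by rw [S.σ_eq k hk]; exact div_le_self hσ₀.le (S.one_le_u k hk)
    linarith [mul_le_mul_of_nonneg_right this (sq_nonneg L)]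
  · filter_upwards [hge, h₁] with k hk h
    have hu : 0 < u k := by linarith [S.one_le_u k hk]
    have hv : 0 < v k := by linarith [S.one_le_v k hk]
    have hX' := hX k
    have hE' := hE k
    have hD' := hD k
    refine h.trans ?_
    gcongr
  · filter_upwards [hge, h₂] with k hk h
    have hu : 0 < u k := by linarith [S.one_le_u k hk]
    have hv : 0 < v k := by linarith [S.one_le_v k hk]
    have hX' := hX k
    have hD' := hD k
    refine h.trans ?_
    gcongr
  · filter_upwards [hge, h₃] with k hk h
    have hv : 0 < v k := by linarith [S.one_le_v k hk]
    have hX' := hX k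
    have hE' := hE k
    refine h.trans ?_
    gcongr

end RunSetting

end Run

end SPACO

/-! ### Almost sure subsequences and the conclusion. -/

namespace SPACO

set_option maxSynthPendingDepth 3
set_option linter.unusedSectionVars false

open Filter Topology Set MeasureTheory ProbabilityTheory

/-- Nonnegative random variables with frequently small expectations tend to zero almost surely along
a subsequence. -/
theorem exists_subseq_ae_tendsto_zero {Ω : Type*} [MeasurableSpace Ω] {P : Measure Ω}
    {g : ℕ → Ω → ℝ} (hi : ∀ k, Integrable (g k) P) (h0 : ∀ k ω, 0 ≤ g k ω)
    (h : ∀ ε > 0, ∃ᶠ k in atTop, ∫ ω, g k ω ∂P < ε) :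
    ∃ κ : ℕ → ℕ, StrictMono κ ∧
      ∀ᵐ ω ∂P, Tendsto (fun j => g (κ j) ω) atTop (𝓝 0) := by
  obtain ⟨τ, hτ, hlt⟩ := extraction_forall_of_frequently
    (P := fun n k => ∫ ω, g k ω ∂P < 1 / ((n : ℝ) + 1)) fun n => h _ Nat.one_div_pos_of_nat
  have hlim : Tendsto (fun n => ∫ ω, g (τ n) ω ∂P) atTop (𝓝 0) :=
    squeeze_zero (fun n => integral_nonneg (h0 _)) (fun n => (hlt n).le)
      tendsto_one_div_add_atTop_nhds_zero_nat
  -- For nonnegative variables the mean is the `L¹` norm; convergence in `L¹` gives convergence in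
  -- measure, hence almost surely along a subsequence.
  have hLp : Tendsto (fun n => eLpNorm (g (τ n) - 0) 1 P) atTop (𝓝 0) := by
    have e : ∀ n, eLpNorm (g (τ n) - 0) 1 P = ENNReal.ofReal (∫ ω, g (τ n) ω ∂P) := by
      intro n
      rw [sub_zero, eLpNorm_one_eq_lintegral_enorm, ← ofReal_integral_norm_eq_lintegral_enorm (hi _)]
      congr 1
      exact integral_congr_ae (Eventually.of_forall fun ω => Real.norm_of_nonneg (h0 _ ω))
    simp_rw [e]
    simpa using ENNReal.tendsto_ofReal hlim
  have hm := tendstoInMeasure_of_tendsto_eLpNorm one_ne_zero (fun n => (hi (τ n)).1)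
    aestronglyMeasurable_zero hLp
  obtain ⟨ns, hns, hae⟩ := hm.exists_seq_tendsto_ae
  exact ⟨τ ∘ ns, hτ.comp hns, hae⟩

section Run

variable {E G : Type*} [NormedAddCommGroup E] [InnerProductSpace ℝ E] [CompleteSpace E]
  [MeasurableSpace E] [BorelSpace E] [SecondCountableTopology E]
  [NormedAddCommGroup G] [InnerProductSpace ℝ G] [CompleteSpace G]
  [MeasurableSpace G] [BorelSpace G] [SecondCountableTopology G] {p : ℕ}
  {X : Set E} {Y : Set G} {f : E → G → ℝ} {c : Fin p → E → G → ℝ} {L : ℝ}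
  {Ξ Ω : Type*} [MeasurableSpace Ξ] {D : Measure Ξ} [IsProbabilityMeasure D] {F : Ξ → E → G → ℝ}
  [MeasurableSpace Ω] {P : Measure Ω} [IsProbabilityMeasure P] {ξy ξx : ℕ → Ω → Ξ}
  {ρ σ α β η : ℕ → ℝ} {x₀ : E} {y₀ : G} {x : ℕ → Ω → E} {y : ℕ → Ω → G} {dx : ℕ → Ω → E}
  {ρ₀ σ₀ α₀ β₀ η₀ : ℝ} {u v : ℕ → ℝ}

/-- A bound for `‖𝒢_k(x^k)‖² + ‖y^k - y*_k(x^k)‖²`. -/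
noncomputable def stationarityGap (Y : Set G) (f : E → G → ℝ) (c : Fin p → E → G → ℝ) (L : ℝ)
    (ρ σ α : ℕ → ℝ) (x : ℕ → Ω → E) (y : ℕ → Ω → G) (dx : ℕ → Ω → E) (k : ℕ) (ω : Ω) : ℝ :=
  2 * (1 / α k) ^ 2 * ‖x (k + 1) ω - x k ω‖ ^ 2 + 4 * ‖dirError f c ρ σ x y dx k ω‖ ^ 2 +
    4 * ((1 + ρ k) * L) ^ 2 * ‖y (k + 1) ω - innerSol Y f c ρ σ x k ω‖ ^ 2 +
    ‖y k ω - innerSol Y f c ρ σ x k ω‖ ^ 2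

namespace RunSetting

theorem integral_stationarityGap (R : RunSetting X Y f c L D F P ξy ξx ρ σ α β η x₀ y₀ x y dx)
    (k : ℕ) : Integrable (stationarityGap Y f c L ρ σ α x y dx k) P ∧
      ∫ ω, stationarityGap Y f c L ρ σ α x y dx k ω ∂P =
        2 * (1 / α k) ^ 2 * stepSq x P k + 4 * dirErr f c ρ σ x y dx P k +
        4 * ((1 + ρ k) * L) ^ 2 * ∫ ω, ‖y (k + 1) ω - innerSol Y f c ρ σ x k ω‖ ^ 2 ∂P +
        innerErr Y f c ρ σ x y P k := by
  have i1 := (R.integrable_sq_x_step (k + 1) k).const_mul (2 * (1 / α k) ^ 2)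
  have i2 := (R.integrable_dirError k).const_mul 4
  have i3 := (R.integrable_sq_dist_inner (k + 1) k).const_mul (4 * ((1 + ρ k) * L) ^ 2)
  have i4 := R.integrable_sq_dist_inner k k
  refine ⟨((i1.add i2).add i3).add i4, ?_⟩
  refine (integral_add ((i1.add i2).add i3) i4).trans ?_
  refine congrArg₂ _ ((integral_add (i1.add i2) i3).trans ?_) rfl
  refine congrArg₂ _ ((integral_add i1 i2).trans ?_) (integral_const_mul _ _)
  exact congrArg₂ _ (integral_const_mul _ _) (integral_const_mul _ _)

/-- Since `1/α²` is a multiple of `(u⁶v)²`, the mean gap is at most a constant times the weighted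
errors plus `1/v`; each of the two is given `ε/(2K)`. -/
theorem frequently_stationarityGap_lt
    (R : RunSetting X Y f c L D F P ξy ξx ρ σ α β η x₀ y₀ x y dx)
    (S : ScaleSchedule ρ₀ σ₀ α₀ β₀ η₀ u v ρ σ α β η) {ε : ℝ} (hε : 0 < ε) :
    ∃ᶠ k in atTop, ∫ ω, stationarityGap Y f c L ρ σ α x y dx k ω ∂P < ε := by
  obtain ⟨C, hC, hasc⟩ := R.inner_ascent_scaled S
  have hL := R.bounds.one_le
  have hρ₀ := S.ρ₀_pos
  have hσ₀ := S.σ₀_pos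
  have hβ₀ := S.β₀_pos
  have hα₀ := S.α₀_pos
  set r := (1 + ρ₀) * L with hr
  set K := 2 / α₀ ^ 2 + 4 + 4 * r ^ 2 + 1 + 4 * r ^ 2 * C with hK
  have hKpos : 0 < K := by positivity
  have hfreq := R.frequently_error_lt S (show 0 < ε / (2 * K) by positivity)
  have hv2 : ∀ᶠ k in atTop, 1 / v k ≤ ε / (2 * K) := by
    have : Tendsto (fun k => 1 / v k) atTop (𝓝 0) := S.v_tendsto.const_div_atTop 1
    exact this.eventually_le_const (by positivity)
  refine (hfreq.and_eventually (hv2.and (hasc.and (eventually_ge_atTop 1)))).mono ?_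
  rintro k ⟨h1, h2, h3, hk⟩
  rw [(R.integral_stationarityGap k).2, S.α_eq k hk, S.ρ_eq k hk]
  have hu := S.one_le_u k hk
  have hvk := S.one_le_v k hk
  have hE : 0 ≤ dirErr f c ρ σ x y dx P k := integral_nonneg fun _ => sq_nonneg _
  have hX : 0 ≤ stepSq x P k := integral_nonneg fun _ => sq_nonneg _
  have hD : 0 ≤ innerErr Y f c ρ σ x y P k := integral_nonneg fun _ => sq_nonneg _
  generalize ∫ ω, ‖y (k + 1) ω - innerSol Y f c ρ σ x k ω‖ ^ 2 ∂P = d' at *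
  generalize innerErr Y f c ρ σ x y P k = d at *
  generalize dirErr f c ρ σ x y dx P k = e at *
  generalize stepSq x P k = X' at *
  generalize u k = U at *
  generalize v k = W at *
  have hUp : 0 < U := by linarith
  have hWp : 0 < W := by linarith
  have hr' : (1 + ρ₀ * U) * L ≤ r * U := by
    rw [hr]; nlinarith [mul_le_mul_of_nonneg_right hu (show 0 ≤ L by linarith)]
  have s2 : d' ≤ d + C / (U * W) ^ 2 := by
    have : 0 ≤ β₀ * σ₀ / (U ^ 2 * W) * d := by positivity
    linarith
  have s1 : 2 * (1 / (α₀ / (U ^ 6 * W))) ^ 2 * X' = 2 / α₀ ^ 2 * ((U ^ 6 * W) ^ 2 * X') := by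
    field_simp
  have s3 : 4 * ((1 + ρ₀ * U) * L) ^ 2 * d' ≤ 4 * r ^ 2 * (U ^ 2 * d) + 4 * r ^ 2 * C * (1 / W) := by
    calc _ ≤ 4 * ((1 + ρ₀ * U) * L) ^ 2 * (d + C / (U * W) ^ 2) := by gcongr
      _ ≤ 4 * (r * U) ^ 2 * (d + C / (U * W) ^ 2) := by gcongr
      _ = 4 * r ^ 2 * (U ^ 2 * d) + 4 * r ^ 2 * C * (1 / W ^ 2) := by field_simp
      _ ≤ _ := by gcongr; exact le_self_pow₀ hvk two_ne_zero
  have s4 : d ≤ U ^ 2 * d := le_mul_of_one_le_left hD (one_le_pow₀ hu)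
  rw [s1]
  have t1 : 0 ≤ (U ^ 6 * W) ^ 2 * X' := by positivity
  have t2 : 0 ≤ U ^ 2 * d := by positivity
  have t3 : 0 ≤ 1 / W := by positivity
  have a1 : 0 ≤ 2 / α₀ ^ 2 := by positivity
  have a2 : 0 ≤ 4 * r ^ 2 := by positivity
  have a3 : 0 ≤ 4 * r ^ 2 * C := by positivity
  have hfin : 2 / α₀ ^ 2 * ((U ^ 6 * W) ^ 2 * X') + 4 * e + 4 * r ^ 2 * (U ^ 2 * d) +
      4 * r ^ 2 * C * (1 / W) + U ^ 2 * d ≤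
        K * (((U ^ 6 * W) ^ 2 * X' + e + U ^ 2 * d) + 1 / W) := by
    rw [hK]
    generalize (U ^ 6 * W) ^ 2 * X' = b1 at *
    generalize U ^ 2 * d = b2 at *
    generalize 1 / W = b3 at *
    generalize 4 * r ^ 2 * C = c3 at *
    generalize 4 * r ^ 2 = c2 at *
    generalize 2 / α₀ ^ 2 = c1 at *
    have p1 := mul_nonneg a1 (add_nonneg (add_nonneg hE t2) t3)
    have p2 := mul_nonneg a2 (add_nonneg (add_nonneg t1 hE) t3)
    have p3 := mul_nonneg a3 (add_nonneg (add_nonneg t1 hE) t2)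
    linarith
  have hlt : K * (((U ^ 6 * W) ^ 2 * X' + e + U ^ 2 * d) + 1 / W) < ε := by
    calc _ < K * (ε / (2 * K) + ε / (2 * K)) :=
          mul_lt_mul_of_pos_left (add_lt_add_of_lt_of_le h1 h2) hKpos
      _ = ε := by field_simp; norm_num
  linarith

theorem exists_subseq_isKKT (R : RunSetting X Y f c L D F P ξy ξx ρ σ α β η x₀ y₀ x y dx)
    (S : ScaleSchedule ρ₀ σ₀ α₀ β₀ η₀ u v ρ σ α β η) :
    ∀ᵐ ω ∂P, ∃ (κ : ℕ → ℕ) (xbar : E) (ybar : G), StrictMono κ ∧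
      Tendsto (fun j => x (κ j) ω) atTop (𝓝 xbar) ∧
      Tendsto (fun j => y (κ j) ω) atTop (𝓝 ybar) ∧
      Tendsto (fun j => ‖residual X Y f c (ρ (κ j)) (σ (κ j)) (α (κ j)) (x (κ j) ω)‖)
        atTop (𝓝 0) ∧
      (GPLCQ X Y c xbar ybar → IsKKT X Y f c xbar ybar) := by
  have H := R.std
  have hgap0 : ∀ k ω, 0 ≤ stationarityGap Y f c L ρ σ α x y dx k ω := fun k ω => by
    rw [stationarityGap]; positivity
  -- `τ` does not depend on the sample; only the refinement `τ'` below, obtained from compactness,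
  -- does.
  obtain ⟨τ, hτ, hae⟩ := exists_subseq_ae_tendsto_zero
    (fun k => (R.integral_stationarityGap k).1) hgap0
    (fun ε hε => R.frequently_stationarityGap_lt S hε)
  have hge := eventually_ge_atTop (α := ℕ) 1
  have hρt : Tendsto ρ atTop atTop :=
    (S.u_tendsto.const_mul_atTop S.ρ₀_pos).congr' (hge.mono fun k hk => (S.ρ_eq k hk).symm)
  have hσt : Tendsto σ atTop (𝓝 0) :=
    (S.u_tendsto.const_div_atTop σ₀).congr' (hge.mono fun k hk => (S.σ_eq k hk).symm)
  have hsmall : ∀ᶠ k in atTop, α k ≤ α₀ / u k ∧ ρ k * α k ≤ ρ₀ * α₀ / u k := by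
    filter_upwards [hge] with k hk
    have hu := S.one_le_u k hk
    have hv := S.one_le_v k hk
    have hu0 : 0 < u k := by linarith
    have hv0 : 0 < v k := by linarith
    have hα₀ := S.α₀_pos
    have hρ₀ := S.ρ₀_pos
    have h6 : u k * u k ≤ u k ^ 6 * v k := by
      calc u k * u k = u k ^ 2 := (sq _).symm
        _ ≤ u k ^ 6 := pow_le_pow_right₀ hu (by norm_num)
        _ ≤ _ := le_mul_of_one_le_right (by positivity) hv
    rw [S.α_eq k hk, S.ρ_eq k hk]
    constructor
    · gcongr
      exact le_trans (le_mul_of_one_le_left hu0.le hu) h6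
    · calc ρ₀ * u k * (α₀ / (u k ^ 6 * v k)) ≤ ρ₀ * u k * (α₀ / (u k * u k)) := by gcongr
        _ = _ := by field_simp
  have hαt : Tendsto α atTop (𝓝 0) :=
    squeeze_zero' (Eventually.of_forall fun k => (R.α_pos k).le) (hsmall.mono fun k h => h.1)
      (S.u_tendsto.const_div_atTop α₀)
  have hραt : Tendsto (fun k => ρ k * α k) atTop (𝓝 0) :=
    squeeze_zero' (Eventually.of_forall fun k => (mul_pos (R.ρ_pos k) (R.α_pos k)).le)
      (hsmall.mono fun k h => h.2) (S.u_tendsto.const_div_atTop (ρ₀ * α₀))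
  filter_upwards [hae] with ω hω
  obtain ⟨⟨xbar, ybar⟩, -, τ', hτ', hlim⟩ := (H.X_compact.prod H.Y_compact).tendsto_subseq
    (x := fun j => (x (τ j) ω, y (τ j) ω)) fun j => ⟨R.x_mem _ ω, R.y_mem _ ω⟩
  have hx : Tendsto (fun j => x (τ (τ' j)) ω) atTop (𝓝 xbar) :=
    (continuous_fst.tendsto _).comp hlim
  have hy : Tendsto (fun j => y (τ (τ' j)) ω) atTop (𝓝 ybar) :=
    (continuous_snd.tendsto _).comp hlim
  set κ := τ ∘ τ' with hκdef
  have hκ : StrictMono κ := hτ.comp hτ'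
  have hκt := hκ.tendsto_atTop
  have hgap : Tendsto (fun j => √(stationarityGap Y f c L ρ σ α x y dx (κ j) ω)) atTop (𝓝 0) := by
    have h := (hω.comp hτ'.tendsto_atTop).sqrt
    rw [Real.sqrt_zero] at h
    exact h
  have hres : Tendsto (fun j => ‖residual X Y f c (ρ (κ j)) (σ (κ j)) (α (κ j)) (x (κ j) ω)‖)
      atTop (𝓝 0) := by
    refine squeeze_zero (fun _ => norm_nonneg _) (fun j => Real.le_sqrt_of_sq_le ?_) hgap
    refine (R.residual_sq_le (κ j) ω).trans ?_
    rw [stationarityGap]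
    exact le_add_of_nonneg_right (sq_nonneg _)
  have hdist : Tendsto (fun j => ‖y (κ j) ω - innerSol Y f c ρ σ x (κ j) ω‖) atTop (𝓝 0) := by
    refine squeeze_zero (fun _ => norm_nonneg _) (fun j => Real.le_sqrt_of_sq_le ?_) hgap
    rw [stationarityGap]
    exact le_add_of_nonneg_left (by positivity)
  -- The optimality conditions hold at the inner solutions rather than at the iterates `y`; the
  -- vanishing gap gives both the same limit.
  have hsol : Tendsto (fun j => innerSol Y f c ρ σ x (κ j) ω) atTop (𝓝 ybar) := by
    have hy' : Tendsto (fun j => y (κ j) ω) atTop (𝓝 ybar) := hy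
    have h := hy'.sub (tendsto_zero_iff_norm_tendsto_zero.2 hdist)
    simpa only [sub_sub_cancel, sub_zero] using h
  exact ⟨κ, xbar, ybar, hκ, hx, hy, hres, R.bounds.isKKT_of_tendsto H (fun j => R.ρ_pos (κ j))
    (fun j => R.σ_pos (κ j)) (fun j => R.α_pos (κ j)) (hρt.comp hκt) (hσt.comp hκt)
    (hαt.comp hκt) (hραt.comp hκt) (fun j => R.x_mem (κ j) ω) hx hsol hres⟩

end RunSetting

end Run

end SPACO

theorem mainTheorem2 {n m p : ℕ}
    (X : Set (EuclideanSpace ℝ (Fin n))) (Y : Set (EuclideanSpace ℝ (Fin m)))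
    (f : EuclideanSpace ℝ (Fin n) → EuclideanSpace ℝ (Fin m) → ℝ)
    (c : Fin p → EuclideanSpace ℝ (Fin n) → EuclideanSpace ℝ (Fin m) → ℝ)
    (hfc : SPACO.StandingAssumptions X Y f c)
    {Ξ : Type*} [MeasurableSpace Ξ] (D : MeasureTheory.Measure Ξ)
    [MeasureTheory.IsProbabilityMeasure D]
    (F : Ξ → EuclideanSpace ℝ (Fin n) → EuclideanSpace ℝ (Fin m) → ℝ)
    (hF : SPACO.OracleAssumptions X Y D F f)
    {Ω : Type*} [MeasurableSpace Ω] (P : MeasureTheory.Measure Ω)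
    [MeasureTheory.IsProbabilityMeasure P]
    (ξy ξx : ℕ → Ω → Ξ) (hξ : SPACO.IsSampling P D ξy ξx)
    (ρ₀ σ₀ α₀ β₀ η₀ s t : ℝ)
    (hρ₀ : 0 < ρ₀) (hσ₀ : 0 < σ₀) (hα₀ : 0 < α₀) (hβ₀ : 0 < β₀) (hη₀ : 0 < η₀)
    (ht0 : 0 < t) (ht1 : t < 1) (hs0 : 0 < s) (hs1 : s < 1)
    (hst : 3 * t < s) (hts : 8 * t + s < 1) (hsum : 1 < 2 * s + 5 * t)
    (ρ σ α β η : ℕ → ℝ) (hpar : SPACO.IsSchedule ρ₀ σ₀ α₀ β₀ η₀ s t ρ σ α β η)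
    (x₀ : EuclideanSpace ℝ (Fin n)) (y₀ : EuclideanSpace ℝ (Fin m))
    (x : ℕ → Ω → EuclideanSpace ℝ (Fin n)) (y : ℕ → Ω → EuclideanSpace ℝ (Fin m))
    (dx : ℕ → Ω → EuclideanSpace ℝ (Fin n))
    (hrun : SPACO.IsSPACO X Y F c ρ σ α β η ξy ξx x₀ y₀ x y dx) :
    (∀ k, ∀ z ∈ X, DifferentiableAt ℝ (SPACO.phi Y f c (ρ k) (σ k)) z) ∧
    ∀ᵐ ω ∂P, ∃ (κ : ℕ → ℕ) (xbar : EuclideanSpace ℝ (Fin n)) (ybar : EuclideanSpace ℝ (Fin m)),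
      StrictMono κ ∧
      Filter.Tendsto (fun j => x (κ j) ω) Filter.atTop (nhds xbar) ∧
      Filter.Tendsto (fun j => y (κ j) ω) Filter.atTop (nhds ybar) ∧
      Filter.Tendsto
        (fun j => ‖SPACO.residual X Y f c (ρ (κ j)) (σ (κ j)) (α (κ j)) (x (κ j) ω)‖)
        Filter.atTop (nhds 0) ∧
      (SPACO.GPLCQ X Y c xbar ybar → SPACO.IsKKT X Y f c xbar ybar) := by
  obtain ⟨L, B⟩ := hfc.exists_problemBounds
  have R : SPACO.RunSetting X Y f c L D F P ξy ξx ρ σ α β η x₀ y₀ x y dx :=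
    ⟨hfc, B, hF, hξ, hrun, hpar.ρ_pos, hpar.σ_pos, hpar.α_pos, hpar.β_pos⟩
  have S := hpar.scaleSchedule hρ₀ hσ₀ hα₀ hβ₀ hη₀ ht0 ht1 hs0 hs1 hst hts
  exact ⟨fun k z hz => (hfc.hasGradientAt_phi hz (hpar.ρ_pos k).le (hpar.σ_pos k)).differentiableAt,
    R.exists_subseq_isKKT S⟩
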